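/- Let $\mathbb A=(A;R_1,\dots,R_n)$ be a relational structure with finite nonempty domain $A$ and nonempty relations $R_i\subseteq A^{k_i}$. Put $k=\sum_{i=1}^n k_i$ and let $R=R_1\times\dots\times R_n\subseteq A^k$ be the product relation. For $\mathcal I\subseteq\{1,\dots,k\}$ let $\mathbb Q_{\mathcal I}$ be the oriented path obtained by concatenating a single edge $\bullet\to\bullet$, then, for $l=1,\dots,k$ in this order, a single edge if $l\in\mathcal I$ and a zigzag $\bullet\to\bullet\leftarrow\bullet\to\bullet$ if $l\notin\mathcal I$, and finally a single edge. The digraph $\mathcal D(\mathbb A)$ is obtained from the digraph with vertex set the disjoint union $A\sqcup R$ and edge set $A\times R$ by replacing every edge $e=(a,\mathbf r)$ by a copy of the oriented path $\mathbb Q_{\{i\,:\,a=r_i\}}$ with initial vertex $a$ and terminal vertex $\mathbf r$ (interior vertices of different paths being distinct). A connected digraph is balanced if it has a level function, that is, a function $\mathrm{lvl}$ from the vertices to $\{0,1,2,\dots\}$ with minimum $0$ such that $\mathrm{lvl}(v)=\mathrm{lvl}(u)+1$ for every edge $u\to v$; the maximum of $\mathrm{lvl}$ is then called the height of the digraph.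 **Proposition.** (1) $\mathcal D(\mathbb A)$ has exactly $$(3k+1)|R||A|+(1-2k)|R|+|A|$$ vertices and exactly $$(3k+2)|R||A|-2k|R|$$ edges; it is connected and balanced, and its height is $k+2$. (2) For every fixed signature (that is, fixed $n$ and $k_1,\dots,k_n$), the construction of $\mathcal D(\mathbb A)$ from $\mathbb A$ can be performed in logarithmic space under any reasonable encodings of the structures and of digraphs. Precisely: the standard code of a structure of the given signature with domain $\{0,\dots,m-1\}$ is the binary word consisting of $1^m0$ followed by the truth tables of its relations. An encoding of finite structures (with nonempty domain and nonempty relations) by words over a finite alphabet, in which a structure may have several codes, is *reasonable* if some logspace transducer turns every code of any structure into the standard code of an isomorphic copy of it, and some logspace transducer turns the standard code of any structure into a code of an isomorphic copy of it. (A logspace transducer is a deterministic Turing machine with a two-way read-only input tape, finitely many work tapes, and a write-only output tape, which, on each of the inputs in question, halts and uses $O(\log N)$ cells of its work tapes, where $N$ is the length of the input.) Then, for every reasonable encoding of structures of the given signature and every reasonable encoding of digraphs (structures with one binary relation), there is a logspace transducer that turns every code of a structure $\mathbb A$ into a code of a digraph isomorphic to $\mathcal D(\mathbb A)$. -/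

import Mathlib

/-! ## Finite relational structures -/

/-- A relational structure `(A; R_1, …, R_n)` with domain `A`, whose signature consists of `n`
relation symbols, the `i`-th one of arity `ar i`. -/
structure RelStructure {n : ℕ} (ar : Fin n → ℕ) (A : Type*) where
  /-- the interpretation of the `i`-th relation symbol -/
  rel : ∀ i, Set (Fin (ar i) → A)

/-- Two structures over the same signature are isomorphic. -/
def RelStructure.Isomorphic {n : ℕ} {ar : Fin n → ℕ} {A B : Type*}
    (𝔸 : RelStructure ar A) (𝔹 : RelStructure ar B) : Prop :=
  ∃ φ : A ≃ B, ∀ i, ∀ t : Fin (ar i) → A, t ∈ 𝔸.rel i ↔ φ ∘ t ∈ 𝔹.rel i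

/-- The signature of digraphs: one binary relation symbol. -/
abbrev digraphSignature : Fin 1 → ℕ := fun _ => 2

/-- A digraph regarded as a relational structure with a single binary relation. -/
def Digraph.toRelStructure {V : Type*} (G : Digraph V) : RelStructure digraphSignature V where
  rel _ := {t | G.Adj (t 0) (t 1)}

/-- The product relation `R = R_1 × ⋯ × R_n`, of arity `k = k_1 + ⋯ + k_n`. A `k`-tuple is in `R`
iff its `i`-th block of length `k_i` is in `R_i`, for every `i`; `finSigmaFinEquiv` sends the
`j`-th position of the `i`-th block to the position `k_1 + ⋯ + k_{i-1} + j`. -/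
def RelStructure.prodRel {n : ℕ} {ar : Fin n → ℕ} {A : Type*} (𝔸 : RelStructure ar A) :
    Set (Fin (∑ i, ar i) → A) :=
  {r | ∀ i, (fun j => r (finSigmaFinEquiv ⟨i, j⟩)) ∈ 𝔸.rel i}

/-! ## The digraph `𝓓(𝔸)` -/

/-- An oriented path, given by the directions of its consecutive edges: the list `d_0, …, d_{l-1}`
stands for the path with vertices `v_0, …, v_l` in which there is an edge `v_j → v_{j+1}` if `d_j`
is `true` and an edge `v_{j+1} → v_j` if `d_j` is `false`. Concatenation of oriented paths
(identifying the terminal vertex of the first with the initial vertex of the second) is `++`. -/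
abbrev OrientedPath := List Bool

/-- The path `• → •`. -/
def OrientedPath.singleEdge : OrientedPath := [true]

/-- The path `• → • ← • → •`. -/
def OrientedPath.zigzag : OrientedPath := [true, false, true]

open Classical in
/-- The oriented path `ℚ_I`: a single edge, then for `l = 1, …, k` a single edge if `l ∈ I` and a
zigzag if `l ∉ I`, and finally a single edge. -/
noncomputable def pathQ {k : ℕ} (I : Set (Fin k)) : OrientedPath :=
  OrientedPath.singleEdge ++
    (List.finRange k).flatMap
      (fun l => if l ∈ I then OrientedPath.singleEdge else OrientedPath.zigzag) ++
    OrientedPath.singleEdge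

namespace RelStructure

variable {n : ℕ} {ar : Fin n → ℕ} {A : Type*} (𝔸 : RelStructure ar A)

/-- The oriented path `ℙ_e` for `e = (a, r)`, that is `ℚ_I` with `I = {i | a = r_i}`. -/
noncomputable def edgePath (e : A × 𝔸.prodRel) : OrientedPath :=
  pathQ {i | e.1 = e.2.1 i}

/-- The vertices of `𝓓(𝔸)`: the disjoint union of `A`, of `R`, and of the interior vertices
(numbered `1, …, l - 1`, where `l` is the number of edges) of the paths `ℙ_e`, `e ∈ A × R`. -/
abbrev DVertex : Type _ :=
  A ⊕ 𝔸.prodRel ⊕ (Σ e : A × 𝔸.prodRel, Set.Ioo 0 (𝔸.edgePath e).length)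

/-- The `j`-th vertex of the path `ℙ_e`, `e = (a, r)`, in `𝓓(𝔸)`: the initial vertex is `a`,
the terminal one is `r`. -/
noncomputable def pathVertex (e : A × 𝔸.prodRel) (j : ℕ) : 𝔸.DVertex :=
  if j = 0 then Sum.inl e.1
  else if h : j ∈ Set.Ioo 0 (𝔸.edgePath e).length then Sum.inr (Sum.inr ⟨e, j, h⟩)
  else Sum.inr (Sum.inl e.2)

/-- The digraph `𝓓(𝔸)`, obtained from `(A ∪ R; A × R)` by replacing every `e ∈ A × R` by `ℙ_e`. -/
noncomputable def toDigraph : Digraph 𝔸.DVertex where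
  Adj u v := ∃ (e : A × 𝔸.prodRel) (j : ℕ),
    ((𝔸.edgePath e)[j]? = some true ∧ u = 𝔸.pathVertex e j ∧ v = 𝔸.pathVertex e (j + 1)) ∨
    ((𝔸.edgePath e)[j]? = some false ∧ u = 𝔸.pathVertex e (j + 1) ∧ v = 𝔸.pathVertex e j)

end RelStructure

/-- A level function of a digraph: it increases by one along every edge and its minimum is `0`. -/
def Digraph.IsLevelFunction {V : Type*} (G : Digraph V) (lvl : V → ℕ) : Prop :=
  (∀ a b, G.Adj a b → lvl b = lvl a + 1) ∧ ∃ v, lvl v = 0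

/-- The digraph is connected (by oriented paths) and balanced, and its height, the maximum value
of its level function, is `h`. A connected digraph has at most one level function. -/
def Digraph.HasHeight {V : Type*} (G : Digraph V) (h : ℕ) : Prop :=
  G.toSimpleGraphInclusive.Connected ∧
    ∃ lvl : V → ℕ, G.IsLevelFunction lvl ∧ IsGreatest (Set.range lvl) h

/-! ## Logarithmic space: Turing machines with a two-way read-only input tape, finitely many
read-write work tapes, and a write-only output tape -/

/-- What the input head sees: an end marker or a letter of the input word. -/
inductive InputSymbol (Γ : Type)
  | leftEnd
  | letter (a : Γ)
  | rightEnd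

/-- Head movements. -/
inductive HeadMove
  | left
  | stay
  | right

/-- Apply a movement to a head on a one-way infinite tape; moving left from cell `0` has no
effect. -/
def HeadMove.apply : HeadMove → ℕ → ℕ
  | left, p => p - 1
  | stay, p => p
  | right, p => p + 1

/-- A deterministic multitape Turing transducer with input alphabet `Γ` and output alphabet `Δ`. -/
structure Transducer (Γ Δ : Type) where
  /-- control states -/
  State : Type
  /-- the index set of the work tapes -/
  Tape : Type
  /-- the work alphabet -/
  Sym : Type
  finite_state : Finite State
  finite_tape : Finite Tape
  finite_sym : Finite Sym
  start : State
  blank : Sym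
  /-- From the state, the scanned input symbol and the scanned work symbols, the machine either
  halts (`none`), or it chooses the next state, the movement of the input head, for each work tape
  the symbol to be written and the movement of the head, and possibly a letter to be appended to
  the output. -/
  step : State → InputSymbol Γ → (Tape → Sym) →
    Option (State × HeadMove × (Tape → Sym × HeadMove) × Option Δ)

namespace Transducer

variable {Γ Δ : Type} (M : Transducer Γ Δ)

/-- Configurations. -/
structure Config where
  state : M.State
  inputHead : ℕ
  work : M.Tape → ℕ → M.Sym
  head : M.Tape → ℕ
  output : List Δ

/-- The initial configuration: blank work tapes, empty output, all heads in cell `0`. -/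
def init : M.Config where
  state := M.start
  inputHead := 0
  work := fun _ _ => M.blank
  head := fun _ => 0
  output := []

/-- The contents of the cell `p` of the input tape for the input word `w`: the left end marker is
in cell `0`, the word in the cells `1, …, |w|`, and the right end marker in cell `|w| + 1`. -/
def inputCell (w : List Γ) : ℕ → InputSymbol Γ
  | 0 => .leftEnd
  | p + 1 => match w[p]? with
    | some a => .letter a
    | none => .rightEnd

/-- One step of the computation on input `w`; `none` if the machine halts. The input head does not
move beyond the end markers. -/
def next (w : List Γ) (c : M.Config) : Option M.Config :=
  (M.step c.state (inputCell w c.inputHead) (fun t => c.work t (c.head t))).map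
    fun (q, m, act, o) =>
      { state := q
        inputHead := min (m.apply c.inputHead) (w.length + 1)
        work := fun t => Function.update (c.work t) (c.head t) (act t).1
        head := fun t => (act t).2.apply (c.head t)
        output := c.output ++ o.toList }

/-- On input `w` the machine halts with output `v`, and each of its work heads visits only the
first `s` cells of its tape. -/
def ComputesInSpace (w : List Γ) (v : List Δ) (s : ℕ) : Prop :=
  (∃ c, StateTransition.Reaches (M.next w) M.init c ∧ M.next w c = none ∧ c.output = v) ∧
    ∀ c, StateTransition.Reaches (M.next w) M.init c → ∀ t, c.head t < s

end Transducer

/-- `C w x` means that the word `w` is a code of the object `x` (the input of the construction),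
and `C' v x` that the word `v` is a code of the object to be constructed from `x`. The construction
can be performed in logarithmic space: some transducer that uses `O(log |w|)` work space
turns every code `w` of every `x` into a code of the object to be constructed from `x`. -/
def LogspaceConstructible {Γ Δ : Type} {X : Type*} (C : List Γ → X → Prop)
    (C' : List Δ → X → Prop) : Prop :=
  ∃ (M : Transducer Γ Δ) (c : ℕ), ∀ (x : X) (w : List Γ), C w x →
    ∃ v, C' v x ∧ M.ComputesInSpace w v (c * (Nat.log 2 w.length + 1))

/-! ## Encodings of finite structures by words -/

/-- A finite structure with domain `{0, …, size - 1}`, where the domain and all relations are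
nonempty. -/
structure FinRelStructure {n : ℕ} (ar : Fin n → ℕ) where
  size : ℕ
  size_pos : 0 < size
  str : RelStructure ar (Fin size)
  rel_nonempty : ∀ i, (str.rel i).Nonempty

/-- An encoding of the finite structures over a signature by words over the alphabet `Γ`:
`E w 𝔹` means that the word `w` is a code of `𝔹`. A structure may have several codes. -/
abbrev Encoding {n : ℕ} (ar : Fin n → ℕ) (Γ : Type) : Type :=
  List Γ → FinRelStructure ar → Prop

namespace Encoding

variable {n : ℕ} {ar : Fin n → ℕ} {Γ : Type}

/-- The word `w` is a code of (an isomorphic copy with domain `{0, …, m - 1}` of) the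
structure `𝔸`. -/
def Codes (E : Encoding ar Γ) {A : Type*} (w : List Γ) (𝔸 : RelStructure ar A) : Prop :=
  ∃ 𝔹 : FinRelStructure ar, 𝔹.str.Isomorphic 𝔸 ∧ E w 𝔹

open Classical in
/-- The standard code of a structure with domain `{0, …, m - 1}`: the word `1^m 0` followed by the
tables of the relations, in order; the table of a relation of arity `p` consists of `m ^ p` bits,
and its `j`-th bit says whether the tuple of the `p` base-`m` digits of `j` is in the relation. -/
noncomputable def standardCode (𝔹 : FinRelStructure ar) : List Bool :=
  List.replicate 𝔹.size true ++ [false] ++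
    (List.finRange n).flatMap fun i =>
      (List.finRange (𝔹.size ^ ar i)).map fun j => decide (finFunctionFinEquiv.symm j ∈ 𝔹.str.rel i)

/-- The standard encoding. -/
def standard (ar : Fin n → ℕ) : Encoding ar Bool := fun w 𝔹 => w = standardCode 𝔹

/-- An encoding is reasonable if it and the standard encoding can be translated into each other in
logarithmic space. -/
def Reasonable (E : Encoding ar Γ) : Prop :=
  LogspaceConstructible (fun w (𝔸 : FinRelStructure ar) => E.Codes w 𝔸.str)
      (fun v 𝔸 => (standard ar).Codes v 𝔸.str) ∧
    LogspaceConstructible (fun w (𝔸 : FinRelStructure ar) => (standard ar).Codes w 𝔸.str)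
      (fun v 𝔸 => E.Codes v 𝔸.str)

end Encoding

/-! ## Functions computable with polynomially bounded counters -/

/-! Size and height. Fix a tuple `r`. For each position `l` exactly one `a` equals `r_l`, so over
all paths ending in `r` this position contributes `3|A| - 2` edges. Together with the two outer
edges of every path this gives the number of edges (`sum_length_edgePath`, `arc_injective`). A path
with `p` edges has `p - 1` interior vertices, which gives the number of vertices. A zigzag has the
same net rise as a single edge and never leaves the levels between its ends, so every path climbs
from level `0` to level `k + 2` whatever the set of positions is (`climbs_pathQ`). Hence the levels
of the paths fit together at the shared ends.

Logarithmic space. Logarithmic space amounts to finitely many counters with polynomially bounded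
values, and `LogFn` is the machine-free form of this: numerical functions built by recursion with
polynomially bounded values, with access to the letters of the input. A word function is a `LogWord`
if its length and its letters belong to this class. Two theorems link the class to Turing machines.
`LogWord.exists_transducer` turns recursions into while programs, these into programs with jumps,
and these into machines that keep the registers in binary on work tapes. `Transducer.exists_logWord`
goes back: a configuration of a logspace machine is a vector of polynomially bounded numbers, and a
halting run repeats no vector, so polynomially many rounds suffice.

In the class `LogFn`, composition is easy (`LogFn.comp`, `LogWord.comp`): the letters of an
intermediate word are recomputed whenever they are needed. It remains to get the standard code of
the digraph from the standard code of the structure. Vertices are numbered by triples, and adjacency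
is expressed by bounded quantifiers. For a fixed signature only finitely many oriented paths occur,
so they are handled by a case distinction (`PathDigraph.logWord_code`, `PathDigraph.codes_code`).
This map is placed between the two translations given by the reasonable encodings; isomorphic
structures yield isomorphic digraphs (`Isomorphic.toDigraph`), so the passage to isomorphic copies
is harmless. -/

/-- The points of a context carry an input word and finitely many numerical variables. -/
class Ctx (Γ : outParam Type) (α : Type) where
  /-- the input word -/
  word : α → List Γ
  /-- the variables -/
  vars : List (α → ℕ)

namespace Ctx

variable {Γ α : Type}

instance : Ctx Γ (List Γ) where
  word := id
  vars := []

instance [Ctx Γ α] : Ctx Γ (α × ℕ) where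
  word p := word p.1
  vars := Prod.snd :: vars.map (fun v p => v p.1)

noncomputable instance [Ctx Γ α] {ι : Type} [Fintype ι] : Ctx Γ (α × (ι → ℕ)) where
  word p := word p.1
  vars := Finset.univ.toList.map (fun i p => p.2 i) ++ vars.map (fun v p => v p.1)

/-- The size of a point of a context. -/
def size [Ctx Γ α] (a : α) : ℕ := (word a).length + (vars.map (fun v => v a)).sum + 2

/-- The summand `2` in `size` serves this bound: powers of a base that is at least `2` absorb
constants and sums. -/
lemma two_le_size [Ctx Γ α] (a : α) : 2 ≤ size a := Nat.le_add_left _ _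

lemma size_prod [Ctx Γ α] (p : α × ℕ) : size p = size p.1 + p.2 := by
  simp [size, word, vars, Function.comp_def]; omega

end Ctx

open Ctx

/-- A function on a context that is bounded by a polynomial in the size. -/
def PolyBounded {Γ α : Type} [Ctx Γ α] (f : α → ℕ) : Prop := ∃ e, ∀ a, f a ≤ size a ^ e

namespace PolyBounded

variable {Γ α : Type} [Ctx Γ α] {f g : α → ℕ}

lemma mono (hg : PolyBounded g) (h : ∀ a, f a ≤ g a) : PolyBounded f :=
  hg.imp fun _ he a => (h a).trans (he a)

lemma const (n : ℕ) : PolyBounded (fun _ : α => n) :=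
  ⟨n, fun a => (Nat.lt_two_pow_self).le.trans (Nat.pow_le_pow_left (two_le_size a) n)⟩

lemma size_bounded : PolyBounded (fun a : α => size a) := ⟨1, fun a => by simp⟩

lemma mul (hf : PolyBounded f) (hg : PolyBounded g) : PolyBounded (fun a => f a * g a) := by
  obtain ⟨d, hd⟩ := hf
  obtain ⟨e, he⟩ := hg
  exact ⟨d + e, fun a => by rw [pow_add]; exact Nat.mul_le_mul (hd a) (he a)⟩

lemma add (hf : PolyBounded f) (hg : PolyBounded g) : PolyBounded (fun a => f a + g a) := by
  obtain ⟨d, hd⟩ := hf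
  obtain ⟨e, he⟩ := hg
  -- The additional factor `size a`, being at least `2`, pays for having two summands.
  refine ⟨d + e + 1, fun a => ?_⟩
  have h2 := two_le_size a
  have h3 : size a ^ d ≤ size a ^ (d + e) := Nat.pow_le_pow_right (by omega) (by omega)
  have h4 : size a ^ e ≤ size a ^ (d + e) := Nat.pow_le_pow_right (by omega) (by omega)
  rw [pow_succ]
  nlinarith [hd a, he a]

lemma pow (hf : PolyBounded f) (n : ℕ) : PolyBounded (fun a => f a ^ n) := by
  induction n with
  | zero => simpa using const 1
  | succ n ih => simpa [pow_succ] using ih.mul hf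

/-- Substitution of points of polynomial size. -/
lemma comp {Δ β : Type} [Ctx Δ β] {φ : β → α} (hf : PolyBounded f)
    (hφ : PolyBounded (fun b => size (φ b))) : PolyBounded (fun b => f (φ b)) := by
  obtain ⟨e, he⟩ := hf
  exact (hφ.pow e).mono fun b => he _

lemma letIn {g : α × ℕ → ℕ} (hg : PolyBounded g) (hf : PolyBounded f) :
    PolyBounded (fun a => g (a, f a)) :=
  hg.comp (φ := fun a => (a, f a)) (by
    simp only [size_prod]
    exact size_bounded.add hf)

lemma of_mem_vars {v : α → ℕ} (hv : v ∈ vars) : PolyBounded v := by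
  refine ⟨1, fun a => ?_⟩
  have := List.single_le_sum (l := vars.map (fun v : α → ℕ => v a)) (by simp) (v a)
    (List.mem_map_of_mem hv)
  simp only [size, pow_one]
  omega

lemma listSum {L : List (α → ℕ)} (h : ∀ f ∈ L, PolyBounded f) :
    PolyBounded (fun a => (L.map (fun f => f a)).sum) := by
  induction L with
  | nil => simpa using const 0
  | cons f L ih =>
    simp only [List.map_cons, List.sum_cons]
    exact (h f (by simp)).add (ih fun g hg => h g (by simp [hg]))

end PolyBounded

open Classical in
/-- The functions that are computed by programs with finitely many counters, of polynomially bounded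
values, and with access to the input word. -/
inductive LogFn {Γ : Type} : {α : Type} → [Ctx Γ α] → (α → ℕ) → Prop
  | var {α : Type} [Ctx Γ α] {v : α → ℕ} (hv : v ∈ vars) : LogFn v
  | weaken {α : Type} [Ctx Γ α] {f : α → ℕ} (hf : LogFn f) : LogFn (fun p : α × ℕ => f p.1)
  | zero {α : Type} [Ctx Γ α] : LogFn (fun _ : α => 0)
  | succ {α : Type} [Ctx Γ α] {f : α → ℕ} (hf : LogFn f) : LogFn (fun a => f a + 1)
  | length {α : Type} [Ctx Γ α] : LogFn (fun a : α => (word a).length)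
  | letter {α : Type} [Ctx Γ α] {f : α → ℕ} (hf : LogFn f) (x : Γ) :
      LogFn (fun a => if (word a)[f a]? = some x then 1 else 0)
  | letIn {α : Type} [Ctx Γ α] {f : α → ℕ} {g : α × ℕ → ℕ} (hf : LogFn f) (hg : LogFn g) :
      LogFn (fun a => g (a, f a))
  -- The bound covers all intermediate values, so a program that carries out the recursion never
  -- needs larger registers.
  | recBounded {α : Type} [Ctx Γ α] {c i : α → ℕ} {s : (α × ℕ) × ℕ → ℕ} (e : ℕ)
      (hc : LogFn c) (hi : LogFn i) (hs : LogFn s)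
      (he : ∀ a, ∀ m ≤ c a,
        Nat.rec (motive := fun _ => ℕ) (i a) (fun n y => s ((a, n), y)) m ≤ size a ^ e) :
      LogFn (fun a => Nat.rec (motive := fun _ => ℕ) (i a) (fun n y => s ((a, n), y)) (c a))

/-- Predicates with an indicator function in the class `LogFn`. -/
def LogPred {Γ α : Type} [Ctx Γ α] (p : α → Prop) : Prop :=
  open Classical in LogFn (fun a => if p a then 1 else 0)

/-! ### Arithmetic in the class `LogFn` -/

namespace LogFn

variable {Γ α : Type} [Ctx Γ α] {f g : α → ℕ}

lemma polyBounded (hf : LogFn f) : PolyBounded f := by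
  induction hf with
  | var hv => exact .of_mem_vars hv
  | weaken _ ih => exact ih.comp (PolyBounded.size_bounded.mono fun p => by rw [size_prod]; omega)
  | zero => exact .const 0
  | succ _ ih => exact ih.add (.const 1)
  | length => exact PolyBounded.size_bounded.mono fun a => by simp only [size]; omega
  | letter => exact (PolyBounded.const 1).mono fun a => by split_ifs <;> simp
  | letIn _ _ ihf ihg => exact ihg.letIn ihf
  | recBounded e _ _ _ he => exact ⟨e, fun a => he a _ le_rfl⟩

lemma congr (hf : LogFn f) (h : ∀ a, g a = f a) : LogFn g := by
  rwa [funext h]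

lemma primrec {c i b : α → ℕ} {s : (α × ℕ) × ℕ → ℕ}
    (hc : LogFn c) (hi : LogFn i) (hs : LogFn s) (hb : PolyBounded b)
    (h : ∀ a, ∀ m ≤ c a,
      Nat.rec (motive := fun _ => ℕ) (i a) (fun n y => s ((a, n), y)) m ≤ b a) :
    LogFn (fun a => Nat.rec (motive := fun _ => ℕ) (i a) (fun n y => s ((a, n), y)) (c a)) := by
  obtain ⟨e, he⟩ := hb
  exact .recBounded e hc hi hs fun a m hm => (h a m hm).trans (he a)

lemma snd : LogFn (fun p : α × ℕ => p.2) := .var (by simp [vars])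

lemma const (n : ℕ) : LogFn (fun _ : α => n) := by
  induction n with
  | zero => exact .zero
  | succ n ih => exact ih.succ

lemma add (hf : LogFn f) (hg : LogFn g) : LogFn (fun a => f a + g a) := by
  have key (x m : ℕ) : Nat.rec (motive := fun _ => ℕ) x (fun _ y => y + 1) m = x + m := by
    induction m with
    | zero => rfl
    | succ m ih => simp only [ih]; rfl
  refine (primrec (s := fun p => p.2 + 1) hg hf snd.succ (hf.polyBounded.add hg.polyBounded)
    fun a m hm => ?_).congr fun a => (key _ _).symm
  simp only [key]
  omega

lemma mul (hf : LogFn f) (hg : LogFn g) : LogFn (fun a => f a * g a) := by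
  have key (x m : ℕ) : Nat.rec (motive := fun _ => ℕ) 0 (fun _ y => y + x) m = x * m := by
    induction m with
    | zero => rfl
    | succ m ih => simp only [ih]; rfl
  refine (primrec (s := fun p => p.2 + f p.1.1) hg .zero (snd.add hf.weaken.weaken)
    (hf.polyBounded.mul hg.polyBounded) fun a m hm => ?_).congr fun a => (key _ _).symm
  simp only [key]
  exact Nat.mul_le_mul_left _ hm

lemma pow (hf : LogFn f) (n : ℕ) : LogFn (fun a => f a ^ n) := by
  induction n with
  | zero => simpa using const 1
  | succ n ih => simpa [pow_succ] using ih.mul hf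

/-- A recursion whose step forgets the previous value and returns the round number ends with the
number of the last round, `m - 1`. -/
lemma pred (hf : LogFn f) : LogFn (fun a => f a - 1) := by
  have key (m : ℕ) : Nat.rec (motive := fun _ => ℕ) 0 (fun n _ => n) m = m - 1 := by
    cases m <;> rfl
  refine (primrec (s := fun p => p.1.2) hf .zero snd.weaken hf.polyBounded
    fun a m hm => ?_).congr fun a => (key _).symm
  simp only [key]
  omega

lemma sub (hf : LogFn f) (hg : LogFn g) : LogFn (fun a => f a - g a) := by
  have key (x m : ℕ) : Nat.rec (motive := fun _ => ℕ) x (fun _ y => y - 1) m = x - m := by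
    induction m with
    | zero => rfl
    | succ m ih => simp only [ih]; rfl
  refine (primrec (s := fun p => p.2 - 1) hg hf snd.pred hf.polyBounded
    fun a m hm => ?_).congr fun a => (key _ _).symm
  simp only [key]
  omega

end LogFn

/-! ### Boolean operations and comparisons -/

namespace LogPred

variable {Γ α : Type} [Ctx Γ α] {f g : α → ℕ} {p q : α → Prop}

lemma congr (hp : LogPred p) (h : ∀ a, q a ↔ p a) : LogPred q := by
  rwa [funext fun a => propext (h a)]

lemma indicator [DecidablePred p] (hp : LogPred p) : LogFn (fun a => if p a then 1 else 0) :=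
  LogFn.congr hp fun a => by congr

lemma weaken (hp : LogPred p) : LogPred (fun x : α × ℕ => p x.1) := LogFn.weaken hp

/-- With truncated subtraction, `1 - (f a - g a)` is the indicator. -/
lemma le (hf : LogFn f) (hg : LogFn g) : LogPred (fun a => f a ≤ g a) :=
  ((LogFn.const 1).sub (hf.sub hg)).congr fun a => by split_ifs <;> omega

lemma not (hp : LogPred p) : LogPred (fun a => ¬ p a) := by
  classical
  exact ((LogFn.const 1).sub hp.indicator).congr fun a => by by_cases h : p a <;> simp [h]

lemma and (hp : LogPred p) (hq : LogPred q) : LogPred (fun a => p a ∧ q a) := by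
  classical
  exact (hp.indicator.mul hq.indicator).congr fun a => by
    by_cases h : p a <;> by_cases h' : q a <;> simp [h, h']

lemma or (hp : LogPred p) (hq : LogPred q) : LogPred (fun a => p a ∨ q a) :=
  (hp.not.and hq.not).not.congr fun a => by tauto

lemma lt (hf : LogFn f) (hg : LogFn g) : LogPred (fun a => f a < g a) := le hf.succ hg

lemma eq (hf : LogFn f) (hg : LogFn g) : LogPred (fun a => f a = g a) :=
  ((le hf hg).and (le hg hf)).congr fun _ => le_antisymm_iff

lemma const (P : Prop) : LogPred (fun _ : α => P) :=
  open Classical in LogFn.const (if P then 1 else 0)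

lemma letter (hf : LogFn f) (x : Γ) : LogPred (fun a => (word a)[f a]? = some x) :=
  LogFn.congr (LogFn.letter hf x) fun a => by congr

lemma letIn {p : α × ℕ → Prop} (hp : LogPred p) (hf : LogFn f) : LogPred (fun a => p (a, f a)) :=
  LogFn.letIn hf hp

lemma exists_mem {κ : Type*} (s : Finset κ) {p : κ → α → Prop} (hp : ∀ i ∈ s, LogPred (p i)) :
    LogPred (fun a => ∃ i ∈ s, p i a) := by
  classical
  induction s using Finset.induction_on with
  | empty => exact (const False).congr fun a => by simp
  | insert i s _ ih =>
    exact ((hp i (by simp)).or (ih fun j hj => hp j (by simp [hj]))).congr fun a => by simp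

lemma exists_finite {κ : Type*} [Finite κ] {p : κ → α → Prop} (hp : ∀ i, LogPred (p i)) :
    LogPred (fun a => ∃ i, p i a) := by
  have := Fintype.ofFinite κ
  exact (exists_mem Finset.univ fun i _ => hp i).congr fun a => by simp

lemma forall_finite {κ : Type*} [Finite κ] {p : κ → α → Prop} (hp : ∀ i, LogPred (p i)) :
    LogPred (fun a => ∀ i, p i a) :=
  (exists_finite fun i => (hp i).not).not.congr fun a => by simp

end LogPred

namespace LogFn

variable {Γ α : Type} [Ctx Γ α] {f g : α → ℕ}

lemma ite {p : α → Prop} [DecidablePred p] (hp : LogPred p) (hf : LogFn f) (hg : LogFn g) :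
    LogFn (fun a => if p a then f a else g a) :=
  ((hp.indicator.mul hf).add (((LogFn.const 1).sub hp.indicator).mul hg)).congr fun a => by
    by_cases h : p a <;> simp [h]

lemma min (hf : LogFn f) (hg : LogFn g) : LogFn (fun a => Min.min (f a) (g a)) :=
  (ite (.le hf hg) hf hg).congr fun a => by rw [min_def]

lemma max (hf : LogFn f) (hg : LogFn g) : LogFn (fun a => Max.max (f a) (g a)) :=
  (ite (.le hf hg) hg hf).congr fun a => by rw [max_def]

lemma finsetSum {κ : Type*} (s : Finset κ) {F : κ → α → ℕ} (hF : ∀ i ∈ s, LogFn (F i)) :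
    LogFn (fun a => ∑ i ∈ s, F i a) := by
  classical
  induction s using Finset.induction_on with
  | empty => simpa using zero
  | insert i s hi ih =>
    simp only [Finset.sum_insert hi]
    exact (hF i (by simp)).add (ih fun j hj => hF j (by simp [hj]))

lemma listSum {κ : Type*} (l : List κ) {F : κ → α → ℕ} (hF : ∀ i, LogFn (F i)) :
    LogFn (fun a => (l.map (fun i => F i a)).sum) := by
  induction l with
  | nil => simpa using zero
  | cons i s ih =>
    simp only [List.map_cons, List.sum_cons]
    exact (hF i).add ih

lemma sumRange {c : α → ℕ} {s : α × ℕ → ℕ} (hc : LogFn c) (hs : LogFn s) :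
    LogFn (fun a => ∑ i ∈ Finset.range (c a), s (a, i)) := by
  have key (a : α) (m : ℕ) : Nat.rec (motive := fun _ => ℕ) 0 (fun n y => y + s (a, n)) m =
      ∑ i ∈ Finset.range m, s (a, i) := by
    induction m with
    | zero => rfl
    | succ m ih => rw [Finset.sum_range_succ, ← ih]
  obtain ⟨e, he⟩ := hs.polyBounded
  -- A summand with `i < c a` lives at a point of size at most `size a + c a`, and there are at most
  -- `c a` summands.
  refine (primrec (b := fun a => c a * (size a + c a) ^ e) (s := fun p => p.2 + s p.1) hc .zero
    (snd.add hs.weaken) (hc.polyBounded.mul ((PolyBounded.size_bounded.add hc.polyBounded).pow e))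
    fun a m hm => ?_).congr fun a => (key _ _).symm
  simp only [key]
  refine (Finset.sum_le_card_nsmul _ _ ((size a + c a) ^ e) fun i hi => ?_).trans ?_
  · refine (he _).trans (Nat.pow_le_pow_left ?_ _)
    rw [size_prod]
    have := Finset.mem_range.1 hi
    simp only
    omega
  · simpa using Nat.mul_le_mul_right _ hm

end LogFn

/-! ### Bounded quantifiers -/

namespace LogPred

variable {Γ α : Type} [Ctx Γ α] {c : α → ℕ} {p : α × ℕ → Prop}

lemma exists_lt (hc : LogFn c) (hp : LogPred p) : LogPred (fun a => ∃ i < c a, p (a, i)) := by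
  classical
  refine (lt .zero (LogFn.sumRange hc hp.indicator)).congr fun a => ?_
  rw [Finset.sum_boole, Nat.cast_id, Finset.card_pos]
  simp [Finset.Nonempty]

lemma forall_lt (hc : LogFn c) (hp : LogPred p) : LogPred (fun a => ∀ i < c a, p (a, i)) :=
  (exists_lt hc hp.not).not.congr fun a => by simp

end LogPred

/-! ### Counting, division, iteration -/

namespace LogFn

variable {Γ α : Type} [Ctx Γ α] {f g c : α → ℕ} {p : α × ℕ → Prop}

lemma count [∀ a, DecidablePred fun i => p (a, i)] (hc : LogFn c) (hp : LogPred p) :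
    LogFn (fun a => Nat.count (fun i => p (a, i)) (c a)) := by
  classical
  refine (sumRange hc hp.indicator).congr fun a => ?_
  rw [Finset.sum_boole, Nat.cast_id, Nat.count_eq_card_filter_range]

/-- The quotient is the number of positive multiples of `g a` up to `f a`. The condition `0 < g x.1`
produces the value `0` for division by zero. -/
lemma div (hf : LogFn f) (hg : LogFn g) : LogFn (fun a => f a / g a) := by
  classical
  refine (count hf (p := fun x => (x.2 + 1) * g x.1 ≤ f x.1 ∧ 0 < g x.1)
    ((LogPred.le (snd.succ.mul hg.weaken) hf.weaken).and
      (LogPred.lt .zero hg.weaken))).congr fun a => ?_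
  rw [Nat.count_eq_card_filter_range]
  rcases Nat.eq_zero_or_pos (g a) with h | h
  · simp [h]
  · have : Finset.filter (fun i => (i + 1) * g a ≤ f a ∧ 0 < g a) (Finset.range (f a)) =
        Finset.range (f a / g a) := by
      ext i
      simp only [Finset.mem_filter, Finset.mem_range, h, and_true, ← Nat.le_div_iff_mul_le h]
      have := Nat.div_le_self (f a) (g a)
      omega
    rw [this, Finset.card_range]

lemma mod (hf : LogFn f) (hg : LogFn g) : LogFn (fun a => f a % g a) :=
  (hf.sub (hg.mul (hf.div hg))).congr fun a => by
    have := Nat.div_add_mod (f a) (g a)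
    omega

/-- The polynomially bounded iteration of a function, with values cut down to a bound. -/
lemma iterate {c i b : α → ℕ} {s : α × ℕ → ℕ} (hc : LogFn c) (hi : LogFn i) (hb : LogFn b)
    (hs : ∀ a y, s (a, y) ≤ b a) (hs' : LogFn (fun p : (α × ℕ) × ℕ => s (p.1.1, p.2))) :
    LogFn (fun a => (fun y => s (a, y))^[c a] (i a)) := by
  have key (a : α) (m : ℕ) : Nat.rec (motive := fun _ => ℕ) (i a) (fun _ y => s (a, y)) m =
      (fun y => s (a, y))^[m] (i a) := by
    induction m with
    | zero => rfl
    | succ m ih => rw [Function.iterate_succ_apply', ← ih]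
  -- The start value need not respect the bound `b`, so it is added to it.
  refine (primrec (s := fun p => s (p.1.1, p.2)) hc hi hs' (hb.polyBounded.add hi.polyBounded)
    fun a m hm => ?_).congr fun a => (key _ _).symm
  cases m with
  | zero => exact Nat.le_add_left _ _
  | succ m => exact (hs _ _).trans (Nat.le_add_right _ _)

end LogFn

/-! ### Substitution -/

/-- A map from points to words such that the length and the letters of the words are in the class
`LogFn`. -/
def LogWord {Γ Δ α : Type} [Ctx Γ α] (W : α → List Δ) : Prop :=
  LogFn (fun a => (W a).length) ∧ ∀ x, LogPred (fun p : α × ℕ => (W p.1)[p.2]? = some x)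

/-- A map between contexts that is given by functions in the class `LogFn`. -/
def LogMap {Γ Δ α β : Type} [Ctx Γ α] [Ctx Δ β] (φ : β → α) : Prop :=
  LogWord (fun b => word (φ b)) ∧ ∀ v ∈ vars, LogFn (fun b => v (φ b))

lemma LogMap.size_bounded {Γ Δ α β : Type} [Ctx Γ α] [Ctx Δ β] {φ : β → α} (h : LogMap φ) :
    PolyBounded (fun b => size (φ b)) := by
  refine ((h.1.1.polyBounded.add ?_).add (.const 2))
  have := PolyBounded.listSum (L := vars.map (fun v b => v (φ b))) (by
    intro f hf
    obtain ⟨v, hv, rfl⟩ := List.mem_map.1 hf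
    exact (h.2 v hv).polyBounded)
  simpa [Function.comp_def] using this

/-- Substitution of variables. -/
lemma LogFn.subst {Γ α β : Type} [Ctx Γ α] [Ctx Γ β] {f : α → ℕ} (hf : LogFn f) {φ : β → α}
    (hw : ∀ b, word (φ b) = word b) (hv : ∀ v ∈ vars, LogFn (fun b => v (φ b))) :
    LogFn (fun b => f (φ b)) := by
  -- The recursion step lives over a context with more variables, so the substitution has to be
  -- lifted to it.
  have ext {α β : Type} [Ctx Γ α] [Ctx Γ β] {φ : β → α} (hv : ∀ v ∈ vars, LogFn fun b => v (φ b)) :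
      ∀ v ∈ vars, LogFn fun p : β × ℕ => v (φ p.1, p.2) := by
    intro v h
    rcases List.mem_cons.1 h with rfl | h
    · exact snd
    · obtain ⟨u, hu, rfl⟩ := List.mem_map.1 h
      exact (hv u hu).weaken
  induction hf generalizing β with
  | var h => exact hv _ h
  | weaken _ ih =>
    exact ih (φ := fun b => (φ b).1) hw fun v h =>
      hv (fun p => v p.1) (List.mem_cons_of_mem _ (List.mem_map_of_mem h))
  | zero => exact zero
  | succ _ ih => exact (ih hw hv).succ
  | length => exact length.congr fun b => by simp only [hw]
  | letter _ x ih => exact (letter (ih hw hv) x).congr fun b => by beta_reduce; rw [hw b]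
  | letIn _ _ ihf ihg =>
    exact (ihf hw hv).letIn (ihg (φ := fun p : β × ℕ => (φ p.1, p.2)) (fun p => hw p.1) (ext hv))
  | recBounded e _ _ _ he ihc ihi ihs =>
    have hs := ihs (φ := fun p : (β × ℕ) × ℕ => ((φ p.1.1, p.1.2), p.2)) (fun p => hw p.1.1)
      (ext (φ := fun p : β × ℕ => (φ p.1, p.2)) (ext hv))
    refine primrec (b := fun b => size (φ b) ^ e) (ihc hw hv) (ihi hw hv) hs (PolyBounded.pow ?_ e)
      fun b => he (φ b)
    have := PolyBounded.listSum (L := vars.map (fun v b => v (φ b))) (by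
      intro f hf
      obtain ⟨v, h, rfl⟩ := List.mem_map.1 hf
      exact (hv v h).polyBounded)
    refine (PolyBounded.add (PolyBounded.size_bounded) this).mono fun b => ?_
    simp only [size, hw, List.map_map, Function.comp_def]
    omega

lemma LogPred.subst {Γ α β : Type} [Ctx Γ α] [Ctx Γ β] {p : α → Prop} (hp : LogPred p) {φ : β → α}
    (hw : ∀ b, word (φ b) = word b) (hv : ∀ v ∈ vars, LogFn (fun b => v (φ b))) :
    LogPred (fun b => p (φ b)) := LogFn.subst hp hw hv

lemma LogMap.prodMap {Γ Δ α β : Type} [Ctx Γ α] [Ctx Δ β] {φ : β → α} (h : LogMap φ) :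
    LogMap (fun p : β × ℕ => (φ p.1, p.2)) := by
  refine ⟨⟨h.1.1.weaken, fun x => (h.1.2 x).subst (φ := fun p : (β × ℕ) × ℕ => (p.1.1, p.2))
    (fun _ => rfl) ?_⟩, ?_⟩
  · intro v hv
    rcases List.mem_cons.1 hv with rfl | hv
    · exact LogFn.snd
    · obtain ⟨u, hu, rfl⟩ := List.mem_map.1 hv
      exact (LogFn.var hu).weaken.weaken
  · intro v hv
    rcases List.mem_cons.1 hv with rfl | hv
    · exact LogFn.snd
    · obtain ⟨u, hu, rfl⟩ := List.mem_map.1 hv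
      exact (h.2 u hu).weaken

/-- Here the word itself is replaced. It is never stored: the cases `length` and `letter` recompute
what they need from the old word. Recursion stays polynomially bounded because `size (φ b)` is
polynomially bounded in `size b`. -/
lemma LogFn.comp {Γ Δ α β : Type} [Ctx Γ α] [Ctx Δ β] {f : α → ℕ} (hf : LogFn f) {φ : β → α}
    (h : LogMap φ) : LogFn (fun b => f (φ b)) := by
  induction hf generalizing β with
  | var hv => exact h.2 _ hv
  | weaken _ ih =>
    exact ih (φ := fun b => (φ b).1) ⟨h.1, fun v hv =>
      h.2 (fun p => v p.1) (List.mem_cons_of_mem _ (List.mem_map_of_mem hv))⟩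
  | zero => exact zero
  | succ _ ih => exact (ih h).succ
  | length => exact h.1.1
  | letter _ x ih => exact LogFn.congr ((h.1.2 x).letIn (ih h)) fun b => by beta_reduce; congr
  | letIn _ _ ihf ihg => exact (ihf h).letIn (ihg h.prodMap)
  | recBounded e _ _ _ he ihc ihi ihs =>
    exact primrec (ihc h) (ihi h) (ihs h.prodMap.prodMap) (h.size_bounded.pow e) fun b => he (φ b)

lemma LogPred.comp {Γ Δ α β : Type} [Ctx Γ α] [Ctx Δ β] {p : α → Prop} (hp : LogPred p) {φ : β → α}
    (h : LogMap φ) : LogPred (fun b => p (φ b)) := LogFn.comp hp h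

lemma LogWord.comp {Γ Δ Θ : Type} {V : List Δ → List Θ} {W : List Γ → List Δ} (hV : LogWord V)
    (hW : LogWord W) : LogWord (fun w => V (W w)) := by
  have : LogMap W := ⟨hW, fun v hv => by simp [vars] at hv⟩
  exact ⟨hV.1.comp this, fun x => (hV.2 x).comp this.prodMap⟩

/-! ## While programs on counters and an input head -/

/-- While programs on registers, an input head and an output tape. -/
inductive Cmd (Γ Δ : Type)
  | skip
  | inc (r : ℕ)
  | dec (r : ℕ)
  | move (m : HeadMove)
  | out (d : Δ)
  | ifSym (p : InputSymbol Γ → Bool) (c₁ c₂ : Cmd Γ Δ)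
  | seq (c₁ c₂ : Cmd Γ Δ)
  | loop (r : ℕ) (c : Cmd Γ Δ)

/-- The states of while programs. -/
@[ext]
structure Store (Δ : Type) where
  regs : ℕ → ℕ
  pos : ℕ
  out : List Δ

namespace Store

variable {Δ : Type}

/-- Change the value of a register. -/
def set (s : Store Δ) (r x : ℕ) : Store Δ := { s with regs := Function.update s.regs r x }

@[simp] lemma set_pos (s : Store Δ) (r x : ℕ) : (s.set r x).pos = s.pos := rfl

@[simp] lemma set_out (s : Store Δ) (r x : ℕ) : (s.set r x).out = s.out := rfl

lemma set_regs (s : Store Δ) (r x i : ℕ) :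
    (s.set r x).regs i = if i = r then x else s.regs i := by
  simp [set, Function.update_apply]

end Store

namespace Cmd

variable {Γ Δ : Type}

/-- All registers of the program are smaller than `K`. -/
def RegsLT (K : ℕ) : Cmd Γ Δ → Prop
  | skip => True
  | inc r => r < K
  | dec r => r < K
  | move _ => True
  | out _ => True
  | ifSym _ c₁ c₂ => c₁.RegsLT K ∧ c₂.RegsLT K
  | seq c₁ c₂ => c₁.RegsLT K ∧ c₂.RegsLT K
  | loop r c => r < K ∧ c.RegsLT K

lemma RegsLT.mono {K K' : ℕ} (h : K ≤ K') {c : Cmd Γ Δ} (hc : c.RegsLT K) : c.RegsLT K' := by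
  induction c with
  | skip => trivial
  | inc r => exact lt_of_lt_of_le hc h
  | dec r => exact lt_of_lt_of_le hc h
  | move => trivial
  | out => trivial
  | ifSym _ _ _ ih₁ ih₂ => exact ⟨ih₁ hc.1, ih₂ hc.2⟩
  | seq _ _ ih₁ ih₂ => exact ⟨ih₁ hc.1, ih₂ hc.2⟩
  | loop _ _ ih => exact ⟨lt_of_lt_of_le hc.1 h, ih hc.2⟩

lemma exists_regsLT (c : Cmd Γ Δ) : ∃ K, c.RegsLT K := by
  induction c with
  | skip => exact ⟨0, trivial⟩
  | inc r => exact ⟨r + 1, Nat.lt_succ_self r⟩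
  | dec r => exact ⟨r + 1, Nat.lt_succ_self r⟩
  | move => exact ⟨0, trivial⟩
  | out => exact ⟨0, trivial⟩
  | ifSym _ _ _ ih₁ ih₂ =>
    obtain ⟨K₁, h₁⟩ := ih₁
    obtain ⟨K₂, h₂⟩ := ih₂
    exact ⟨max K₁ K₂, h₁.mono (le_max_left _ _), h₂.mono (le_max_right _ _)⟩
  | seq _ _ ih₁ ih₂ =>
    obtain ⟨K₁, h₁⟩ := ih₁
    obtain ⟨K₂, h₂⟩ := ih₂
    exact ⟨max K₁ K₂, h₁.mono (le_max_left _ _), h₂.mono (le_max_right _ _)⟩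
  | loop r _ ih =>
    obtain ⟨K, h⟩ := ih
    exact ⟨max (r + 1) K, lt_of_lt_of_le r.lt_succ_self (le_max_left _ _),
      h.mono (le_max_right _ _)⟩

/-- The program leads from a state to another one on input `w`, with registers bounded by `B`. -/
inductive Exec (w : List Γ) (B : ℕ) : Cmd Γ Δ → Store Δ → Store Δ → Prop
  | skip (s) : Exec w B skip s s
  -- Only this rule makes a register grow, so the bound is checked here alone.
  | inc (s : Store Δ) (r) (h : s.regs r + 1 ≤ B) : Exec w B (inc r) s (s.set r (s.regs r + 1))
  | dec (s : Store Δ) (r) (h : 0 < s.regs r) : Exec w B (dec r) s (s.set r (s.regs r - 1))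
  | move (s : Store Δ) (m) :
      Exec w B (move m) s { s with pos := min (m.apply s.pos) (w.length + 1) }
  | out (s : Store Δ) (d) : Exec w B (out d) s { s with out := s.out ++ [d] }
  | ifSym_true {s s' p c₁ c₂} (h : p (Transducer.inputCell w s.pos) = true)
      (h₁ : Exec w B c₁ s s') : Exec w B (ifSym p c₁ c₂) s s'
  | ifSym_false {s s' p c₁ c₂} (h : p (Transducer.inputCell w s.pos) = false)
      (h₂ : Exec w B c₂ s s') : Exec w B (ifSym p c₁ c₂) s s'
  | seq {s s' s'' c₁ c₂} (h₁ : Exec w B c₁ s s') (h₂ : Exec w B c₂ s' s'') :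
      Exec w B (seq c₁ c₂) s s''
  | loop_zero {s r c} (h : s.regs r = 0) : Exec w B (loop r c) s s
  | loop_succ {s s' s'' r c} (h : s.regs r ≠ 0) (h₁ : Exec w B c s s')
      (h₂ : Exec w B (loop r c) s' s'') : Exec w B (loop r c) s s''

end Cmd

/-! ### Programs with jumps -/

/-- Instructions of programs with jumps. -/
inductive Instr (Γ Δ : Type)
  | inc (r : ℕ)
  | dec (r : ℕ)
  | jz (r l : ℕ)
  | jmp (l : ℕ)
  | jsym (p : InputSymbol Γ → Bool) (l : ℕ)
  | move (m : HeadMove)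
  | out (d : Δ)

namespace Instr

variable {Γ Δ : Type}

/-- The register of an instruction, if there is one, is smaller than `K`. -/
def RegsLT (K : ℕ) : Instr Γ Δ → Prop
  | inc r => r < K
  | dec r => r < K
  | jz r _ => r < K
  | _ => True

/-- The steps of a program with jumps on input `w`, with registers bounded by `B`. -/
inductive Step (w : List Γ) (B : ℕ) (P : List (Instr Γ Δ)) : ℕ × Store Δ → ℕ × Store Δ → Prop
  | inc {i s r} (hi : P[i]? = some (inc r)) (h : s.regs r + 1 ≤ B) :
      Step w B P (i, s) (i + 1, s.set r (s.regs r + 1))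
  | dec {i s r} (hi : P[i]? = some (dec r)) (h : 0 < s.regs r) :
      Step w B P (i, s) (i + 1, s.set r (s.regs r - 1))
  | jz_zero {i s r l} (hi : P[i]? = some (jz r l)) (h : s.regs r = 0) : Step w B P (i, s) (l, s)
  | jz_pos {i s r l} (hi : P[i]? = some (jz r l)) (h : s.regs r ≠ 0) :
      Step w B P (i, s) (i + 1, s)
  | jmp {i s l} (hi : P[i]? = some (jmp l)) : Step w B P (i, s) (l, s)
  | jsym_true {i s p l} (hi : P[i]? = some (jsym p l))
      (h : p (Transducer.inputCell w s.pos) = true) : Step w B P (i, s) (l, s)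
  | jsym_false {i s p l} (hi : P[i]? = some (jsym p l))
      (h : p (Transducer.inputCell w s.pos) = false) : Step w B P (i, s) (i + 1, s)
  | move {i s m} (hi : P[i]? = some (move m)) :
      Step w B P (i, s) (i + 1, { s with pos := min (m.apply s.pos) (w.length + 1) })
  | out {i s d} (hi : P[i]? = some (out d)) :
      Step w B P (i, s) (i + 1, { s with out := s.out ++ [d] })

/-- The program `P` contains the block `l` at position `i`. -/
def BlockAt (P : List (Instr Γ Δ)) (i : ℕ) (l : List (Instr Γ Δ)) : Prop :=
  ∃ pre post, P = pre ++ (l ++ post) ∧ pre.length = i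

lemma BlockAt.left {P : List (Instr Γ Δ)} {i : ℕ} {l l' : List (Instr Γ Δ)}
    (h : BlockAt P i (l ++ l')) : BlockAt P i l := by
  obtain ⟨pre, post, rfl, hi⟩ := h
  exact ⟨pre, l' ++ post, by simp, hi⟩

lemma BlockAt.right {P : List (Instr Γ Δ)} {i : ℕ} {l l' : List (Instr Γ Δ)}
    (h : BlockAt P i (l ++ l')) : BlockAt P (i + l.length) l' := by
  obtain ⟨pre, post, rfl, hi⟩ := h
  exact ⟨pre ++ l, post, by simp, by simp [hi]⟩

lemma BlockAt.head {P : List (Instr Γ Δ)} {i : ℕ} {x : Instr Γ Δ} {l : List (Instr Γ Δ)}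
    (h : BlockAt P i (x :: l)) : P[i]? = some x := by
  obtain ⟨pre, post, rfl, hi⟩ := h
  simp [← hi]

lemma BlockAt.tail {P : List (Instr Γ Δ)} {i : ℕ} {x : Instr Γ Δ} {l : List (Instr Γ Δ)}
    (h : BlockAt P i (x :: l)) : BlockAt P (i + 1) l :=
  BlockAt.right (l := [x]) h

end Instr

namespace Cmd

variable {Γ Δ : Type}

/-- Translation of while programs into programs with jumps, to be placed at position `i`. -/
def compile : ℕ → Cmd Γ Δ → List (Instr Γ Δ)
  | _, skip => []
  | _, inc r => [.inc r]
  | _, dec r => [.dec r]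
  | _, move m => [.move m]
  | _, out d => [.out d]
  -- Layout: test, code of `c₂`, jump to the end, code of `c₁`. Jump targets are absolute, so the
  -- lengths of the blocks enter.
  | i, ifSym p c₁ c₂ =>
    let l₂ := compile (i + 1) c₂
    let l₁ := compile (i + 1 + l₂.length + 1) c₁
    .jsym p (i + 1 + l₂.length + 1) :: (l₂ ++ .jmp (i + 1 + l₂.length + 1 + l₁.length) :: l₁)
  | i, seq c₁ c₂ =>
    let l₁ := compile i c₁
    l₁ ++ compile (i + l₁.length) c₂
  | i, loop r c =>
    let l := compile (i + 1) c
    .jz r (i + 1 + l.length + 1) :: (l ++ [.jmp i])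

lemma compile_regsLT {K : ℕ} {c : Cmd Γ Δ} (hc : c.RegsLT K) (i : ℕ) :
    ∀ I ∈ c.compile i, I.RegsLT K := by
  induction c generalizing i with
  | skip => simp [compile]
  | inc r => simpa [compile, Instr.RegsLT, RegsLT] using hc
  | dec r => simpa [compile, Instr.RegsLT, RegsLT] using hc
  | move => simp [compile, Instr.RegsLT]
  | out => simp [compile, Instr.RegsLT]
  | ifSym p c₁ c₂ ih₁ ih₂ =>
    intro I hI
    simp only [compile, List.mem_cons, List.mem_append] at hI
    rcases hI with rfl | hI | rfl | hI
    · trivial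
    · exact ih₂ hc.2 _ I hI
    · trivial
    · exact ih₁ hc.1 _ I hI
  | seq c₁ c₂ ih₁ ih₂ =>
    intro I hI
    simp only [compile, List.mem_append] at hI
    rcases hI with hI | hI
    · exact ih₁ hc.1 _ I hI
    · exact ih₂ hc.2 _ I hI
  | loop r c ih =>
    intro I hI
    simp only [compile, List.mem_cons, List.mem_append, List.not_mem_nil, or_false] at hI
    rcases hI with rfl | hI | rfl
    · exact hc.1
    · exact ih hc.2 _ I hI
    · trivial

-- Induction on the run of the while program. The surrounding program `P` stays fixed and only
-- contains the compiled block, so the induction hypotheses apply to the sub-blocks within the same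
-- `P`; for a loop, the second one applies to the same block again.
open Relation in
lemma Exec.compile {w : List Γ} {B : ℕ} {c : Cmd Γ Δ} {s s' : Store Δ} (h : Exec w B c s s')
    {P : List (Instr Γ Δ)} {i : ℕ} (hP : Instr.BlockAt P i (c.compile i)) :
    ReflTransGen (Instr.Step w B P) (i, s) (i + (c.compile i).length, s') := by
  induction h generalizing i with
  | skip s => exact .refl
  | inc s r h => exact .single (.inc hP.head h)
  | dec s r h => exact .single (.dec hP.head h)
  | move s m => exact .single (.move hP.head)
  | out s d => exact .single (.out hP.head)
  | ifSym_true h _ ih =>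
    have := ih hP.tail.right.tail
    refine .head (.jsym_true hP.head h) ?_
    convert this using 2
    simp only [Cmd.compile, List.length_cons, List.length_append]
    omega
  | ifSym_false h _ ih =>
    have := (ih hP.tail.left).tail (.jmp hP.tail.right.head)
    refine .head (.jsym_false hP.head h) ?_
    convert this using 2
    simp only [Cmd.compile, List.length_cons, List.length_append]
    omega
  | seq _ _ ih₁ ih₂ =>
    have := (ih₁ hP.left).trans (ih₂ hP.right)
    convert this using 2
    simp only [Cmd.compile, List.length_append]
    omega
  | loop_zero h =>
    refine .single ?_
    convert Instr.Step.jz_zero hP.head h using 2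
    simp only [Cmd.compile, List.length_cons, List.length_append, List.length_nil]
    omega
  | loop_succ h _ _ ih₁ ih₂ =>
    exact .head (.jz_pos hP.head h)
      (((ih₁ hP.tail.left).tail (.jmp hP.tail.right.head)).trans (ih₂ hP))

end Cmd

/-! ### Binary counters on work tapes -/

/-- The work alphabet of the machines that keep their registers in binary. -/
inductive Cell
  | blank
  | mark
  | bit (b : Bool)

/-- The phases of an operation on a binary counter: moving away from the mark in cell `0`, and
returning to it with a result. -/
inductive Phase
  | go
  | ret (b : Bool)

/-- Operations on binary counters. -/
inductive CounterOp
  | inc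
  | dec
  | test

instance : Finite Cell := by
  refine Finite.of_injective (β := Option (Option Bool))
    (fun | .blank => none | .mark => some none | .bit b => some (some b)) ?_
  rintro (_ | _ | _) (_ | _ | _) <;> simp

instance : Finite Phase := by
  refine Finite.of_injective (β := Option Bool) (fun | .go => none | .ret b => some b) ?_
  rintro (_ | _) (_ | _) <;> simp

namespace Counter

/-- One step of an operation on a binary counter: the next phase or the result, the symbol to be
written, and the movement of the head. -/
def step : CounterOp → Phase → Cell → (Phase ⊕ Bool) × Cell × HeadMove
  | .inc, .go, .bit true => (.inl .go, .bit false, .right)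
  -- The carry stops at a digit `0` or at a blank; in the latter case the word becomes longer.
  | .inc, .go, _ => (.inl (.ret false), .bit true, .left)
  | .dec, .go, .bit false => (.inl .go, .bit true, .right)
  | .dec, .go, _ => (.inl (.ret false), .bit false, .left)
  | .test, .go, .bit false => (.inl .go, .bit false, .right)
  | .test, .go, .bit true => (.inl (.ret false), .bit true, .left)
  | .test, .go, c => (.inl (.ret true), c, .left)
  | _, .ret b, .mark => (.inr b, .mark, .stay)
  | _, .ret b, c => (.inl (.ret b), c, .left)

/-- The tape with a mark in cell `0` followed by a binary word. -/
def tape (l : List Bool) : ℕ → Cell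
  | 0 => .mark
  | i + 1 => match l[i]? with
    | some b => .bit b
    | none => .blank

/-- The value of a binary word, the least significant digit being the first one. -/
def value : List Bool → ℕ
  | [] => 0
  | b :: l => b.toNat + 2 * value l

/-- The increment of a binary word. -/
def incList : List Bool → List Bool
  | [] => [true]
  | false :: l => true :: l
  | true :: l => false :: incList l

/-- The decrement of a binary word. -/
def decList : List Bool → List Bool
  | [] => []
  | true :: l => false :: l
  | false :: l => true :: decList l

lemma value_incList (l : List Bool) : value (incList l) = value l + 1 := by
  induction l with
  | nil => rfl
  | cons b l ih => cases b <;> simp [incList, value, ih] <;> omega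

lemma value_decList (l : List Bool) (h : 0 < value l) : value (decList l) = value l - 1 := by
  induction l with
  | nil => simp [value] at h
  | cons b l ih =>
    cases b
    · simp only [value, Bool.toNat_false, zero_add] at h
      simp only [decList, value, Bool.toNat_false, Bool.toNat_true, ih (by omega)]
      omega
    · simp [decList, value]

lemma length_decList (l : List Bool) : (decList l).length = l.length := by
  induction l with
  | nil => rfl
  | cons b l ih => cases b <;> simp [decList, ih]

/-- Decrementing keeps leading zeros, so the value alone does not bound the length of a word. But an
increment lengthens a word only if all its digits are `1`, and then the new length is controlled by
the new value. This preserves the invariant `2 ^ l.length ≤ 2 * B` of `Represents`. -/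
lemma length_incList (l : List Bool) :
    (incList l).length = l.length ∨ 2 ^ (incList l).length ≤ 2 * (value l + 1) := by
  induction l with
  | nil => right; simp [incList, value]
  | cons b l ih =>
    cases b
    · left; rfl
    · simp only [incList, List.length_cons, value, Bool.toNat_true, pow_succ]
      omega

lemma update_tape (l l' : List Bool) (b c : Bool) :
    Function.update (tape (l ++ b :: l')) (l.length + 1) (.bit c) = tape (l ++ c :: l') := by
  funext i
  cases i with
  | zero => rfl
  | succ i =>
    rcases lt_trichotomy i l.length with h | rfl | h
    · rw [Function.update_of_ne (by omega)]
      simp [tape, List.getElem?_append_left h]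
    · simp [tape]
    · rw [Function.update_of_ne (by omega)]
      obtain ⟨j, rfl⟩ := Nat.exists_eq_add_of_lt h
      simp [tape, List.getElem?_append_right, Nat.add_assoc]

lemma update_tape_end (l : List Bool) (c : Bool) :
    Function.update (tape l) (l.length + 1) (.bit c) = tape (l ++ [c]) := by
  funext i
  cases i with
  | zero => rfl
  | succ i =>
    rcases lt_trichotomy i l.length with h | rfl | h
    · rw [Function.update_of_ne (by omega)]
      simp [tape, List.getElem?_append_left h]
    · simp [tape]
    · rw [Function.update_of_ne (by omega)]
      obtain ⟨j, rfl⟩ := Nat.exists_eq_add_of_lt h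
      simp [tape, Nat.add_assoc]

/-- The operation leads from the given phase, tape and head position to the given result and tape
with the head in cell `0`, and the head visits only the first `n` cells. -/
inductive Run (op : CounterOp) (n : ℕ) : Phase → (ℕ → Cell) → ℕ → Bool → (ℕ → Cell) → Prop
  | done {q T b} (h : step op q (T 0) = (.inr b, T 0, .stay)) (hn : 0 < n) : Run op n q T 0 b T
  | step {q q' T T' h b x m} (hs : Counter.step op q (T h) = (.inl q', x, m)) (hn : h < n)
      (hr : Run op n q' (Function.update T h x) (m.apply h) b T') : Run op n q T h b T'

lemma run_ret (op : CounterOp) {n : ℕ} (b : Bool) (l : List Bool) {h : ℕ} (hn : h < n) :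
    Run op n (.ret b) (tape l) h b (tape l) := by
  induction h with
  | zero => exact .done (by cases op <;> rfl) hn
  | succ h ih =>
    refine .step (q' := .ret b) (x := tape l (h + 1)) (m := .left) ?_ hn ?_
    · cases hc : tape l (h + 1) with
      | mark => simp only [tape] at hc; split at hc <;> simp at hc
      | blank => cases op <;> rfl
      | bit => cases op <;> rfl
    · rw [Function.update_eq_self]
      exact ih (by omega)

lemma tape_append (l l' : List Bool) (b : Bool) : tape (l ++ b :: l') (l.length + 1) = .bit b := by
  simp [tape]

lemma tape_end (l : List Bool) : tape l (l.length + 1) = .blank := by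
  simp [tape]

/-- Here `l` is the part of the word that the head has already passed; it has to be arbitrary for
the induction on the rest `l'`. The head gets at most to the first blank, in cell `length + 1`. -/
lemma run_inc {n : ℕ} (l l' : List Bool) (hn : (l ++ l').length + 1 < n) :
    Run .inc n .go (tape (l ++ l')) (l.length + 1) false (tape (l ++ incList l')) := by
  induction l' generalizing l with
  | nil =>
    simp only [List.append_nil] at hn ⊢
    refine .step (q' := .ret false) (x := .bit true) (m := .left) (by rw [tape_end]; rfl)
      (by simpa using hn) ?_
    rw [update_tape_end]
    exact run_ret _ _ _ (by simp only [HeadMove.apply]; omega)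
  | cons b l' ih =>
    simp only [List.length_append, List.length_cons] at hn
    cases b
    · refine .step (q' := .ret false) (x := .bit true) (m := .left) (by rw [tape_append]; rfl)
        (by omega) ?_
      rw [update_tape]
      exact run_ret _ _ _ (by simp only [HeadMove.apply]; omega)
    · refine .step (q' := .go) (x := .bit false) (m := .right) (by rw [tape_append]; rfl)
        (by omega) ?_
      rw [update_tape]
      have := ih (l ++ [false]) (by simp; omega)
      simpa [incList, HeadMove.apply] using this

lemma run_dec {n : ℕ} (l l' : List Bool) (hn : (l ++ l').length + 1 < n) (h : 0 < value l') :
    Run .dec n .go (tape (l ++ l')) (l.length + 1) false (tape (l ++ decList l')) := by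
  induction l' generalizing l with
  | nil => simp [value] at h
  | cons b l' ih =>
    simp only [List.length_append, List.length_cons] at hn
    cases b
    · refine .step (q' := .go) (x := .bit true) (m := .right) (by rw [tape_append]; rfl)
        (by omega) ?_
      rw [update_tape]
      have := ih (l ++ [true]) (by simp; omega) (by simpa [value] using h)
      simpa [decList, HeadMove.apply] using this
    · refine .step (q' := .ret false) (x := .bit false) (m := .left) (by rw [tape_append]; rfl)
        (by omega) ?_
      rw [update_tape]
      exact run_ret _ _ _ (by simp only [HeadMove.apply]; omega)

lemma run_test {n : ℕ} (l l' : List Bool) (hn : (l ++ l').length + 1 < n) :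
    Run .test n .go (tape (l ++ l')) (l.length + 1) (decide (value l' = 0)) (tape (l ++ l')) := by
  induction l' generalizing l with
  | nil =>
    simp only [List.append_nil] at hn ⊢
    refine .step (q' := .ret true) (x := tape l (l.length + 1)) (m := .left)
      (by rw [tape_end]; rfl) (by simpa using hn) ?_
    rw [Function.update_eq_self]
    exact run_ret _ _ _ (by simp only [HeadMove.apply]; omega)
  | cons b l' ih =>
    simp only [List.length_append, List.length_cons] at hn
    cases b
    · refine .step (q' := .go) (x := .bit false) (m := .right) (by rw [tape_append]; rfl)
        (by omega) ?_
      rw [update_tape]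
      have := ih (l ++ [false]) (by simp; omega)
      simpa [value, HeadMove.apply] using this
    · refine .step (q' := .ret false) (x := .bit true) (m := .left) (by rw [tape_append]; rfl)
        (by omega) ?_
      rw [update_tape]
      simpa [value] using run_ret (n := n) .test false (l ++ true :: l')
        (h := HeadMove.left.apply (l.length + 1)) (by simp only [HeadMove.apply]; omega)

end Counter

/-! ### The transducer of a program with jumps -/

namespace Transducer

variable {Γ Δ : Type}

/-- The computation leads from `c` to `c'`, and before each of its steps, the work heads are in the
first `n` cells. -/
def Run (M : Transducer Γ Δ) (w : List Γ) (n : ℕ) : M.Config → M.Config → Prop :=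
  Relation.ReflTransGen (fun c c' => M.next w c = some c' ∧ ∀ t, c.head t < n)

lemma next_eq_some {M : Transducer Γ Δ} {w : List Γ} {c : M.Config} {q : M.State} {m : HeadMove}
    {act : M.Tape → M.Sym × HeadMove} {o : Option Δ}
    (h : M.step c.state (inputCell w c.inputHead) (fun t => c.work t (c.head t)) =
      some (q, m, act, o)) :
    M.next w c = some
      { state := q
        inputHead := min (m.apply c.inputHead) (w.length + 1)
        work := fun t => Function.update (c.work t) (c.head t) (act t).1
        head := fun t => (act t).2.apply (c.head t)
        output := c.output ++ o.toList } := by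
  rw [next, h]
  rfl

/-- The machine is deterministic, so every reachable configuration lies on the given run and
inherits its bound on the heads. -/
lemma Run.computesInSpace {M : Transducer Γ Δ} {w : List Γ} {n : ℕ} {c : M.Config}
    (h : M.Run w n M.init c) (hc : M.next w c = none) (hn : ∀ t, c.head t < n) :
    M.ComputesInSpace w c.output n := by
  refine ⟨⟨c, Relation.ReflTransGen.mono (fun _ _ hab => hab.1) _ _ h, hc, rfl⟩, ?_⟩
  generalize M.init = c₀ at h
  induction h using Relation.ReflTransGen.head_induction_on with
  | refl =>
    intro c' h'
    rcases Relation.ReflTransGen.cases_head h' with rfl | ⟨d, hd, _⟩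
    · exact hn
    · simp [hc] at hd
  | head h₁ _ ih =>
    intro c' h'
    rcases Relation.ReflTransGen.cases_head h' with rfl | ⟨d, hd, hd'⟩
    · exact h₁.2
    · rw [h₁.1, Option.mem_some] at hd
      subst hd
      exact ih _ hd'

end Transducer

namespace Instr

variable {Γ Δ : Type} (P : List (Instr Γ Δ)) (K : ℕ)

/-- The position `i` as a control state. -/
def label (i : ℕ) : Fin (P.length + 1) := Fin.ofNat _ i

/-- The type of the transitions of the transducer of a program with jumps. -/
abbrev Transition : Type :=
  Option (Fin (P.length + 1) × Option Phase) × HeadMove × (Fin K → Cell × HeadMove) × Option Δ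

/-- Leave the work tapes unchanged. -/
def idle (read : Fin K → Cell) : Fin K → Cell × HeadMove := fun t => (read t, .stay)

/-- The symbol that is read on the tape of the register `r`. -/
def readReg (read : Fin K → Cell) (r : ℕ) : Cell := if h : r < K then read ⟨r, h⟩ else .blank

/-- Act on the tape of the register `r` only. -/
def actReg (read : Fin K → Cell) (r : ℕ) (x : Cell) (m : HeadMove) : Fin K → Cell × HeadMove :=
  fun t => if t.1 = r then (x, m) else (read t, .stay)

/-- The transition during an operation on the register `r`; `l` gives the next position in
terms of the result of the operation. -/
def opTransition (op : CounterOp) (r : ℕ) (l : Bool → ℕ) (i : Fin (P.length + 1)) :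
    Option Phase → (Fin K → Cell) → Transition (Δ := Δ) P K
  | none, read => (some (i, some .go), .stay, actReg K read r (readReg K read r) .right, none)
  | some q, read =>
    match Counter.step op q (readReg K read r) with
    | (.inl q', x, m) => (some (i, some q'), .stay, actReg K read r x m, none)
    | (.inr b, x, m) => (some (label P (l b), none), .stay, actReg K read r x m, none)

/-- The transition during the execution of an instruction. -/
def transition (i : Fin (P.length + 1)) (q : Option Phase) (σ : InputSymbol Γ)
    (read : Fin K → Cell) : Instr Γ Δ → Transition (Δ := Δ) P K
  | inc r => opTransition P K .inc r (fun _ => i.1 + 1) i q read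
  | dec r => opTransition P K .dec r (fun _ => i.1 + 1) i q read
  | jz r l => opTransition P K .test r (fun b => if b then l else i.1 + 1) i q read
  | jmp l => (some (label P l, none), .stay, idle K read, none)
  | jsym p l => (some (label P (if p σ then l else i.1 + 1), none), .stay, idle K read, none)
  | move m => (some (label P (i.1 + 1), none), m, idle K read, none)
  | out d => (some (label P (i.1 + 1), none), .stay, idle K read, some d)

/-- The transducer of a program with jumps. -/
abbrev toTransducer : Transducer Γ Δ where
  State := Option (Fin (P.length + 1) × Option Phase)
  Tape := Fin K
  Sym := Cell
  finite_state := inferInstance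
  finite_tape := inferInstance
  finite_sym := inferInstance
  start := none
  blank := .blank
  step q σ read :=
    match q with
    | none => some (some (label P 0, none), .stay, fun _ => (.mark, .stay), none)
    | some (i, q) => P[i.1]?.map (transition P K i q σ read)

instance : DecidableEq (toTransducer P K).Tape := inferInstanceAs (DecidableEq (Fin K))

/-- The configuration of the transducer represents a configuration of the program. -/
structure Represents (w : List Γ) (B : ℕ) (c : (toTransducer P K).Config) (i : ℕ)
    (s : Store Δ) : Prop where
  state : c.state = some (label P i, none)
  pos : c.inputHead = s.pos
  pos_le : s.pos ≤ w.length + 1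
  work : ∀ t : Fin K, ∃ l, c.work t = Counter.tape l ∧ Counter.value l = s.regs t.1 ∧
    2 ^ l.length ≤ 2 * B
  head : ∀ t, c.head t = 0
  out : c.output = s.out

variable {P K}

lemma label_val {i : ℕ} (h : i < P.length + 1) : (label P i).1 = i := Nat.mod_eq_of_lt h

lemma label_of_getElem? {i : ℕ} {I : Instr Γ Δ} (h : P[i]? = some I) : (label P i).1 = i := by
  obtain ⟨h', _⟩ := List.getElem?_eq_some_iff.1 h
  exact label_val (by omega)

/-- The result of acting on the tape of the register `r` only. -/
lemma next_actReg {w : List Γ} {c : (toTransducer P K).Config} {r : ℕ} (hr : r < K) {x : Cell}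
    {m : HeadMove} {q : Option (Fin (P.length + 1) × Option Phase)}
    (hs : (toTransducer P K).step c.state (Transducer.inputCell w c.inputHead)
      (fun t => c.work t (c.head t)) =
        some (q, .stay, actReg K (fun t => c.work t (c.head t)) r x m, none))
    (hp : c.inputHead ≤ w.length + 1) :
    (toTransducer P K).next w c = some { c with
      state := q
      work := Function.update c.work ⟨r, hr⟩
        (Function.update (c.work ⟨r, hr⟩) (c.head ⟨r, hr⟩) x)
      head := Function.update c.head ⟨r, hr⟩ (m.apply (c.head ⟨r, hr⟩)) } := by
  rw [Transducer.next_eq_some hs]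
  simp only [Option.some.injEq, Transducer.Config.mk.injEq, true_and]
  refine ⟨by simpa [HeadMove.apply] using hp, ?_, ?_, by simp⟩
  · funext t
    by_cases h : t = ⟨r, hr⟩
    · subst h; simp [actReg]
    · have : t.1 ≠ r := fun h' => h (Fin.ext h')
      simp [actReg, this, h]
  · funext t
    by_cases h : t = ⟨r, hr⟩
    · subst h; simp [actReg]
    · have : t.1 ≠ r := fun h' => h (Fin.ext h')
      simp [actReg, this, h, HeadMove.apply]

/-- An abstract counter run takes place on the tape of one register, while all other tapes stay
idle. -/
lemma run_of_counterRun {w : List Γ} {n : ℕ} {i : Fin (P.length + 1)} {I : Instr Γ Δ}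
    (hI : P[i.1]? = some I) {op : CounterOp} {r : ℕ} (hr : r < K) {l : Bool → ℕ}
    (hop : ∀ q σ read, transition P K i q σ read I = opTransition P K op r l i q read)
    {q : Phase} {T T' : ℕ → Cell} {h : ℕ} {b : Bool} (hrun : Counter.Run op n q T h b T') :
    ∀ {c : (toTransducer P K).Config}, c.state = some (i, some q) → c.work ⟨r, hr⟩ = T →
      c.head ⟨r, hr⟩ = h → c.inputHead ≤ w.length + 1 → (∀ t, t ≠ ⟨r, hr⟩ → c.head t < n) →
      (toTransducer P K).Run w n c { c with
        state := some (label P (l b), none)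
        work := Function.update c.work ⟨r, hr⟩ T'
        head := Function.update c.head ⟨r, hr⟩ 0 } := by
  induction hrun with
  | @done q T b h hn =>
    intro c hq hT hh hp ht
    have := next_actReg (w := w) (c := c) (r := r) hr (x := T 0) (m := .stay)
      (q := some (label P (l b), none)) (by
        simp [hq, toTransducer, hI, hop, opTransition, readReg, hr, hT, hh, h]) hp
    refine .single ⟨?_, fun t => ?_⟩
    · rw [this]
      simp [hh, hT, HeadMove.apply]
    · by_cases h : t = ⟨r, hr⟩
      · rw [h, hh]; exact hn
      · exact ht t h
  | @step q q' T T' h b x m hs hn _ ih =>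
    intro c hq hT hh hp ht
    have := next_actReg (w := w) (c := c) (r := r) hr (x := x) (m := m)
      (q := some (i, some q')) (by
        simp [hq, toTransducer, hI, hop, opTransition, readReg, hr, hT, hh, hs]) hp
    have h2 := ih (c := { c with
      state := some (i, some q')
      work := Function.update c.work ⟨r, hr⟩
        (Function.update (c.work ⟨r, hr⟩) (c.head ⟨r, hr⟩) x)
      head := Function.update c.head ⟨r, hr⟩ (m.apply (c.head ⟨r, hr⟩)) }) rfl
      (by simp [hT, hh]) (by simp [hh]) hp (fun t h => by simp [h, ht])
    refine .head ⟨this, fun t => ?_⟩ (by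
      simp only [Function.update_idem] at h2
      exact h2)
    by_cases h : t = ⟨r, hr⟩
    · rw [h, hh]; exact hn
    · exact ht t h

/-- The machine steps off the mark, performs the counter operation, and returns to the mark. The
assumption quantifies over all words `L` because a register value has many representations with
leading zeros. -/
lemma run_op {w : List Γ} {n B : ℕ} {i : ℕ} {I : Instr Γ Δ}
    (hI : P[i]? = some I) {op : CounterOp} {r : ℕ} (hr : r < K) {l : Bool → ℕ}
    (hop : ∀ q σ read, transition P K (label P i) q σ read I =
      opTransition P K op r l (label P i) q read)
    {s : Store Δ} {c : (toTransducer P K).Config} (hc : Represents P K w B c i s) {x : ℕ} {b : Bool}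
    (hn : 0 < n)
    (hrun : ∀ L, Counter.value L = s.regs r → 2 ^ L.length ≤ 2 * B → ∃ L',
      Counter.Run op n .go (Counter.tape L) 1 b (Counter.tape L') ∧ Counter.value L' = x ∧
        2 ^ L'.length ≤ 2 * B) :
    ∃ c', (toTransducer P K).Run w n c c' ∧ Represents P K w B c' (l b) (s.set r x) := by
  obtain ⟨L, hL, hL', hLB⟩ := hc.work ⟨r, hr⟩
  obtain ⟨L', hrun, hx, hB⟩ := hrun L hL' hLB
  have hi := label_of_getElem? hI
  have hp : c.inputHead ≤ w.length + 1 := hc.pos.trans_le hc.pos_le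
  have := next_actReg (w := w) (c := c) (r := r) hr (x := .mark) (m := .right)
    (q := some (label P i, some .go)) (by
      simp [hc.state, toTransducer, hi, hI, hop, opTransition, readReg, hr, hc.head,
        hL, Counter.tape]) hp
  have h2 := run_of_counterRun (w := w) (by rwa [hi]) hr hop hrun (c := { c with
      state := some (label P i, some .go)
      work := Function.update c.work ⟨r, hr⟩
        (Function.update (c.work ⟨r, hr⟩) (c.head ⟨r, hr⟩) .mark)
      head := Function.update c.head ⟨r, hr⟩ (HeadMove.right.apply (c.head ⟨r, hr⟩)) }) rfl
    (by
      funext j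
      cases j <;> simp [hL, hc.head, Counter.tape])
    (by simp [hc.head, HeadMove.apply]) hp (fun t h => by simp [h, hc.head, hn])
  refine ⟨_, .head ⟨this, fun t => by rw [hc.head]; exact hn⟩ h2, rfl, hc.pos, hc.pos_le,
    fun t => ?_, fun t => ?_, hc.out⟩
  · by_cases h : t = ⟨r, hr⟩
    · subst h
      exact ⟨L', by simp, by simp [Store.set_regs, hx], hB⟩
    · have h' : t.1 ≠ r := fun h' => h (Fin.ext h')
      simpa [h, h', Store.set_regs] using hc.work t
  · by_cases h : t = ⟨r, hr⟩
    · subst h; simp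
    · simp [h, hc.head]

lemma run_idle {w : List Γ} {n B : ℕ} {i j : ℕ} {I : Instr Γ Δ} (hI : P[i]? = some I)
    {m : HeadMove} {o : Option Δ} {s s' : Store Δ} {c : (toTransducer P K).Config}
    (hc : Represents P K w B c i s) (hn : 0 < n)
    (ht : ∀ read, transition P K (label P i) none (Transducer.inputCell w s.pos) read I =
      (some (label P j, none), m, idle K read, o))
    (hr : s'.regs = s.regs) (hp : s'.pos = min (m.apply s.pos) (w.length + 1))
    (ho : s'.out = s.out ++ o.toList) :
    ∃ c', (toTransducer P K).Run w n c c' ∧ Represents P K w B c' j s' := by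
  have hi := label_of_getElem? hI
  refine ⟨{ c with
    state := some (label P j, none)
    inputHead := s'.pos
    output := s'.out }, .single ⟨?_, fun t => by rw [hc.head]; exact hn⟩, rfl, rfl, by simp [hp],
    fun t => by simpa [hr] using hc.work t, hc.head, rfl⟩
  have : (toTransducer P K).step c.state (Transducer.inputCell w c.inputHead)
      (fun t => c.work t (c.head t)) = some (some (label P j, none), m,
        idle K (fun t => c.work t (c.head t)), o) := by
    simp [hc.state, toTransducer, hi, hI, hc.pos, ht]
  rw [Transducer.next_eq_some this]
  simp only [idle, Function.update_eq_self, hc.pos, hp, ho, hc.out]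
  rfl

lemma Step.run {w : List Γ} {n B : ℕ} (hn : ∀ m, 2 ^ m ≤ 2 * B → m + 1 < n) (hn' : 0 < n)
    (hP : ∀ I ∈ P, I.RegsLT K) {i j : ℕ} {s s' : Store Δ} (h : Step w B P (i, s) (j, s'))
    {c : (toTransducer P K).Config} (hc : Represents P K w B c i s) :
    ∃ c', (toTransducer P K).Run w n c c' ∧ Represents P K w B c' j s' := by
  have stay : s.pos = min (HeadMove.stay.apply s.pos) (w.length + 1) := by
    simpa [HeadMove.apply] using hc.pos_le
  have self (r : ℕ) : s.set r (s.regs r) = s := by simp [Store.set]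
  cases h with
  | @inc _ _ r hi h =>
    refine run_op (b := false) (l := fun _ => i + 1) hi (hP _ (List.mem_of_getElem? hi))
      (fun q σ read => ?_) hc hn'
      fun L hL hB => ⟨_, Counter.run_inc [] L (hn _ hB), ?_, ?_⟩
    · simp only [transition, label_of_getElem? hi]
    · rw [List.nil_append, Counter.value_incList, hL]
    · rcases Counter.length_incList L with h' | h'
      · rwa [List.nil_append, h']
      · rw [List.nil_append]; omega
  | @dec _ _ r hi h =>
    refine run_op (b := false) (l := fun _ => i + 1) hi (hP _ (List.mem_of_getElem? hi))
      (fun q σ read => ?_) hc hn'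
      fun L hL hB => ⟨_, Counter.run_dec [] L (hn _ hB) (hL ▸ h), ?_, ?_⟩
    · simp only [transition, label_of_getElem? hi]
    · rw [List.nil_append, Counter.value_decList _ (hL ▸ h), hL]
    · rwa [List.nil_append, Counter.length_decList]
  | @jz_zero _ _ r l hi h =>
    -- A test is treated as an operation that assigns to the register its own value.
    have := run_op (b := true) (x := s.regs r) (op := .test)
      (l := fun b => if b then j else i + 1) hi
      (hP _ (List.mem_of_getElem? hi)) (fun q σ read => ?_) hc hn' (fun L hL hB => ⟨L, ?_, hL, hB⟩)
    · rwa [self] at this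
    · simp only [transition, label_of_getElem? hi]
    · simpa [hL, h] using Counter.run_test [] L (hn _ hB)
  | @jz_pos _ _ r l hi h =>
    have := run_op (b := false) (x := s.regs r) (op := .test)
      (l := fun b => if b then l else i + 1) hi
      (hP _ (List.mem_of_getElem? hi)) (fun q σ read => ?_) hc hn' (fun L hL hB => ⟨L, ?_, hL, hB⟩)
    · rwa [self] at this
    · simp only [transition, label_of_getElem? hi]
    · simpa [hL, h] using Counter.run_test [] L (hn _ hB)
  | jmp hi => exact run_idle hi hc hn' (fun _ => rfl) rfl stay (by simp)
  | jsym_true hi h =>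
    exact run_idle hi hc hn' (m := .stay) (o := none) (fun _ => by simp [transition, h]) rfl stay
      (by simp)
  | jsym_false hi h =>
    exact run_idle hi hc hn' (m := .stay) (o := none)
      (fun _ => by simp [transition, h, label_of_getElem? hi]) rfl stay (by simp)
  | move hi =>
    exact run_idle hi hc hn' (o := none) (fun _ => by simp [transition, label_of_getElem? hi])
      rfl rfl (by simp)
  | @out _ _ d hi =>
    exact run_idle hi hc hn' (m := .stay) (o := some d)
      (fun _ => by simp [transition, label_of_getElem? hi]) rfl stay (by simp)

end Instr

/-- The transducer of a while program. -/
def Cmd.toTransducer {Γ Δ : Type} (c : Cmd Γ Δ) (K : ℕ) : Transducer Γ Δ :=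
  Instr.toTransducer (c.compile 0) K

lemma Cmd.Exec.computesInSpace {Γ Δ : Type} {w : List Γ} {B n K : ℕ} {c : Cmd Γ Δ} {s : Store Δ}
    (h : Exec w B c ⟨fun _ => 0, 0, []⟩ s) (hc : c.RegsLT K) (hB : 0 < B)
    (hn : ∀ m, 2 ^ m ≤ 2 * B → m + 1 < n) :
    (c.toTransducer K).ComputesInSpace w s.out n := by
  have hn' : 0 < n := by
    have := hn 0 (by omega)
    omega
  set P := c.compile 0
  have hrun := h.compile (P := P) (i := 0) ⟨[], [], by simp [P], rfl⟩
  rw [Nat.zero_add] at hrun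
  have key : ∀ x : ℕ × Store Δ,
      Relation.ReflTransGen (Instr.Step w B P) (0, ⟨fun _ => 0, 0, []⟩) x →
      ∃ c', (Instr.toTransducer P K).Run w n (Instr.toTransducer P K).init c' ∧
        Instr.Represents P K w B c' x.1 x.2 := by
    intro x hx
    induction hx with
    | refl =>
      -- The first step of the machine writes the marks; after it every tape carries the empty word,
      -- which represents `0`.
      refine ⟨_, .single ⟨rfl, fun _ => hn'⟩, rfl, ?_, by simp, fun t => ⟨[], ?_, rfl, ?_⟩,
        fun t => rfl, rfl⟩
      · simp [Transducer.init, HeadMove.apply]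
      · funext i
        cases i <;> simp [Transducer.init, Counter.tape, Instr.toTransducer]
      · simp; omega
    | tail _ h₂ ih =>
      obtain ⟨c₁, hc₁, hr₁⟩ := ih
      obtain ⟨c₂, hc₂, hr₂⟩ := Instr.Step.run hn hn' (Cmd.compile_regsLT hc 0) h₂ hr₁
      exact ⟨c₂, hc₁.trans hc₂, hr₂⟩
  obtain ⟨c', hc', hr'⟩ := key _ hrun
  rw [← hr'.out]
  refine hc'.computesInSpace ?_ fun t => by rw [hr'.head]; exact hn'
  -- The final position is the length of the program and holds no instruction, so the machine halts.
  simp [Transducer.next, hr'.state, Instr.toTransducer, Instr.label_val, P]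

/-! ### Programs for the functions in the class `LogFn` -/

namespace Store

variable {Δ : Type} (s : Store Δ)

@[simp] lemma set_regs_self (r x : ℕ) : (s.set r x).regs r = x := by simp [set_regs]

lemma set_regs_of_ne {r i : ℕ} (h : i ≠ r) (x : ℕ) : (s.set r x).regs i = s.regs i := by
  simp [set_regs, h]

@[simp] lemma set_set (r x y : ℕ) : (s.set r x).set r y = s.set r y := by simp [set]

lemma set_eq_self {r x : ℕ} (h : s.regs r = x) : s.set r x = s := by subst h; simp [set]

/-- Change the position of the input head. -/
def moveTo (p : ℕ) : Store Δ := { s with pos := p }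

@[simp] lemma moveTo_regs (p : ℕ) : (s.moveTo p).regs = s.regs := rfl

@[simp] lemma moveTo_out (p : ℕ) : (s.moveTo p).out = s.out := rfl

@[simp] lemma moveTo_pos (p : ℕ) : (s.moveTo p).pos = p := rfl

lemma moveTo_eq_self {p : ℕ} (h : s.pos = p) : s.moveTo p = s := by subst h; rfl

/-- Prove that two states are equal by comparing all registers. -/
lemma ext_regs {s s' : Store Δ} (h : ∀ i, s.regs i = s'.regs i) (hp : s.pos = s'.pos)
    (ho : s.out = s'.out) : s = s' := Store.ext (funext h) hp ho

end Store

namespace Cmd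

variable {Γ Δ : Type} {w : List Γ} {B : ℕ}

/-- The invariant `I` is indexed by the number of remaining rounds, which is the value of the loop
register, so the run goes down from `I N` to `I 0`. -/
lemma Exec.loop_of {r : ℕ} {c : Cmd Γ Δ} (I : ℕ → Store Δ) {N : ℕ} (h : ∀ n ≤ N, (I n).regs r = n)
    (hs : ∀ n < N, Exec w B c (I (n + 1)) (I n)) : Exec w B (loop r c) (I N) (I 0) := by
  induction N with
  | zero => exact .loop_zero (h 0 le_rfl)
  | succ N ih =>
    refine .loop_succ (by rw [h _ le_rfl]; omega) (hs N (by omega))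
      (ih (fun n hn => h n (by omega)) fun n hn => hs n (by omega))

lemma Exec.inc' {s : Store Δ} {r x : ℕ} (h : x ≤ B) (hx : s.regs r + 1 = x) :
    Exec w B (.inc r) s (s.set r x) := by
  subst hx
  exact .inc s r h

lemma Exec.dec' {s : Store Δ} {r x : ℕ} (hx : s.regs r = x + 1) :
    Exec w B (.dec r) s (s.set r x) := by
  have := Exec.dec (w := w) (B := B) s r (by omega)
  rwa [hx, Nat.add_sub_cancel] at this

/-- Set a register to zero. -/
def clear (r : ℕ) : Cmd Γ Δ := loop r (dec r)

lemma Exec.clear (s : Store Δ) (r : ℕ) : Exec w B (clear r) s (s.set r 0) := by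
  have := Exec.loop_of (w := w) (B := B) (r := r) (c := .dec r) (fun n => s.set r n)
    (N := s.regs r) (by simp) (fun n _ => ?_)
  · rwa [s.set_eq_self rfl] at this
  · simpa using Exec.dec' (w := w) (B := B) (s := s.set r (n + 1)) (r := r) (x := n) (by simp)

/-- Move the value of a register to another register. -/
def transfer (r r' : ℕ) : Cmd Γ Δ := loop r (seq (dec r) (inc r'))

lemma Exec.transfer {s : Store Δ} {r r' : ℕ} (hne : r ≠ r') (h0 : s.regs r' = 0)
    (hB : s.regs r ≤ B) :
    Exec w B (transfer r r') s ((s.set r 0).set r' (s.regs r)) := by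
  have := Exec.loop_of (w := w) (B := B) (r := r) (c := .seq (.dec r) (.inc r'))
    (fun n => (s.set r n).set r' (s.regs r - n))
    (N := s.regs r) (by simp [Store.set_regs, hne]) (fun n hn => ?_)
  · rwa [s.set_eq_self rfl, Nat.sub_self, s.set_eq_self h0] at this
  · refine .seq (.dec' (x := n) (by simp [Store.set_regs, hne])) ?_
    convert Exec.inc' (x := s.regs r - n) (r := r') ?_ ?_ using 1
    · refine Store.ext_regs (fun i => ?_) rfl rfl
      simp only [Store.set_regs]
      split_ifs <;> simp_all
    · omega
    · simp only [Store.set_regs, hne.symm, if_false, if_true]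
      omega

/-- Copy the value of the register `r` to the register `r'`, using the register `t`. -/
def copy (r r' t : ℕ) : Cmd Γ Δ :=
  seq (loop r (seq (dec r) (seq (inc r') (inc t)))) (transfer t r)

lemma Exec.copy {s : Store Δ} {r r' t : ℕ} (h1 : r < r') (h2 : r' < t) (h0' : s.regs r' = 0)
    (h0 : s.regs t = 0) (hB : s.regs r ≤ B) :
    Exec w B (copy r r' t) s (s.set r' (s.regs r)) := by
  refine .seq (s' := ((s.set r 0).set r' (s.regs r)).set t (s.regs r)) ?_ ?_
  · have := Exec.loop_of (w := w) (B := B) (r := r)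
      (c := .seq (.dec r) (.seq (.inc r') (.inc t)))
      (fun n => ((s.set r n).set r' (s.regs r - n)).set t (s.regs r - n))
      (N := s.regs r) ?_ (fun n hn => ?_)
    · rwa [s.set_eq_self rfl, Nat.sub_self, s.set_eq_self h0', s.set_eq_self h0] at this
    · intro n hn
      simp only [Store.set_regs]
      split_ifs <;> omega
    · refine .seq (.dec' (x := n) ?_) (.seq (.inc' (x := s.regs r - n) ?_ ?_) ?_)
      · simp only [Store.set_regs]
        split_ifs <;> omega
      · omega
      · simp only [Store.set_regs]
        split_ifs <;> omega
      · convert Exec.inc' (x := s.regs r - n) (r := t) ?_ ?_ using 1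
        · refine Store.ext_regs (fun i => ?_) rfl rfl
          simp only [Store.set_regs]
          split_ifs <;> rfl
        · omega
        · simp only [Store.set_regs]
          split_ifs <;> omega
  · convert Exec.transfer (w := w) (B := B)
      (s := ((s.set r 0).set r' (s.regs r)).set t (s.regs r)) (r := t) (r' := r) (by omega) ?_ ?_
      using 1
    · refine Store.ext_regs (fun i => ?_) rfl rfl
      simp only [Store.set_regs]
      split_ifs <;> simp_all
    · simp only [Store.set_regs]
      split_ifs <;> omega
    · simpa using hB

/-- Whether the left end marker is scanned. -/
def isLeftEnd : InputSymbol Γ → Bool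
  | .leftEnd => true
  | _ => false

/-- Whether the right end marker is scanned. -/
def isRightEnd : InputSymbol Γ → Bool
  | .rightEnd => true
  | _ => false

open Classical in
/-- Whether the letter `x` is scanned. -/
noncomputable def isLetter (x : Γ) : InputSymbol Γ → Bool
  | .letter y => y = x
  | _ => false

lemma isRightEnd_inputCell (n : ℕ) :
    isRightEnd (Transducer.inputCell w (n + 1)) = decide (w.length ≤ n) := by
  rcases lt_or_ge n w.length with h | h
  · simp [Transducer.inputCell, isRightEnd, h]
  · simp [Transducer.inputCell, isRightEnd, h]

open Classical in
lemma isLetter_inputCell (n : ℕ) (x : Γ) :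
    isLetter x (Transducer.inputCell w (min n w.length + 1)) = decide (w[n]? = some x) := by
  rcases lt_or_ge n w.length with h | h
  · simp [Transducer.inputCell, List.getElem?_eq_getElem h, isLetter, h.le]
  · simp [Transducer.inputCell, isLetter, h]

/-- Move the input head to the left end, using the register `t`. -/
def rewind (t : ℕ) : Cmd Γ Δ := seq (inc t) (loop t (ifSym isLeftEnd (dec t) (move .left)))

/-- Register `t` is a flag that keeps the loop alive until the left end marker is seen. Strong
induction is used because a position outside the input tape is first cut down to the right end
marker. -/
lemma Exec.rewind {s : Store Δ} {t : ℕ} (h : s.regs t = 0) (hB : 0 < B) :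
    Exec w B (rewind t) s (s.moveTo 0) := by
  refine .seq (.inc' (x := 1) hB (by omega)) ?_
  generalize hp : s.pos = p
  induction p using Nat.strong_induction_on generalizing s with
  | _ p ih =>
  cases p with
  | zero =>
    refine .loop_succ (s' := s) (by simp) (.ifSym_true (by simp [hp, isLeftEnd,
      Transducer.inputCell]) ?_) ?_
    · have := Exec.dec' (w := w) (B := B) (s := s.set t 1) (r := t) (x := 0) (by simp)
      rwa [Store.set_set, Store.set_eq_self _ h] at this
    · rw [Store.moveTo_eq_self _ hp]
      exact .loop_zero h
  | succ p =>
    refine .loop_succ (by simp) (.ifSym_false ?_ (.move _ _)) ?_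
    · simp only [Store.set_pos, hp, Transducer.inputCell]
      cases w[p]? <;> rfl
    · have := ih (min p (w.length + 1)) (by omega) (s := s.moveTo (min p (w.length + 1))) h rfl
      convert this using 1
      · refine Store.ext_regs (fun _ => rfl) ?_ rfl
        simp [HeadMove.apply, hp, Store.moveTo, Store.set]
      · rfl

end Cmd

namespace LogFn

open Cmd

variable {Γ Δ α : Type} [Ctx Γ α] {B : ℕ}

/-- The variables of the context have the values of the registers with numbers `loc 0, loc 1, …`. -/
def Agree (loc : ℕ → ℕ) (a : α) (s : Store Δ) : Prop :=
  ∀ i v, vars[i]? = some v → s.regs (loc i) = v a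

/-- The function `f` is computed by some program that stores its value in the register `d` and
leaves all other registers unchanged. -/
def Programmable (Δ : Type) (f : α → ℕ) : Prop :=
  ∀ (loc : ℕ → ℕ) (d : ℕ), (∀ i, i < (vars : List (α → ℕ)).length → loc i < d) →
    ∃ (c : Cmd Γ Δ) (e : ℕ), ∀ (a : α) (s : Store Δ) (B : ℕ), Agree loc a s →
      (∀ r, d ≤ r → s.regs r = 0) → s.pos = 0 → size a ^ e ≤ B →
        Exec (word a) B c s (s.set d (f a))

/-- Add a variable. -/
def consLoc (r : ℕ) (loc : ℕ → ℕ) : ℕ → ℕ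
  | 0 => r
  | i + 1 => loc i

lemma consLoc_lt {r d : ℕ} {loc : ℕ → ℕ} (hr : r < d)
    (h : ∀ i, i < (vars : List (α → ℕ)).length → loc i < d) :
    ∀ i, i < (vars : List (α × ℕ → ℕ)).length → consLoc r loc i < d := by
  intro i hi
  cases i with
  | zero => exact hr
  | succ i => exact h i (by simpa [vars] using hi)

lemma Agree.cons {loc : ℕ → ℕ} {a : α} {s : Store Δ} (h : Agree loc a s) {r x : ℕ}
    (hx : s.regs r = x) : Agree (consLoc r loc) (a, x) s := by
  intro i v hv
  cases i with
  | zero =>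
    simp only [vars, List.getElem?_cons_zero, Option.some.injEq] at hv
    subst hv
    exact hx
  | succ i =>
    simp only [vars, List.getElem?_cons_succ, List.getElem?_map, Option.map_eq_some_iff] at hv
    obtain ⟨u, hu, rfl⟩ := hv
    exact h i u hu

lemma Agree.of_cons {loc : ℕ → ℕ} {a : α} {x : ℕ} {s : Store Δ} (h : Agree loc (a, x) s) :
    Agree (fun i => loc (i + 1)) a s := by
  intro i v hv
  exact h (i + 1) (fun p => v p.1) (by simp [vars, hv])

lemma Agree.congr {loc : ℕ → ℕ} {a : α} {s s' : Store Δ} (h : Agree loc a s) {d : ℕ}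
    (hd : ∀ i, i < (vars : List (α → ℕ)).length → loc i < d)
    (hs : ∀ i < d, s'.regs i = s.regs i) : Agree loc a s' := by
  intro i v hv
  rw [hs _ (hd i (List.getElem?_eq_some_iff.1 hv).1), h i v hv]

lemma pow_size_le {a : α} {e e' : ℕ} (h : e ≤ e') : size a ^ e ≤ size a ^ e' :=
  Nat.pow_le_pow_right (by have := two_le_size a; omega) h

lemma pos_of_pow_size_le {a : α} {e : ℕ} (h : size a ^ e ≤ B) : 0 < B :=
  lt_of_lt_of_le (pow_pos (by have := two_le_size a; omega) _) h

lemma programmable_var {v : α → ℕ} (hv : v ∈ vars) : Programmable Δ v := by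
  intro loc d hd
  obtain ⟨i, hi⟩ := List.mem_iff_getElem?.1 hv
  obtain ⟨e, he⟩ := PolyBounded.of_mem_vars hv
  refine ⟨Cmd.copy (loc i) d (d + 1), e, fun a s B hs h0 _ hB => ?_⟩
  rw [← hs i v hi]
  exact .copy (hd i (List.getElem?_eq_some_iff.1 hi).1) (by omega) (h0 _ (by omega))
    (h0 _ (by omega)) (by rw [hs i v hi]; exact (he a).trans hB)

/-- The head walks to the right end marker; register `d` counts the letters and `d + 1` is the flag
of the loop. -/
lemma programmable_length : Programmable Δ (fun a : α => (word a).length) := by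
  intro loc d hd
  refine ⟨.seq (.move .right) (.seq (.inc (d + 1)) (.seq (.loop (d + 1) (.ifSym isRightEnd
    (.dec (d + 1)) (.seq (.move .right) (.inc d)))) (Cmd.rewind (d + 1)))), 1,
    fun a s B hs h0 hp hB => ?_⟩
  rw [pow_one] at hB
  have hB0 : 0 < B := by have := two_le_size a; omega
  refine .seq (.move _ _) (.seq (.inc' (x := 1) hB0 ?_) ?_)
  · simpa using h0 (d + 1) (by omega)
  · have key (m n : ℕ) (h : n + m = (word a).length) :
        Exec (word a) B (.loop (d + 1) (.ifSym isRightEnd (.dec (d + 1))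
          (.seq (.move .right) (.inc d)))) (((s.set (d + 1) 1).set d n).moveTo (n + 1))
          ((s.set d (word a).length).moveTo ((word a).length + 1)) := by
      induction m generalizing n with
      | zero =>
        obtain rfl : n = (word a).length := by omega
        refine .loop_succ (by simp [Store.set_regs]) (.ifSym_true
          (by simp [isRightEnd_inputCell]) (.dec' (x := 0) (by simp [Store.set_regs]))) ?_
        convert Exec.loop_zero ?_ using 1
        · refine Store.ext_regs (fun i => ?_) rfl rfl
          simp only [Store.set_regs, Store.moveTo_regs]
          have := h0 (d + 1) (by omega)
          split_ifs <;> first | rfl | (subst_vars; omega)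
        · simp
      | succ m ih =>
        refine .loop_succ (by simp [Store.set_regs]) (.ifSym_false
          (by simp [isRightEnd_inputCell]; omega) (.seq (.move _ _) (.inc' (x := n + 1) ?_ ?_))) ?_
        · simp only [size] at hB
          omega
        · simp
        · convert ih (n + 1) (by omega) using 1
          refine Store.ext_regs (fun i => ?_) ?_ rfl
          · simp only [Store.set_regs, Store.moveTo_regs]
            split_ifs <;> rfl
          · simp [HeadMove.apply]
            omega
    refine .seq (s' := (s.set d (word a).length).moveTo ((word a).length + 1)) ?_ ?_
    · convert key (word a).length 0 (by omega) using 1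
      refine Store.ext_regs (fun i => ?_) ?_ rfl
      · simp only [Store.set_regs, Store.moveTo_regs]
        have := h0 d (by omega)
        split_ifs <;> first | rfl | (subst_vars; omega)
      · simp [HeadMove.apply, hp]
    · convert Exec.rewind (w := word a)
        (s := (s.set d (word a).length).moveTo ((word a).length + 1)) (t := d + 1) ?_ hB0 using 1
      · exact Store.ext_regs (fun i => rfl) hp rfl
      · simpa [Store.set_regs] using h0 (d + 1) (by omega)

-- Starting from cell `1`, the head moves right `f a` times and the scanned symbol is tested. For `f
-- a` beyond the word it rests on the right end marker, hence the minimum in the intermediate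
-- states.
open Classical in
lemma programmable_letter {f : α → ℕ} (hf : Programmable Δ f) (x : Γ) :
    Programmable Δ (fun a => if (word a)[f a]? = some x then 1 else 0) := by
  intro loc d hd
  obtain ⟨c, e, hc⟩ := hf loc d hd
  refine ⟨.seq c (.seq (.move .right) (.seq (.loop d (.seq (.dec d) (.move .right)))
    (.seq (.ifSym (isLetter x) (.inc d) .skip) (Cmd.rewind (d + 1))))), e,
    fun a s B hs h0 hp hB => ?_⟩
  have hB0 := pos_of_pow_size_le hB
  refine .seq (hc a s B hs h0 hp hB) (.seq (s' := (s.set d (f a)).moveTo 1) ?_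
    (.seq (s' := (s.set d 0).moveTo (Min.min (f a) (word a).length + 1)) ?_
    (.seq (s' := (s.set d (if (word a)[f a]? = some x then 1 else 0)).moveTo
      (Min.min (f a) (word a).length + 1)) ?_ ?_)))
  · convert Exec.move _ _ using 1
    exact Store.ext_regs (fun i => rfl) (by simp [HeadMove.apply, hp]) rfl
  · have := Exec.loop_of (w := word a) (B := B) (r := d) (c := .seq (.dec d) (.move .right))
      (fun n => (s.set d n).moveTo (Min.min (f a - n) (word a).length + 1)) (N := f a)
      (by simp) (fun n hn => ?_)
    · simpa using this
    · refine .seq (.dec' (x := n) (by simp)) ?_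
      convert Exec.move _ _ using 1
      refine Store.ext_regs (fun i => ?_) ?_ rfl
      · simp only [Store.set_regs, Store.moveTo_regs]
        split_ifs <;> rfl
      · simp only [Store.moveTo_pos, Store.set_pos, HeadMove.apply]
        omega
  · split_ifs with h
    · refine .ifSym_true (by simp [isLetter_inputCell, h]) ?_
      convert Exec.inc' (x := 1) (r := d) ?_ ?_ using 1
      · refine Store.ext_regs (fun i => ?_) rfl rfl
        simp only [Store.set_regs, Store.moveTo_regs]
        split_ifs <;> rfl
      · omega
      · simp
    · exact .ifSym_false (by simp [isLetter_inputCell, h]) (.skip _)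
  · convert Exec.rewind (w := word a) (s := (s.set d (if (word a)[f a]? = some x then 1 else
      0)).moveTo (Min.min (f a) (word a).length + 1)) (t := d + 1) ?_ hB0 using 1
    · exact Store.ext_regs (fun i => rfl) hp rfl
    · simpa [Store.set_regs] using h0 (d + 1) (by omega)

/-- The value of `f` in register `d` becomes a variable for the program of `g`, whose result appears
in `d + 1` and is then moved down. -/
lemma programmable_letIn {f : α → ℕ} {g : α × ℕ → ℕ} (hf : Programmable Δ f)
    (hg : Programmable Δ g) (hf' : PolyBounded f) (hg' : PolyBounded g) :
    Programmable Δ (fun a => g (a, f a)) := by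
  intro loc d hd
  obtain ⟨c₁, e₁, hc₁⟩ := hf loc d hd
  obtain ⟨c₂, e₂, hc₂⟩ := hg (consLoc d loc) (d + 1)
    (consLoc_lt (by omega) fun i hi => (hd i hi).trans (by omega))
  obtain ⟨e₃, he₃⟩ := PolyBounded.size_bounded.add hf'
  obtain ⟨e₄, he₄⟩ := hg'.letIn hf'
  refine ⟨.seq c₁ (.seq c₂ (.seq (Cmd.clear d) (Cmd.transfer (d + 1) d))), e₁ + e₃ * e₂ + e₄,
    fun a s B hs h0 hp hB => ?_⟩
  have hB₁ := (pow_size_le (by omega : e₁ ≤ _)).trans hB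
  have hB₂ := (pow_size_le (by omega : e₃ * e₂ ≤ _)).trans hB
  have hB₄ := (pow_size_le (by omega : e₄ ≤ _)).trans hB
  refine .seq (hc₁ a s B hs h0 hp hB₁) (.seq (hc₂ (a, f a) _ B ?_ ?_ hp ?_)
    (.seq (Exec.clear _ _) ?_))
  · refine Agree.cons (hs.congr hd fun i hi => ?_) (by simp)
    rw [Store.set_regs_of_ne _ (by omega)]
  · intro r hr
    rw [Store.set_regs_of_ne _ (by omega)]
    exact h0 r (by omega)
  · refine le_trans ?_ hB₂
    rw [size_prod, pow_mul]
    exact Nat.pow_le_pow_left (he₃ a) _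
  · convert Exec.transfer (r := d + 1) (r' := d) (by omega) ?_ ?_ using 1
    · refine Store.ext_regs (fun i => ?_) rfl rfl
      simp only [Store.set_regs]
      have := h0 (d + 1) (by omega)
      split_ifs <;> first | rfl | omega | (subst_vars; omega)
    · simp
    · simp only [Store.set_regs]
      split_ifs
      · omega
      · exact (he₄ a).trans hB₄

/-- Register `d` holds the current value, `d + 1` the remaining rounds, `d + 2` the finished rounds,
and `d + 3` receives the new value. The exponent `e₅` bounds the size of the points at which the
step function is evaluated. -/
lemma programmable_rec {c i : α → ℕ} {s : (α × ℕ) × ℕ → ℕ} (e : ℕ)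
    (hc : Programmable Δ c) (hi : Programmable Δ i) (hs : Programmable Δ s) (hc' : PolyBounded c)
    (he : ∀ a, ∀ m ≤ c a,
      Nat.rec (motive := fun _ => ℕ) (i a) (fun n y => s ((a, n), y)) m ≤ size a ^ e) :
    Programmable Δ
      (fun a => Nat.rec (motive := fun _ => ℕ) (i a) (fun n y => s ((a, n), y)) (c a)) := by
  intro loc d hd
  have hd' (k : ℕ) : ∀ i, i < (vars : List (α → ℕ)).length → loc i < d + k :=
    fun i hi => (hd i hi).trans_le (by omega)
  obtain ⟨p₁, e₁, hp₁⟩ := hi loc d hd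
  obtain ⟨p₂, e₂, hp₂⟩ := hc loc (d + 1) (hd' 1)
  obtain ⟨p₃, e₃, hp₃⟩ := hs (consLoc d (consLoc (d + 2) loc)) (d + 3)
    (consLoc_lt (by omega) (consLoc_lt (by omega) (hd' 3)))
  obtain ⟨e₄, he₄⟩ := hc'
  obtain ⟨e₅, he₅⟩ := (PolyBounded.size_bounded.add ⟨e₄, he₄⟩).add
    ((PolyBounded.size_bounded (α := α)).pow e)
  refine ⟨.seq p₁ (.seq p₂ (.seq (.loop (d + 1) (.seq p₃ (.seq (Cmd.clear d)
    (.seq (Cmd.transfer (d + 3) d) (.seq (.inc (d + 2)) (.dec (d + 1))))))) (Cmd.clear (d + 2)))),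
    e + e₁ + e₂ + e₄ + e₅ * e₃, fun a t B ht h0 hp hB => ?_⟩
  have hB₀ := (pow_size_le (by omega : e ≤ _)).trans hB
  have hB₁ := (pow_size_le (by omega : e₁ ≤ _)).trans hB
  have hB₂ := (pow_size_le (by omega : e₂ ≤ _)).trans hB
  have hB₄ := (pow_size_le (by omega : e₄ ≤ _)).trans hB
  have hB₅ := (pow_size_le (by omega : e₅ * e₃ ≤ _)).trans hB
  set F : ℕ → ℕ := Nat.rec (motive := fun _ => ℕ) (i a) (fun n y => s ((a, n), y)) with hF
  let I : ℕ → Store Δ := fun n =>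
    ((t.set d (F (c a - n))).set (d + 1) n).set (d + 2) (c a - n)
  have hI (n : ℕ) : I n = ((t.set d (F (c a - n))).set (d + 1) n).set (d + 2) (c a - n) := rfl
  refine .seq (hp₁ a t B ht h0 hp hB₁) (.seq (s' := I (c a)) ?_ (.seq (s' := I 0) ?_ ?_))
  · convert hp₂ a (t.set d (i a)) B ?_ ?_ hp hB₂ using 1
    · refine Store.ext_regs (fun i => ?_) rfl rfl
      have := h0 (d + 2) (by omega)
      simp only [hI, Store.set_regs, Nat.sub_self, hF]
      split_ifs <;> first | rfl | omega | (subst_vars; omega)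
    · exact ht.congr hd fun i hi => by rw [Store.set_regs_of_ne _ (by omega)]
    · intro r hr
      rw [Store.set_regs_of_ne _ (by omega)]
      exact h0 r (by omega)
  · refine .loop_of I (fun n _ => ?_) fun n hn => ?_
    · simp [hI, Store.set_regs]
    · have hF' : F (c a - n) = s ((a, c a - (n + 1)), F (c a - (n + 1))) := by
        rw [show c a - n = c a - (n + 1) + 1 by omega]
      have hFB : F (c a - n) ≤ B := (he a _ (by omega)).trans hB₀
      refine .seq (hp₃ ((a, c a - (n + 1)), F (c a - (n + 1))) _ B ?_ ?_ hp ?_) ?_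
      · refine Agree.cons (Agree.cons (ht.congr hd fun i hi => ?_) ?_) ?_
        · simp only [hI, Store.set_regs]
          split_ifs <;> first | rfl | omega
        · simp [hI]
        · simp [hI, Store.set_regs]
      · intro r hr
        simp only [hI, Store.set_regs]
        split_ifs <;> first | omega | exact h0 r (by omega)
      · refine le_trans ?_ hB₅
        rw [size_prod, size_prod, pow_mul]
        refine Nat.pow_le_pow_left (le_trans ?_ (he₅ a)) _
        have := he a (c a - (n + 1)) (by omega)
        simp only
        change F (c a - (n + 1)) ≤ _ at this
        omega
      · rw [← hF']
        refine .seq (.clear _ _) (.seq (.transfer (by omega) (by simp) ?_)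
          (.seq (.inc' (x := c a - n) ?_ ?_) ?_))
        · simpa [Store.set_regs] using hFB
        · exact le_trans (by omega) ((he₄ a).trans hB₄)
        · simp only [hI, Store.set_regs]
          split_ifs <;> omega
        · convert Exec.dec' (x := n) (r := d + 1) ?_ using 1
          · refine Store.ext_regs (fun i => ?_) rfl rfl
            have := h0 (d + 3) (by omega)
            simp only [hI, Store.set_regs]
            split_ifs <;> first | rfl | omega | (subst_vars; omega)
          · simp [hI, Store.set_regs]
  · convert Exec.clear _ _ using 1
    refine Store.ext_regs (fun i => ?_) rfl rfl
    have := h0 (d + 1) (by omega)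
    have := h0 (d + 2) (by omega)
    simp only [hI, Store.set_regs, Nat.sub_zero]
    split_ifs <;> first | rfl | omega | (subst_vars; omega)

/-- Induction over the construction of `f`; it completes the passage from recursions to while
programs. -/
lemma programmable {f : α → ℕ} (hf : LogFn f) (Δ : Type) : Programmable Δ f := by
  induction hf with
  | var hv => exact programmable_var hv
  | weaken _ ih =>
    intro loc d hd
    obtain ⟨c, e, hc⟩ := ih (fun i => loc (i + 1)) d fun i hi => hd (i + 1) (by simpa [vars])
    refine ⟨c, e, fun a s B hs h0 hp hB => hc a.1 s B hs.of_cons h0 hp (le_trans ?_ hB)⟩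
    exact Nat.pow_le_pow_left (by rw [size_prod]; omega) _
  | zero =>
    intro loc d _
    refine ⟨.skip, 0, fun a s B _ h0 _ _ => ?_⟩
    rw [Store.set_eq_self _ (h0 d le_rfl)]
    exact .skip s
  | @succ _ _ f hf ih =>
    intro loc d hd
    obtain ⟨c, e, hc⟩ := ih loc d hd
    obtain ⟨e', he'⟩ := hf.succ.polyBounded
    refine ⟨.seq c (.inc d), e + e', fun a s B hs h0 hp hB => ?_⟩
    refine .seq (hc a s B hs h0 hp ((pow_size_le (by omega)).trans hB)) ?_
    have := Exec.inc' (w := word a) (B := B) (s := s.set d (f a)) (r := d)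
      ((he' a).trans ((pow_size_le (by omega)).trans hB)) (by simp)
    simpa using this
  | length => exact programmable_length
  | letter _ x ih => exact programmable_letter ih x
  | letIn hf hg ihf ihg => exact programmable_letIn ihf ihg hf.polyBounded hg.polyBounded
  | recBounded e hc _ _ he ihc ihi ihs => exact programmable_rec e ihc ihi ihs hc.polyBounded he

end LogFn

/-! ### The transducer of a word function -/

section Transduce

open Cmd

variable {Γ Δ : Type}

/-- Run through the programs `c x`; whenever the register `2` becomes `1`, output the letter `x`. -/
def Cmd.emit (c : Δ → Cmd Γ Δ) : List Δ → Cmd Γ Δ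
  | [] => .skip
  | x :: l => .seq (c x) (.seq (.loop 2 (.seq (.dec 2) (.out x))) (emit c l))

open Classical in
lemma Cmd.Exec.emit {w : List Γ} {B : ℕ} {c : Δ → Cmd Γ Δ} {o : Option Δ} (l : List Δ) (s : Store Δ)
    (h2 : s.regs 2 = 0)
    (h : ∀ x (v : List Δ), Exec w B (c x) { s with out := v }
      (({ s with out := v } : Store Δ).set 2 (if o = some x then 1 else 0))) :
    Exec w B (emit c l) s { s with out := s.out ++ l.filter (fun x => o = some x) } := by
  induction l generalizing s with
  | nil => simpa using! Exec.skip s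
  | cons x l ih =>
    refine .seq (h x s.out) (.seq (s' := { s with
      out := s.out ++ if o = some x then [x] else [] }) ?_ ?_)
    · split_ifs with hx
      · refine .loop_succ (by simp) (.seq (.dec' (x := 0) (by simp)) (.out _ _)) ?_
        rw [Store.set_set, Store.set_eq_self _ h2]
        exact .loop_zero h2
      · rw [Store.set_eq_self _ h2, List.append_nil]
        exact .loop_zero h2
    · convert ih { s with out := s.out ++ if o = some x then [x] else [] } h2
        (fun y v => h y v) using 2
      simp only [List.append_assoc, List.filter_cons, decide_eq_true_eq]
      split_ifs <;> simp

lemma List.filter_eq_some_of_nodup {l : List Δ} (hl : l.Nodup) (hm : ∀ x, x ∈ l) (o : Option Δ)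
    (p : Δ → Bool) (hp : ∀ x, p x = true ↔ o = some x) : l.filter p = o.toList := by
  cases o with
  | none =>
    simp only [Option.toList_none, List.filter_eq_nil_iff, hp]
    simp
  | some y =>
    have : (l.filter p).Perm [y] := by
      rw [List.perm_ext_iff_of_nodup (hl.filter p) (by simp)]
      intro x
      simp [hm, hp, eq_comm]
    simpa using this

/-- Numbers of digits of polynomially bounded numbers are logarithmic. -/
lemma log_bound {N e m : ℕ} (h : 2 ^ m ≤ 2 * (N + 2) ^ e) :
    m + 1 < (2 * e + 3) * (Nat.log 2 N + 1) := by
  set l := Nat.log 2 N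
  have h1 : N < 2 ^ (l + 1) := Nat.lt_pow_succ_log_self (by norm_num) N
  have h2 : 2 ^ m ≤ 2 ^ (1 + (l + 2) * e) := by
    refine h.trans ?_
    rw [pow_add, pow_mul, pow_one]
    refine Nat.mul_le_mul_left _ (Nat.pow_le_pow_left ?_ _)
    have : 1 ≤ 2 ^ l := Nat.one_le_two_pow
    rw [pow_succ] at h1 ⊢
    rw [pow_succ]
    omega
  have h3 := (Nat.pow_le_pow_iff_right (by norm_num)).1 h2
  nlinarith

/-- The functions in the class `LogWord` are computed by transducers in logarithmic space. -/
theorem LogWord.exists_transducer [Finite Δ] {W : List Γ → List Δ} (hW : LogWord W) :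
    ∃ (M : Transducer Γ Δ) (c : ℕ), ∀ w,
      M.ComputesInSpace w (W w) (c * (Nat.log 2 w.length + 1)) := by
  classical
  have := Fintype.ofFinite Δ
  obtain ⟨cl, el, hcl⟩ := hW.1.programmable Δ (fun _ => 0) 0 (by simp [Ctx.vars])
  have hx (x : Δ) := (hW.2 x).indicator.programmable Δ (fun _ => 1) 2 (by simp)
  choose cx ex hcx using hx
  obtain ⟨e₁, he₁⟩ := hW.1.polyBounded
  obtain ⟨e₂, he₂⟩ := (PolyBounded.size_bounded (α := List Γ)).add ⟨e₁, he₁⟩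
  set E := el + e₁ + e₂ * (∑ x, ex x)
  -- Register `0` holds the number of letters still to be written, `1` the position of the next
  -- letter, and `2` the answer whether this letter is `x`.
  let prog : Cmd Γ Δ := .seq cl (.loop 0 (.seq (Cmd.emit cx Finset.univ.toList)
    (.seq (.inc 1) (.dec 0))))
  obtain ⟨K, hK⟩ := prog.exists_regsLT
  refine ⟨prog.toTransducer K, 2 * E + 3, fun w => ?_⟩
  set B := (w.length + 2) ^ E
  have hsize : Ctx.size w = w.length + 2 := by simp [Ctx.size, Ctx.word, Ctx.vars]
  have hB : Ctx.size w ^ E ≤ B := by rw [hsize]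
  have hB₁ := (LogFn.pow_size_le (by omega : el ≤ E)).trans hB
  have hB₂ := (LogFn.pow_size_le (by omega : e₁ ≤ E)).trans hB
  have hB₃ (x : Δ) : Ctx.size w ^ (e₂ * ex x) ≤ B :=
    (LogFn.pow_size_le ((Nat.mul_le_mul_left _
      (Finset.single_le_sum (f := ex) (fun _ _ => Nat.zero_le _) (Finset.mem_univ x))).trans
        (by omega : e₂ * (∑ x, ex x) ≤ E))).trans hB
  let s₀ : Store Δ := ⟨fun _ => 0, 0, []⟩
  let I : ℕ → Store Δ := fun n =>
    { (s₀.set 0 n).set 1 ((W w).length - n) with out := (W w).take ((W w).length - n) }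
  have hI (n : ℕ) : I n =
    { (s₀.set 0 n).set 1 ((W w).length - n) with out := (W w).take ((W w).length - n) } := rfl
  have h : Exec w B prog s₀ (I 0) := by
    refine .seq (s' := I (W w).length) ?_ (.loop_of I (fun n _ => ?_) fun n hn => ?_)
    · have : I (W w).length = s₀.set 0 (W w).length := by
        refine Store.ext_regs (fun i => ?_) rfl (by simp [hI, s₀])
        simp only [hI, Store.set_regs, s₀]
        split_ifs <;> omega
      rw [this]
      exact hcl w s₀ B (fun i v hv => by simp [Ctx.vars] at hv) (fun _ _ => rfl) rfl hB₁
    · simp [hI, Store.set_regs]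
    · set k := (W w).length - (n + 1)
      have hk : k < (W w).length := by omega
      have hk' : (W w).length - n = k + 1 := by omega
      refine .seq (Cmd.Exec.emit (o := (W w)[k]?) _ _ ?_ ?_)
        (.seq (.inc' (x := k + 1) ?_ ?_) ?_)
      · simp [hI, Store.set_regs, s₀]
      · intro x v
        refine hcx x (w, k) _ B ?_ ?_ rfl ?_
        · intro i v hv
          simp only [Ctx.vars, List.map_nil] at hv
          cases i with
          | zero =>
            obtain rfl : Prod.snd = v := by simpa using hv
            simp [hI, k]
          | succ i => simp at hv
        · intro r hr
          simp only [hI, Store.set_regs, s₀]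
          split_ifs <;> omega
        · refine le_trans ?_ (hB₃ x)
          rw [Ctx.size_prod, pow_mul]
          refine Nat.pow_le_pow_left (le_trans ?_ (he₂ w)) _
          simp only
          omega
      · exact hk.trans_le ((he₁ w).trans hB₂)
      · simp [hI, k]
      · rw [List.filter_eq_some_of_nodup (Finset.nodup_toList _) (by simp) (W w)[k]?
          _ (by simp)]
        convert Exec.dec' (x := n) (r := 0) ?_ using 1
        · refine Store.ext_regs (fun i => ?_) rfl ?_
          · simp only [hI, Store.set_regs, hk']
            split_ifs <;> first | rfl | omega
          · simp only [hI, Store.set_out, hk']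
            rw [List.take_add_one]
        · simp [hI, Store.set_regs]
  have := h.computesInSpace hK (LogFn.pos_of_pow_size_le hB) (n := (2 * E + 3) *
    (Nat.log 2 w.length + 1)) fun m hm => log_bound hm
  simpa [hI] using this

end Transduce

/-! ### Word functions that are computed by transducers in logarithmic space -/

section Digits

lemma digit_sum {b s h : ℕ} {a : ℕ → ℕ} (ha : ∀ i, a i < b) (hs : h < s) :
    (∑ i ∈ Finset.range s, a i * b ^ i) / b ^ h % b = a h := by
  have := finFunctionFinEquiv_symm_apply_val (m := b) (n := s)
    (finFunctionFinEquiv fun i : Fin s => ⟨a i, ha i⟩) ⟨h, hs⟩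
  rw [Equiv.symm_apply_apply, finFunctionFinEquiv_apply_val] at this
  simp only at this
  rw [this, Finset.sum_range]

lemma digits_lt {b s : ℕ} {a : ℕ → ℕ} (ha : ∀ i, a i < b) :
    ∑ i ∈ Finset.range s, a i * b ^ i < b ^ s := by
  have := (finFunctionFinEquiv fun i : Fin s => (⟨a i, ha i⟩ : Fin b)).2
  rwa [finFunctionFinEquiv_apply_val, ← Finset.sum_range (fun i => a i * b ^ i)] at this

/-- Rewriting one cell of a tape that is stored as a number. The new digit is added before the old
one is subtracted, so truncated subtraction is exact. -/
lemma digits_update {b s h : ℕ} (a : ℕ → ℕ) (x : ℕ) (hs : h < s) :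
    ∑ i ∈ Finset.range s, Function.update a h x i * b ^ i =
      ∑ i ∈ Finset.range s, a i * b ^ i + x * b ^ h - a h * b ^ h := by
  have hm : h ∈ Finset.range s := Finset.mem_range.2 hs
  have h1 := Finset.add_sum_erase (Finset.range s) (fun i => Function.update a h x i * b ^ i) hm
  have h2 := Finset.add_sum_erase (Finset.range s) (fun i => a i * b ^ i) hm
  have h3 : ∑ i ∈ (Finset.range s).erase h, Function.update a h x i * b ^ i =
      ∑ i ∈ (Finset.range s).erase h, a i * b ^ i :=
    Finset.sum_congr rfl fun i hi => by rw [Function.update_of_ne (Finset.ne_of_mem_erase hi)]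
  simp only [Function.update_self] at h1
  omega

end Digits

namespace LogFn

variable {Γ α : Type} [Ctx Γ α]

lemma coord {ι : Type} [Fintype ι] (i : ι) : LogFn (fun p : α × (ι → ℕ) => p.2 i) :=
  .var (by simp [vars])

/-- Case distinction by the values of a function with finitely many values. -/
lemma cases {Y : Type} [Finite Y] {g : α → Y} {f : Y → α → ℕ}
    (hg : ∀ y, LogPred (fun a => g a = y)) (hf : ∀ y, LogFn (f y)) :
    LogFn (fun a => f (g a) a) := by
  classical
  have := Fintype.ofFinite Y
  refine (finsetSum Finset.univ fun y _ => ite (hg y) (hf y) zero).congr fun a => ?_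
  simp

/-- The simultaneous iteration of finitely many functions, modulo a bound. -/
lemma iterateVec {ι : Type} [Fintype ι] {c bd : α → ℕ} {init : ι → α → ℕ}
    {step : ι → α × (ι → ℕ) → ℕ} (hc : LogFn c) (hbd : LogFn bd) (hpos : ∀ a, 0 < bd a)
    (hi : ∀ i, LogFn (init i)) (hs : ∀ i, LogFn (step i)) (j : ι) :
    LogFn (fun a => (fun d i => step i (a, d) % bd a)^[c a] (fun i => init i a % bd a) j) := by
  classical
  let e := Fintype.equivFin ι
  -- The vector is stored as one number with the coordinates as base-`m` digits, which reduces the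
  -- claim to the iteration of a single function.
  let pack (m : ℕ) (d : ι → ℕ) : ℕ := ∑ i, d i * m ^ (e i).1
  let unpack (m x : ℕ) (i : ι) : ℕ := x / m ^ (e i).1 % m
  have hpack (m : ℕ) (d : ι → ℕ) (hd : ∀ i, d i < m) :
      pack m d = (finFunctionFinEquiv fun i => (⟨d (e.symm i), hd _⟩ : Fin m) : ℕ) := by
    rw [finFunctionFinEquiv_apply_val, ← e.sum_comp]
    simp [pack]
  have hunpack (m : ℕ) (d : ι → ℕ) (hd : ∀ i, d i < m) : unpack m (pack m d) = d := by
    funext i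
    have := finFunctionFinEquiv_symm_apply_val
      (finFunctionFinEquiv fun i => (⟨d (e.symm i), hd _⟩ : Fin m)) (e i)
    rw [Equiv.symm_apply_apply, ← hpack] at this
    simpa using this.symm
  let s : α × ℕ → ℕ := fun p =>
    pack (bd p.1) (fun i => step i (p.1, unpack (bd p.1) p.2) % bd p.1)
  have hs_le (a : α) (y : ℕ) : s (a, y) ≤ bd a ^ Fintype.card ι := by
    simp only [s]
    rw [hpack _ _ fun i => Nat.mod_lt _ (hpos a)]
    exact (Fin.is_lt _).le
  have hbd' : LogFn (fun p : (α × ℕ) × ℕ => bd p.1.1) := hbd.weaken.weaken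
  have hs' : LogFn (fun p : (α × ℕ) × ℕ => s (p.1.1, p.2)) := by
    refine finsetSum _ fun i _ => (mod ?_ hbd').mul (hbd'.pow _)
    refine (hs i).subst (φ := fun p : (α × ℕ) × ℕ => (p.1.1, unpack (bd p.1.1) p.2))
      (fun _ => rfl) fun v hv => ?_
    simp only [vars, List.mem_append, List.mem_map, Finset.mem_toList, Finset.mem_univ,
      true_and] at hv
    rcases hv with ⟨i, rfl⟩ | ⟨v, hv, rfl⟩
    · exact (snd.div (hbd'.pow _)).mod hbd'
    · exact (LogFn.var hv).weaken.weaken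
  have hinit : LogFn (fun a => pack (bd a) (fun i => init i a % bd a)) :=
    finsetSum _ fun i _ => ((hi i).mod hbd).mul (hbd.pow _)
  have key (a : α) (n : ℕ) : (fun y => s (a, y))^[n] (pack (bd a) (fun i => init i a % bd a)) =
      pack (bd a) ((fun d i => step i (a, d) % bd a)^[n] (fun i => init i a % bd a)) ∧
      ∀ i, (fun d i => step i (a, d) % bd a)^[n] (fun i => init i a % bd a) i < bd a := by
    induction n with
    | zero => exact ⟨rfl, fun i => Nat.mod_lt _ (hpos a)⟩
    | succ n ih =>
      rw [Function.iterate_succ_apply', Function.iterate_succ_apply', ih.1]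
      exact ⟨by simp only [s, hunpack _ _ ih.2], fun i => Nat.mod_lt _ (hpos a)⟩
  refine (((iterate hc hinit (hbd.pow _) hs_le hs').div (hbd.pow (e j).1)).mod hbd).congr
    fun a => ?_
  rw [(key a _).1]
  exact (congrFun (hunpack _ _ (key a _).2) j).symm

end LogFn

/-! ### Words given by the outputs of successive steps -/

section FilterMap

variable {Δ : Type} (o : ℕ → Option Δ)

lemma length_filterMap_range (n : ℕ) :
    ((List.range n).filterMap o).length = Nat.count (fun t => (o t).isSome = true) n := by
  induction n with
  | zero => rfl
  | succ n ih =>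
    rw [List.range_succ, List.filterMap_append, List.length_append, ih, Nat.count_succ]
    cases h : o n <;> simp [h]

/-- A letter has position `p` if exactly `p` letters were emitted before it. So it can be found by
counting, without storing the list. -/
lemma getElem?_filterMap_range (n p : ℕ) (x : Δ) :
    ((List.range n).filterMap o)[p]? = some x ↔
      ∃ t < n, o t = some x ∧ Nat.count (fun t => (o t).isSome = true) t = p := by
  induction n with
  | zero => simp
  | succ n ih =>
    have hl := length_filterMap_range o n
    rw [List.range_succ, List.filterMap_append]
    rcases lt_or_ge p ((List.range n).filterMap o).length with h | h
    · rw [List.getElem?_append_left h, ih]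
      constructor
      · rintro ⟨t, ht, h'⟩
        exact ⟨t, by omega, h'⟩
      · rintro ⟨t, ht, h', h''⟩
        refine ⟨t, lt_of_le_of_ne (by omega) ?_, h', h''⟩
        rintro rfl
        omega
    · rw [List.getElem?_append_right h]
      constructor
      · intro h'
        refine ⟨n, by omega, ?_⟩
        cases ho : o n with
        | none => simp [ho] at h'
        | some y =>
          simp only [List.filterMap_cons, ho, List.filterMap_nil,
            List.getElem?_eq_some_iff, List.length_singleton] at h'
          obtain ⟨h1, h2⟩ := h'
          have : p - ((List.range n).filterMap o).length = 0 := by omega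
          simp only [this, List.getElem_cons_zero] at h2
          exact ⟨by rw [h2], by omega⟩
      · rintro ⟨t, ht, h', h''⟩
        obtain rfl : t = n := by
          by_contra hne
          have h1 : Nat.count (fun t => (o t).isSome = true) (t + 1) ≤
            Nat.count (fun t => (o t).isSome = true) n := Nat.count_monotone _ (by omega)
          rw [Nat.count_succ] at h1
          simp only [h', Option.isSome_some, if_true] at h1
          omega
        rw [← h'', hl]
        simp [h']

lemma LogWord.filterMap_range {Γ : Type} [Finite Δ] {T : List Γ → ℕ} {o : List Γ → ℕ → Option Δ}
    (hT : LogFn T) (ho : ∀ x, LogPred (fun p : List Γ × ℕ => o p.1 p.2 = some x)) :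
    LogWord (fun w => (List.range (T w)).filterMap (o w)) := by
  have hs : LogPred (fun p : List Γ × ℕ => (o p.1 p.2).isSome = true) :=
    (LogPred.exists_finite ho).congr fun p => Option.isSome_iff_exists
  refine ⟨(LogFn.count hT hs).congr fun w => length_filterMap_range _ _, fun x => ?_⟩
  refine (LogPred.exists_lt (p := fun q : (List Γ × ℕ) × ℕ => o q.1.1 q.2 = some x ∧
      Nat.count (fun t => (o q.1.1 t).isSome = true) q.2 = q.1.2) hT.weaken (.and ?_ ?_)).congr
      fun p => getElem?_filterMap_range _ _ _ _
  · refine (ho x).subst (φ := fun q : (List Γ × ℕ) × ℕ => (q.1.1, q.2)) (fun _ => rfl) ?_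
    simpa [vars] using LogFn.snd
  · refine .eq (LogFn.count (p := fun r : ((List Γ × ℕ) × ℕ) × ℕ => (o r.1.1.1 r.2).isSome = true)
      LogFn.snd ?_) LogFn.snd.weaken
    refine hs.subst (φ := fun r : ((List Γ × ℕ) × ℕ) × ℕ => (r.1.1.1, r.2)) (fun _ => rfl) ?_
    simpa [vars] using LogFn.snd

end FilterMap

namespace InputSymbol

instance {Γ : Type} [Finite Γ] : Finite (InputSymbol Γ) := by
  refine Finite.of_injective (β := Option (Option Γ))
    (fun | .leftEnd => none | .rightEnd => some none | .letter x => some (some x)) ?_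
  rintro (_ | _ | _) (_ | _ | _) <;> simp

end InputSymbol

/-- The scanned input symbol is given by functions in the class `LogFn`. -/
lemma LogFn.inputCell {Γ α : Type} [Ctx Γ α] {f : α → ℕ} (hf : LogFn f) (σ : InputSymbol Γ) :
    LogPred (fun a => Transducer.inputCell (word a) (f a) = σ) := by
  have h1 : LogPred (fun a => 0 < f a) := .lt .zero hf
  cases σ with
  | leftEnd =>
    refine (LogPred.eq hf .zero).congr fun a => ?_
    cases f a with
    | zero => simp [Transducer.inputCell]
    | succ n =>
      simp only [Transducer.inputCell]
      cases (word a)[n]? <;> simp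
  | letter x =>
    refine (h1.and (LogPred.letter hf.pred x)).congr fun a => ?_
    cases f a with
    | zero => simp [Transducer.inputCell]
    | succ n =>
      simp only [Transducer.inputCell]
      cases h : (word a)[n]? <;> simp [h]
  | rightEnd =>
    refine (h1.and (LogPred.le LogFn.length hf.pred)).congr fun a => ?_
    cases f a with
    | zero => simp [Transducer.inputCell]
    | succ n =>
      simp only [Transducer.inputCell]
      rw [Nat.add_sub_cancel, ← List.getElem?_eq_none_iff]
      cases (word a)[n]? <;> simp

/-! ### Arithmetical simulation of transducers -/

namespace Transducer

/-- The numbers that describe a configuration: the state, the position of the input head, and for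
each work tape its contents as a number and the power of the base given by the position of its
head. -/
inductive Part (T : Type)
  | state
  | pos
  | tape (t : T)
  | head (t : T)
  deriving Fintype

/-- Numberings of the states and of the work symbols of a transducer. -/
structure Numbering {Γ Δ : Type} (M : Transducer Γ Δ) where
  nState : ℕ
  nSym : ℕ
  state : M.State ≃ Fin nState
  sym : M.Sym ≃ Fin nSym
  sym_blank : (sym M.blank : ℕ) = 0

/-- A transposition gives the blank the digit `0`, so that an empty tape is the number `0`. -/
lemma exists_numbering {Γ Δ : Type} (M : Transducer Γ Δ) : Nonempty M.Numbering := by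
  classical
  have := M.finite_state
  have := M.finite_sym
  obtain ⟨n, ⟨e⟩⟩ := Finite.exists_equiv_fin M.State
  obtain ⟨m, ⟨f⟩⟩ := Finite.exists_equiv_fin M.Sym
  have hm : 0 < m := (f M.blank).pos
  exact ⟨⟨n, m, e, f.trans (Equiv.swap (f M.blank) ⟨0, hm⟩), by simp⟩⟩

namespace Numbering

variable {Γ Δ : Type} {M : Transducer Γ Δ} (𝒩 : M.Numbering)

lemma nState_pos : 0 < 𝒩.nState := (𝒩.state M.start).pos

lemma nSym_pos : 0 < 𝒩.nSym := (𝒩.sym M.blank).pos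

/-- What the machine sees in a configuration. -/
def view (w : List Γ) (d : Part M.Tape → ℕ) : M.State × InputSymbol Γ × (M.Tape → M.Sym) :=
  (𝒩.state.symm ⟨d .state % 𝒩.nState, Nat.mod_lt _ 𝒩.nState_pos⟩, inputCell w (d .pos),
    fun t => 𝒩.sym.symm ⟨d (.tape t) / d (.head t) % 𝒩.nSym, Nat.mod_lt _ 𝒩.nSym_pos⟩)

/-- The movement of a head whose position is given by a power of the base. -/
def moveHead (m : HeadMove) (h : ℕ) : ℕ :=
  match m with
  | .left => max 1 (h / 𝒩.nSym)
  | .stay => h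
  | .right => h * 𝒩.nSym

/-- One step of the computation in terms of numbers; `y` is what the machine sees. -/
def stepNat (w : List Γ) (y : M.State × InputSymbol Γ × (M.Tape → M.Sym)) (d : Part M.Tape → ℕ)
    (i : Part M.Tape) : ℕ :=
  match M.step y.1 y.2.1 y.2.2 with
  | none => d i
  | some (q, m, act, _) =>
    match i with
    | .state => 𝒩.state q
    | .pos => min (m.apply (d .pos)) (w.length + 1)
    | .tape t => d (.tape t) + 𝒩.sym (act t).1 * d (.head t) - 𝒩.sym (y.2.2 t) * d (.head t)
    | .head t => 𝒩.moveHead (act t).2 (d (.head t))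

/-- The output of one step. -/
def outNat (w : List Γ) (d : Part M.Tape → ℕ) : Option Δ :=
  (M.step (𝒩.view w d).1 (𝒩.view w d).2.1 (𝒩.view w d).2.2).bind fun r => r.2.2.2

/-- The initial configuration. -/
def initNat : Part M.Tape → ℕ
  | .state => 𝒩.state M.start
  | .pos => 0
  | .tape _ => 0
  | .head _ => 1

/-- The computation in terms of numbers, modulo a bound. -/
def run (bd : ℕ) (w : List Γ) (n : ℕ) : Part M.Tape → ℕ :=
  (fun d i => 𝒩.stepNat w (𝒩.view w d) d i % bd)^[n] (fun i => 𝒩.initNat i % bd)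

section LogFn

variable [Fintype M.Tape]

/-- There are only finitely many views, so one step of the machine becomes a case distinction over
them with an arithmetical formula in each case. -/
lemma logPred_view [Finite Γ] (y : M.State × InputSymbol Γ × (M.Tape → M.Sym)) :
    LogPred (fun p : List Γ × (Part M.Tape → ℕ) => 𝒩.view p.1 p.2 = y) := by
  obtain ⟨q, σ, f⟩ := y
  refine (((LogPred.eq ((LogFn.coord .state).mod (.const 𝒩.nState))
    (.const (𝒩.state q).1)).and ((LogFn.inputCell (LogFn.coord .pos) σ).and
      (LogPred.forall_finite fun t : M.Tape => LogPred.eq (((LogFn.coord (.tape t)).div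
        (.coord (.head t))).mod (.const 𝒩.nSym)) (.const (𝒩.sym (f t)).1))))).congr fun p => ?_
  simp only [view, Prod.mk.injEq, funext_iff, Equiv.symm_apply_eq, Fin.ext_iff]
  rfl

lemma logFn_stepNat (y : M.State × InputSymbol Γ × (M.Tape → M.Sym)) (i : Part M.Tape) :
    LogFn (fun p : List Γ × (Part M.Tape → ℕ) => 𝒩.stepNat p.1 y p.2 i) := by
  have hc (i : Part M.Tape) : LogFn (fun p : List Γ × (Part M.Tape → ℕ) => p.2 i) := LogFn.coord i
  cases h : M.step y.1 y.2.1 y.2.2 with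
  | none => simpa only [stepNat, h] using hc i
  | some r =>
    obtain ⟨q, m, act, o⟩ := r
    cases i with
    | state => simpa only [stepNat, h] using LogFn.const _
    | pos =>
      simp only [stepNat, h]
      refine LogFn.min ?_ LogFn.length.succ
      cases m
      · exact (hc .pos).pred
      · exact hc .pos
      · exact (hc .pos).succ
    | tape t =>
      simp only [stepNat, h]
      exact ((hc (.tape t)).add ((LogFn.const _).mul (hc (.head t)))).sub
        ((LogFn.const _).mul (hc (.head t)))
    | head t =>
      simp only [stepNat, h]
      cases (act t).2
      · exact (LogFn.const 1).max ((hc (.head t)).div (.const _))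
      · exact hc (.head t)
      · exact (hc (.head t)).mul (.const _)

/-- The reduction modulo `bd` keeps the vectors bounded on every word, including words on which the
machine violates its space bound. On the others `Describes.lt` shows that it changes nothing. -/
lemma logFn_run [Finite Γ] {bd : List Γ → ℕ} (hbd : LogFn bd) (hpos : ∀ w, 0 < bd w)
    (i : Part M.Tape) : LogFn (fun p : List Γ × ℕ => 𝒩.run (bd p.1) p.1 p.2 i) := by
  have := M.finite_state
  have := M.finite_sym
  refine LogFn.iterateVec (α := List Γ × ℕ) (init := fun i _ => 𝒩.initNat i)
    (step := fun i q => 𝒩.stepNat q.1.1 (𝒩.view q.1.1 q.2) q.2 i) LogFn.snd hbd.weaken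
    (fun p => hpos p.1) (fun i => .const _) (fun i => ?_) i
  refine (LogFn.cases 𝒩.logPred_view fun y => 𝒩.logFn_stepNat y i).subst
    (φ := fun q : (List Γ × ℕ) × (Part M.Tape → ℕ) => (q.1.1, q.2)) (fun _ => rfl) ?_
  intro v hv
  simp only [vars, List.map_nil, List.append_nil, List.mem_map, Finset.mem_toList,
    Finset.mem_univ, true_and] at hv
  obtain ⟨i, rfl⟩ := hv
  exact LogFn.coord i

lemma logPred_outNat [Finite Γ] {bd : List Γ → ℕ} (hbd : LogFn bd) (hpos : ∀ w, 0 < bd w)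
    (x : Δ) :
    LogPred (fun p : List Γ × ℕ => 𝒩.outNat p.1 (𝒩.run (bd p.1) p.1 p.2) = some x) := by
  have := M.finite_state
  have := M.finite_sym
  have h : LogPred (fun p : List Γ × (Part M.Tape → ℕ) => 𝒩.outNat p.1 p.2 = some x) := by
    refine (LogPred.exists_finite fun y => (𝒩.logPred_view y).and
      (LogPred.const ((M.step y.1 y.2.1 y.2.2).bind (fun r => r.2.2.2) = some x))).congr
      fun p => ?_
    simp only [outNat, exists_eq_left']
  refine h.subst (φ := fun p : List Γ × ℕ => (p.1, 𝒩.run (bd p.1) p.1 p.2)) (fun _ => rfl) ?_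
  intro v hv
  simp only [vars, List.map_nil, List.append_nil, List.mem_map, Finset.mem_toList,
    Finset.mem_univ, true_and] at hv
  obtain ⟨i, rfl⟩ := hv
  exact 𝒩.logFn_run hbd hpos i

end LogFn

/-- The numbers describe the configuration; `s` is a bound for the positions of the work heads. -/
structure Describes (w : List Γ) (s : ℕ) (c : M.Config) (d : Part M.Tape → ℕ) : Prop where
  state : d .state = 𝒩.state c.state
  pos : d .pos = c.inputHead
  pos_le : c.inputHead ≤ w.length + 1
  tape : ∀ t, d (.tape t) = ∑ i ∈ Finset.range s, (𝒩.sym (c.work t i) : ℕ) * 𝒩.nSym ^ i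
  head : ∀ t, d (.head t) = 𝒩.nSym ^ c.head t

variable {𝒩} {w : List Γ} {s bd : ℕ} {c c' : M.Config} {d : Part M.Tape → ℕ}

lemma Describes.view (h : 𝒩.Describes w s c d) (hs : ∀ t, c.head t < s) :
    𝒩.view w d = (c.state, inputCell w c.inputHead, fun t => c.work t (c.head t)) := by
  simp only [Numbering.view, Prod.mk.injEq, Equiv.symm_apply_eq, Fin.ext_iff, funext_iff, h.pos,
    true_and]
  refine ⟨?_, fun t => ?_⟩
  · rw [h.state, Nat.mod_eq_of_lt (Fin.is_lt _)]
  · rw [h.tape, h.head, digit_sum (fun i => Fin.is_lt _) (hs t)]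

lemma Describes.lt (h : 𝒩.Describes w s c d) (hs : ∀ t, c.head t < s) (h1 : 𝒩.nState ≤ bd)
    (h2 : w.length + 1 < bd) (h3 : 𝒩.nSym ^ s < bd) (i : Part M.Tape) : d i < bd := by
  cases i with
  | state => rw [h.state]; exact (Fin.is_lt _).trans_le h1
  | pos => rw [h.pos]; exact h.pos_le.trans_lt h2
  | tape t => rw [h.tape]; exact (digits_lt fun i => Fin.is_lt _).trans h3
  | head t =>
    rw [h.head]
    exact (Nat.pow_le_pow_right 𝒩.nSym_pos (hs t).le).trans_lt h3

lemma moveHead_pow (m : HeadMove) (p : ℕ) :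
    𝒩.moveHead m (𝒩.nSym ^ p) = 𝒩.nSym ^ m.apply p := by
  cases m with
  | left =>
    cases p with
    | zero =>
      simp only [moveHead, HeadMove.apply, pow_zero]
      exact max_eq_left (Nat.div_le_self _ _)
    | succ p =>
      simp only [moveHead, HeadMove.apply, pow_succ, Nat.mul_div_cancel _ 𝒩.nSym_pos]
      exact max_eq_right (Nat.one_le_pow _ _ 𝒩.nSym_pos)
  | stay => rfl
  | right => rfl

lemma Describes.next (h : 𝒩.Describes w s c d) (hs : ∀ t, c.head t < s)
    (hc : M.next w c = some c') :
    𝒩.Describes w s c' (𝒩.stepNat w (𝒩.view w d) d) ∧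
      c'.output = c.output ++ (𝒩.outNat w d).toList ∧
      M.step (𝒩.view w d).1 (𝒩.view w d).2.1 (𝒩.view w d).2.2 ≠ none := by
  have hv := h.view hs
  rw [Transducer.next, Option.map_eq_some_iff] at hc
  obtain ⟨⟨q, m, act, o⟩, hr, rfl⟩ := hc
  have hr' : M.step (𝒩.view w d).1 (𝒩.view w d).2.1 (𝒩.view w d).2.2 = some (q, m, act, o) := by
    rw [hv]; exact hr
  refine ⟨⟨?_, ?_, ?_, fun t => ?_, fun t => ?_⟩, ?_, by rw [hr']; simp⟩
  · simp only [stepNat, hr']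
  · simp only [stepNat, hr', h.pos]
  · exact min_le_right _ _
  · simp only [stepNat, hr', h.tape, h.head]
    rw [hv]
    have := digits_update (b := 𝒩.nSym) (fun i => (𝒩.sym (c.work t i) : ℕ))
      (𝒩.sym (act t).1) (hs t)
    rw [← this]
    refine Finset.sum_congr rfl fun i _ => ?_
    by_cases hi : i = c.head t
    · subst hi; simp
    · simp [Function.update_of_ne hi]
  · simp only [stepNat, hr', h.head, moveHead_pow]
  · simp only [outNat, hr', Option.bind_some]

lemma describes_init : 𝒩.Describes w s M.init 𝒩.initNat where
  state := rfl
  pos := rfl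
  pos_le := Nat.zero_le _
  tape t := by simp [initNat, init, 𝒩.sym_blank]
  head t := by simp [initNat, init]

lemma run_succ (n : ℕ) : 𝒩.run bd w (n + 1) =
    fun i => 𝒩.stepNat w (𝒩.view w (𝒩.run bd w n)) (𝒩.run bd w n) i % bd := by
  rw [run, Function.iterate_succ_apply']
  rfl

lemma run_lt (hbd : 0 < bd) (n : ℕ) (i : Part M.Tape) : 𝒩.run bd w n i < bd := by
  cases n with
  | zero => exact Nat.mod_lt _ hbd
  | succ n => rw [run_succ]; exact Nat.mod_lt _ hbd

lemma run_add (m n : ℕ) : 𝒩.run bd w (m + n) =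
    (fun d i => 𝒩.stepNat w (𝒩.view w d) d i % bd)^[m] (𝒩.run bd w n) :=
  Function.iterate_add_apply _ _ _ _

/-- The output of the computation in terms of numbers. -/
lemma filterMap_outNat [Fintype M.Tape] {v : List Δ} (h : M.ComputesInSpace w v s)
    (h1 : 𝒩.nState ≤ bd) (h2 : w.length + 1 < bd) (h3 : 𝒩.nSym ^ s < bd) :
    (List.range (bd ^ Fintype.card (Part M.Tape))).filterMap
      (fun n => 𝒩.outNat w (𝒩.run bd w n)) = v := by
  classical
  have hbd : 0 < bd := by omega
  obtain ⟨⟨c, hc, hc', rfl⟩, hs⟩ := h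
  let halts (d : Part M.Tape → ℕ) : Prop :=
    M.step (𝒩.view w d).1 (𝒩.view w d).2.1 (𝒩.view w d).2.2 = none
  -- The simulation follows the machine up to its halting configuration, and `n` is the number of
  -- steps.
  have key : ∃ n, 𝒩.Describes w s c (𝒩.run bd w n) ∧
      c.output = (List.range n).filterMap (fun n => 𝒩.outNat w (𝒩.run bd w n)) ∧
      ∀ m < n, ¬ halts (𝒩.run bd w m) := by
    clear hc'
    induction hc with
    | refl =>
      refine ⟨0, ?_, rfl, by simp⟩
      have h0 := (describes_init (𝒩 := 𝒩) (w := w) (s := s))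
      convert h0 using 1
      funext i
      exact Nat.mod_eq_of_lt (h0.lt (hs _ .refl) h1 h2 h3 i)
    | @tail c₁ c₂ hr hn ih =>
      obtain ⟨n, hd, ho, hm⟩ := ih
      obtain ⟨hd', ho', hh⟩ := hd.next (hs _ hr) hn
      refine ⟨n + 1, ?_, ?_, fun m hmn => ?_⟩
      · rw [run_succ]
        convert hd' using 1
        funext i
        exact Nat.mod_eq_of_lt (hd'.lt (hs _ (hr.tail hn)) h1 h2 h3 i)
      · rw [ho', ho, List.range_succ, List.filterMap_append]
        cases h : 𝒩.outNat w (𝒩.run bd w n) <;> simp [h]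
      · rcases Nat.lt_succ_iff_lt_or_eq.1 hmn with h | rfl
        · exact hm m h
        · exact hh
  obtain ⟨n, hd, ho, hm⟩ := key
  have hhalt : halts (𝒩.run bd w n) := by
    have := hd.view (hs _ hc)
    simp only [halts, this]
    simpa [Transducer.next] using hc'
  -- After halting the vector is constant and nothing is emitted, so superfluous rounds do no harm.
  have hconst (k : ℕ) : 𝒩.run bd w (n + k) = 𝒩.run bd w n := by
    induction k with
    | zero => rfl
    | succ k ih =>
      rw [← Nat.add_assoc, run_succ, ih]
      funext i
      simp only [halts] at hhalt
      simp only [stepNat, hhalt]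
      exact Nat.mod_eq_of_lt (run_lt hbd _ _)
  have hn : n ≤ bd ^ Fintype.card (Part M.Tape) := by
    let φ : Fin (n + 1) → Part M.Tape → Fin bd := fun m i => ⟨𝒩.run bd w m i, run_lt hbd _ _⟩
    -- If the vectors at times `i < j` agreed, the halting vector would already occur `j - i` steps
    -- earlier.
    have hlt (i j : ℕ) (hij : i < j) (hj : j ≤ n) : 𝒩.run bd w i ≠ 𝒩.run bd w j := by
      intro heq
      refine hm (n - j + i) (by omega) ?_
      rw [run_add, heq, ← run_add, Nat.sub_add_cancel hj]
      exact hhalt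
    have hφ : Function.Injective φ := by
      intro i j hij
      have hij' : 𝒩.run bd w i = 𝒩.run bd w j :=
        funext fun t => congrArg Fin.val (congrFun hij t)
      rcases lt_trichotomy i j with h | h | h
      · exact absurd hij' (hlt _ _ h (Nat.lt_succ_iff.1 j.2))
      · exact h
      · exact absurd hij'.symm (hlt _ _ h (Nat.lt_succ_iff.1 i.2))
    have := Fintype.card_le_of_injective φ hφ
    simp only [Fintype.card_fin, Fintype.card_pi, Finset.prod_const, Finset.card_univ] at this
    omega
  obtain ⟨k, hk⟩ := Nat.exists_eq_add_of_le hn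
  rw [ho, hk, List.range_add, List.filterMap_append, List.filterMap_map]
  have : (List.range k).filterMap ((fun n => 𝒩.outNat w (𝒩.run bd w n)) ∘ (n + ·)) = [] := by
    rw [List.filterMap_eq_nil_iff]
    intro m _
    simp only [Function.comp_apply, hconst, outNat]
    simp only [halts] at hhalt
    rw [hhalt]
    rfl
  rw [this, List.append_nil]

end Numbering

/-- The output of a transducer that works in logarithmic space is given by functions in the class
`LogFn`. -/
theorem exists_logWord {Γ Δ : Type} [Finite Γ] [Finite Δ] (M : Transducer Γ Δ) (c : ℕ) :
    ∃ W : List Γ → List Δ, LogWord W ∧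
      ∀ w v, M.ComputesInSpace w v (c * (Nat.log 2 w.length + 1)) → W w = v := by
  classical
  have := M.finite_tape
  have := Fintype.ofFinite M.Tape
  obtain ⟨𝒩⟩ := M.exists_numbering
  let e := 𝒩.nState + 𝒩.nSym * c + 1
  -- The base dominates `2 ^ (log |w| + 1)`, also for the empty word, so its power `nSym * c` bounds
  -- the number of contents of a tape. The exponent `e + 1` makes the inequalities strict.
  let bd : List Γ → ℕ := fun w => (2 * w.length + 2) ^ (e + 1)
  have hbd : LogFn bd := ((LogFn.const 2).mul LogFn.length).succ.succ.pow _
  have hpos (w : List Γ) : 0 < bd w := pow_pos (by omega) _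
  refine ⟨fun w => (List.range (bd w ^ Fintype.card (Part M.Tape))).filterMap
    (fun n => 𝒩.outNat w (𝒩.run (bd w) w n)), LogWord.filterMap_range (hbd.pow _)
      (fun x => 𝒩.logPred_outNat hbd hpos x), fun w v h => ?_⟩
  have hlt : (2 * w.length + 2) ^ e < bd w := Nat.pow_lt_pow_right (by omega) (Nat.lt_succ_self _)
  have hle (f : ℕ) (hf : f ≤ e) : (2 * w.length + 2) ^ f ≤ (2 * w.length + 2) ^ e :=
    Nat.pow_le_pow_right (by omega) hf
  have htwo (f : ℕ) : 2 ^ f ≤ (2 * w.length + 2) ^ f := Nat.pow_le_pow_left (by omega) _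
  refine Numbering.filterMap_outNat h ?_ ?_ ?_
  · exact ((Nat.lt_two_pow_self.le.trans (htwo _)).trans (hle 𝒩.nState (by omega))).trans hlt.le
  · refine lt_of_le_of_lt ?_ ((hle 1 (by omega)).trans_lt hlt)
    rw [pow_one]
    omega
  · refine lt_of_le_of_lt ?_ ((hle (𝒩.nSym * c) (by omega)).trans_lt hlt)
    have h2 : 2 ^ (Nat.log 2 w.length + 1) ≤ 2 * w.length + 2 := by
      rcases Nat.eq_zero_or_pos w.length with h0 | h0
      · simp [h0]
      · have := Nat.pow_log_le_self 2 h0.ne'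
        rw [pow_succ]
        omega
    calc 𝒩.nSym ^ (c * (Nat.log 2 w.length + 1))
        ≤ (2 ^ 𝒩.nSym) ^ (c * (Nat.log 2 w.length + 1)) :=
          Nat.pow_le_pow_left Nat.lt_two_pow_self.le _
      _ = (2 ^ (Nat.log 2 w.length + 1)) ^ (𝒩.nSym * c) := by
          rw [← pow_mul, ← pow_mul]
          ring_nf
      _ ≤ (2 * w.length + 2) ^ (𝒩.nSym * c) := Nat.pow_le_pow_left h2 _

end Transducer

/-! ### Composition with functions on words -/

section App

variable {Γ α : Type} [Ctx Γ α]

lemma LogFn.app₀ {f : List Γ → ℕ} (hf : LogFn f) : LogFn (fun a : α => f (word a)) :=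
  hf.subst (fun _ => rfl) (by simp [vars])

lemma LogFn.app₁ {f : List Γ × ℕ → ℕ} (hf : LogFn f) {g : α → ℕ} (hg : LogFn g) :
    LogFn (fun a => f (word a, g a)) :=
  hf.subst (φ := fun a => (word a, g a)) (fun _ => rfl) (by simpa [vars] using hg)

lemma LogFn.app₂ {f : (List Γ × ℕ) × ℕ → ℕ} (hf : LogFn f) {g h : α → ℕ} (hg : LogFn g)
    (hh : LogFn h) : LogFn (fun a => f ((word a, g a), h a)) :=
  hf.subst (φ := fun a => ((word a, g a), h a)) (fun _ => rfl) (by simpa [vars] using ⟨hh, hg⟩)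

lemma LogFn.app₃ {f : ((List Γ × ℕ) × ℕ) × ℕ → ℕ} (hf : LogFn f) {g h i : α → ℕ} (hg : LogFn g)
    (hh : LogFn h) (hi : LogFn i) : LogFn (fun a => f (((word a, g a), h a), i a)) :=
  hf.subst (φ := fun a => (((word a, g a), h a), i a)) (fun _ => rfl)
    (by simpa [vars] using ⟨hi, hh, hg⟩)

lemma LogPred.app₁ {p : List Γ × ℕ → Prop} (hp : LogPred p) {g : α → ℕ} (hg : LogFn g) :
    LogPred (fun a => p (word a, g a)) := LogFn.app₁ hp hg

lemma LogPred.app₂ {p : (List Γ × ℕ) × ℕ → Prop} (hp : LogPred p) {g h : α → ℕ} (hg : LogFn g)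
    (hh : LogFn h) : LogPred (fun a => p ((word a, g a), h a)) := LogFn.app₂ hp hg hh

lemma LogPred.app₃ {p : ((List Γ × ℕ) × ℕ) × ℕ → Prop} (hp : LogPred p) {g h i : α → ℕ}
    (hg : LogFn g) (hh : LogFn h) (hi : LogFn i) :
    LogPred (fun a => p (((word a, g a), h a), i a)) := LogFn.app₃ hp hg hh hi

lemma LogPred.cases {Y : Type} [Finite Y] {g : α → Y} {p : Y → α → Prop}
    (hg : ∀ y, LogPred (fun a => g a = y)) (hp : ∀ y, LogPred (p y)) :
    LogPred (fun a => p (g a) a) := LogFn.cases hg hp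

lemma LogPred.getElem? {Y : Type} (l : List Y) {f : α → ℕ} (hf : LogFn f) (y : Y) :
    LogPred (fun a => l[f a]? = some y) := by
  refine (exists_finite fun i : Fin l.length =>
    (eq hf (.const i.1)).and (const (l[i] = y))).congr fun a => ?_
  rw [List.getElem?_eq_some_iff]
  constructor
  · rintro ⟨h, h'⟩
    exact ⟨⟨f a, h⟩, rfl, h'⟩
  · rintro ⟨i, hi, h'⟩
    exact ⟨hi ▸ i.2, by simpa [hi] using h'⟩

lemma LogWord.map_range {T : List Γ → ℕ} {p : List Γ → ℕ → Prop}
    [∀ w, DecidablePred (p w)] (hT : LogFn T) (hp : LogPred (fun q : List Γ × ℕ => p q.1 q.2)) :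
    LogWord (fun w => (List.range (T w)).map fun t => decide (p w t)) := by
  refine ⟨hT.congr fun w => by simp, fun x => ?_⟩
  have : LogPred (fun q : List Γ × ℕ => decide (p q.1 q.2) = x) := by
    cases x
    · exact hp.not.congr fun q => by simp
    · exact hp.congr fun q => by simp
  refine ((LogPred.lt LogFn.snd hT.weaken).and this).congr fun q => ?_
  rw [List.getElem?_eq_some_iff]
  simp

end App

/-! ### Digraphs with vertices given by numbers -/

namespace NumberedDigraph

open Classical

variable {Γ : Type} (Y : List Γ → ℕ) (V : List Γ → ℕ → Prop) (R : List Γ → ℕ → ℕ → Prop)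

/-- The number of the vertex `u`. -/
noncomputable def index (w : List Γ) (u : ℕ) : ℕ := Nat.count (V w) u

/-- The number of the vertices, which are the numbers `u < Y w` with `V w u`. -/
noncomputable def card (w : List Γ) : ℕ := index V w (Y w)

/-- The adjacency relation between the vertices with numbers `i` and `j`. -/
def bit (w : List Γ) (i j : ℕ) : Prop :=
  ∃ u < Y w, ∃ v < Y w, (V w u ∧ index V w u = i) ∧ (V w v ∧ index V w v = j) ∧ R w u v

/-- The standard code of the digraph. -/
noncomputable def code (w : List Γ) : List Bool :=
  (List.range (card Y V w + 1 + card Y V w * card Y V w)).map fun p => decide (p < card Y V w ∨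
    card Y V w < p ∧ bit Y V R w ((p - (card Y V w + 1)) % card Y V w)
      ((p - (card Y V w + 1)) / card Y V w))

variable {Y V R}

lemma logWord_code (hY : LogFn Y) (hV : LogPred (fun p : List Γ × ℕ => V p.1 p.2))
    (hR : LogPred (fun p : (List Γ × ℕ) × ℕ => R p.1.1 p.1.2 p.2)) : LogWord (code Y V R) := by
  have hindex : LogFn (fun p : List Γ × ℕ => index V p.1 p.2) :=
    LogFn.count (p := fun q : (List Γ × ℕ) × ℕ => V q.1.1 q.2) LogFn.snd (hV.app₁ LogFn.snd)
  have hcard : LogFn (card Y V) := hindex.app₁ hY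
  have hbit : LogPred (fun p : (List Γ × ℕ) × ℕ => bit Y V R p.1.1 p.1.2 p.2) := by
    refine LogPred.exists_lt
      (p := fun q : ((List Γ × ℕ) × ℕ) × ℕ => ∃ v < Y q.1.1.1, (V q.1.1.1 q.2 ∧
        index V q.1.1.1 q.2 = q.1.1.2) ∧ (V q.1.1.1 v ∧ index V q.1.1.1 v = q.1.2) ∧
          R q.1.1.1 q.2 v) hY.app₀ ?_
    refine LogPred.exists_lt
      (p := fun q : (((List Γ × ℕ) × ℕ) × ℕ) × ℕ => (V q.1.1.1.1 q.1.2 ∧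
        index V q.1.1.1.1 q.1.2 = q.1.1.1.2) ∧ (V q.1.1.1.1 q.2 ∧
          index V q.1.1.1.1 q.2 = q.1.1.2) ∧ R q.1.1.1.1 q.1.2 q.2) hY.app₀ ?_
    have h0 : LogFn (fun q : (((List Γ × ℕ) × ℕ) × ℕ) × ℕ => q.2) := LogFn.snd
    have h1 : LogFn (fun q : (((List Γ × ℕ) × ℕ) × ℕ) × ℕ => q.1.2) := LogFn.snd.weaken
    have h2 : LogFn (fun q : (((List Γ × ℕ) × ℕ) × ℕ) × ℕ => q.1.1.2) := LogFn.snd.weaken.weaken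
    have h3 : LogFn (fun q : (((List Γ × ℕ) × ℕ) × ℕ) × ℕ => q.1.1.1.2) :=
      LogFn.snd.weaken.weaken.weaken
    exact ((hV.app₁ h1).and (.eq (hindex.app₁ h1) h3)).and
      (((hV.app₁ h0).and (.eq (hindex.app₁ h0) h2)).and (hR.app₂ h1 h0))
  have hsub : LogFn (fun p : List Γ × ℕ => p.2 - (card Y V p.1 + 1)) :=
    LogFn.snd.sub hcard.weaken.succ
  refine LogWord.map_range (p := fun w p => p < card Y V w ∨ card Y V w < p ∧
    bit Y V R w ((p - (card Y V w + 1)) % card Y V w) ((p - (card Y V w + 1)) / card Y V w))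
    (hcard.succ.add (hcard.mul hcard)) ?_
  exact ((LogPred.lt LogFn.snd hcard.weaken).or ((LogPred.lt hcard.weaken LogFn.snd).and
      (hbit.app₂ (hsub.mod hcard.weaken) (hsub.div hcard.weaken))))

/-- The numbers `φ a` may have gaps; counting the smaller valid numbers renumbers them
consecutively, with `Nat.nth` as the inverse. In the table the first entry of a pair is the least
significant digit, which explains the remainder and quotient in `code`. -/
lemma codes {w : List Γ} {U : Type} [Nonempty U] (G : Digraph U) (hG : ∃ a b, G.Adj a b)
    (φ : U → ℕ) (hφ : Function.Injective φ) (hV : ∀ u, (u < Y w ∧ V w u) ↔ ∃ a, φ a = u)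
    (hR : ∀ a b, G.Adj a b ↔ R w (φ a) (φ b)) :
    (Encoding.standard digraphSignature).Codes (code Y V R w) G.toRelStructure := by
  have hlt (a : U) : φ a < Y w := ((hV _).2 ⟨a, rfl⟩).1
  have hv (a : U) : V w (φ a) := ((hV _).2 ⟨a, rfl⟩).2
  have hi (a : U) : index V w (φ a) < card Y V w := by
    refine lt_of_lt_of_le ?_ (Nat.count_monotone (V w) (hlt a : φ a + 1 ≤ Y w))
    rw [Nat.count_succ, if_pos (hv a)]
    exact Nat.lt_succ_self _
  let ψ : U → Fin (card Y V w) := fun a => ⟨index V w (φ a), hi a⟩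
  have hψ : Function.Bijective ψ := by
    constructor
    · intro a b hab
      exact hφ (Nat.count_injective (hv a) (hv b) (congrArg Fin.val hab))
    · rintro ⟨i, h⟩
      have h' : ∀ hf : (Set.ofPred (V w)).Finite, i < hf.toFinset.card := fun hf =>
        h.trans_le (Nat.count_le_card hf _)
      have hlt : Nat.nth (V w) i < Y w := Nat.nth_lt_of_lt_count h
      obtain ⟨a, ha⟩ := (hV _).1 ⟨hlt, Nat.nth_mem i h'⟩
      exact ⟨a, Fin.ext (by simp only [ψ, index, ha]; exact Nat.count_nth h')⟩
  let e := Equiv.ofBijective ψ hψ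
  have hbit (a b : U) : bit Y V R w (e a) (e b) ↔ G.Adj a b := by
    rw [hR]
    constructor
    · rintro ⟨u, hu, v, hv', ⟨h1, h2⟩, ⟨h3, h4⟩, h5⟩
      have hu' : u = φ a := Nat.count_injective h1 (hv a) h2
      have hv'' : v = φ b := Nat.count_injective h3 (hv b) h4
      rwa [hu', hv''] at h5
    · exact fun h => ⟨φ a, hlt a, φ b, hlt b, ⟨hv a, rfl⟩, ⟨hv b, rfl⟩, h⟩
  have hpos : 0 < card Y V w := (e (Classical.arbitrary U)).pos
  refine ⟨⟨card Y V w, hpos, ⟨fun _ => {t | bit Y V R w (t 0) (t 1)}⟩, fun _ => ?_⟩,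
    ⟨e.symm, fun i t => ?_⟩, ?_⟩
  · obtain ⟨a, b, hab⟩ := hG
    exact ⟨![e a, e b], (hbit a b).2 hab⟩
  · have := hbit (e.symm (t 0)) (e.symm (t 1))
    simp only [Equiv.apply_symm_apply] at this
    exact this
  · simp only [Encoding.standard, Encoding.standardCode, code]
    rw [List.range_add, List.range_succ, List.map_append, List.map_append]
    congr 1
    · congr 1
      · refine List.ext_getElem (by simp) fun p hp _ => ?_
        simp at hp
        simp [hp]
      · simp
    · simp only [List.finRange_succ, List.finRange_zero, List.map_nil, List.flatMap_cons,
        List.flatMap_nil, List.append_nil]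
      refine List.ext_getElem (by simp [pow_two]) fun p hp hp' => ?_
      simp only [List.length_map, List.length_finRange] at hp'
      have h1 : card Y V w < card Y V w + 1 + p := by omega
      have h2 : ¬ card Y V w + 1 + p < card Y V w := by omega
      have h3 : p / card Y V w < card Y V w := by
        rw [Nat.div_lt_iff_lt_mul hpos, ← pow_two]; exact hp'
      simp [h1, h2, finFunctionFinEquiv_symm_apply_val, Nat.mod_eq_of_lt h3]

end NumberedDigraph

/-! ### The digraph `𝓓(𝔸)` in terms of numbers -/

section PathQ

variable {k : ℕ} (I : Set (Fin k))

open Classical in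
lemma length_pathQ : (pathQ I).length = 2 + ∑ l : Fin k, if l ∈ I then 1 else 3 := by
  have h (l : Fin k) : (if l ∈ I then OrientedPath.singleEdge else OrientedPath.zigzag).length =
      if l ∈ I then 1 else 3 := by
    split_ifs <;> rfl
  simp only [pathQ, List.length_append, List.length_flatMap, h, ← Fin.sum_univ_def]
  simp only [OrientedPath.singleEdge, List.length_singleton]
  omega

lemma two_le_length_pathQ : 2 ≤ (pathQ I).length := by
  classical
  rw [length_pathQ]
  exact Nat.le_add_right _ _

lemma length_pathQ_le : (pathQ I).length ≤ 3 * k + 2 := by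
  classical
  rw [length_pathQ]
  have := Finset.sum_le_card_nsmul (Finset.univ : Finset (Fin k))
    (fun l => if l ∈ I then 1 else 3) 3 (fun l _ => by split_ifs <;> omega)
  simp only [Finset.card_univ, Fintype.card_fin, smul_eq_mul] at this
  omega

end PathQ

namespace RelStructure

variable {n : ℕ} {ar : Fin n → ℕ} {A : Type*} {𝔸 : RelStructure ar A}

lemma two_le_length_edgePath (e : A × 𝔸.prodRel) : 2 ≤ (𝔸.edgePath e).length :=
  two_le_length_pathQ _

lemma pathVertex_zero (e : A × 𝔸.prodRel) : 𝔸.pathVertex e 0 = Sum.inl e.1 := rfl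

lemma pathVertex_of_mem (e : A × 𝔸.prodRel) {j : ℕ} (h : j ∈ Set.Ioo 0 (𝔸.edgePath e).length) :
    𝔸.pathVertex e j = Sum.inr (Sum.inr ⟨e, j, h⟩) := by
  simp only [pathVertex, h.1.ne', if_false, dif_pos h]

lemma pathVertex_of_le (e : A × 𝔸.prodRel) {j : ℕ} (h : (𝔸.edgePath e).length ≤ j) :
    𝔸.pathVertex e j = Sum.inr (Sum.inl e.2) := by
  have := two_le_length_edgePath e
  have h' : j ∉ Set.Ioo 0 (𝔸.edgePath e).length := fun h' => absurd h'.2 (by omega)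
  simp only [pathVertex, dif_neg h', show j ≠ 0 by omega, if_false]

lemma prodRel_nonempty (h : ∀ i, (𝔸.rel i).Nonempty) : 𝔸.prodRel.Nonempty := by
  choose t ht using h
  refine ⟨fun p => t (finSigmaFinEquiv.symm p).1 (finSigmaFinEquiv.symm p).2, fun i => ?_⟩
  have : (fun j => t (finSigmaFinEquiv.symm (finSigmaFinEquiv ⟨i, j⟩)).1
      (finSigmaFinEquiv.symm (finSigmaFinEquiv ⟨i, j⟩)).2) = t i := by
    funext j
    rw [Equiv.symm_apply_apply]
  rw [this]
  exact ht i

lemma exists_pathVertex [Nonempty A] (h : 𝔸.prodRel.Nonempty) (v : 𝔸.DVertex) :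
    ∃ e, ∃ j ≤ (𝔸.edgePath e).length, 𝔸.pathVertex e j = v := by
  obtain ⟨r, hr⟩ := h
  rcases v with a | r' | ⟨e, j, hj⟩
  · exact ⟨(a, ⟨r, hr⟩), 0, Nat.zero_le _, rfl⟩
  · exact ⟨(Classical.arbitrary A, r'), _, le_rfl, pathVertex_of_le _ le_rfl⟩
  · exact ⟨e, j, hj.2.le, pathVertex_of_mem e hj⟩

end RelStructure

namespace PathDigraph

variable {n : ℕ} (ar : Fin n → ℕ)

/-- The size of the domain of the structure with the code `w`. -/
noncomputable def dom (w : List Bool) : ℕ :=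
  open Classical in Nat.count (fun p => ∀ q < p + 1, w[q]? = some true) w.length

/-- The number of tuples. -/
noncomputable def tuples (w : List Bool) : ℕ := dom w ^ ∑ i, ar i

/-- The product relation, for tuples given by numbers. -/
def mem (w : List Bool) (x : ℕ) : Prop :=
  ∀ i : Fin n, w[dom w + 1 + (((List.finRange n).take i).map (fun i' => dom w ^ ar i')).sum +
    x / dom w ^ (∑ i' : Fin i, ar (Fin.castLE i.2.le i')) % dom w ^ ar i]? = some true

/-- The set of positions where the letter `a` occurs in a tuple. -/
def positions (w : List Bool) (a x : ℕ) : Set (Fin (∑ i, ar i)) := {l | a = x / dom w ^ l.1 % dom w}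

/-- A number for three numbers. -/
noncomputable def triple (w : List Bool) (a x j : ℕ) : ℕ :=
  a + (dom w + tuples ar w + 2) * (x + (dom w + tuples ar w + 2) * j)

/-- The number of a vertex of a path. -/
noncomputable def vertex (w : List Bool) (a x j : ℕ) : ℕ :=
  if j = 0 then triple ar w (a + 1) 0 0
  else if j < (pathQ (positions ar w a x)).length then triple ar w (a + 1) (x + 1) j
  else triple ar w 0 (x + 1) 0

/-- A bound for the vertices. -/
noncomputable def bound (w : List Bool) : ℕ := triple ar w 0 0 (3 * (∑ i, ar i) + 3)

/-- The vertices. -/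
def Vert (w : List Bool) (u : ℕ) : Prop :=
  ∃ a < dom w, ∃ x < tuples ar w, ∃ j < 3 * (∑ i, ar i) + 3,
    mem ar w x ∧ u = vertex ar w a x j

/-- The adjacency relation. -/
def Adj (w : List Bool) (u v : ℕ) : Prop :=
  ∃ a < dom w, ∃ x < tuples ar w, ∃ j < 3 * (∑ i, ar i) + 3, mem ar w x ∧
    (((pathQ (positions ar w a x))[j]? = some true ∧
        u = vertex ar w a x j ∧ v = vertex ar w a x (j + 1)) ∨
      ((pathQ (positions ar w a x))[j]? = some false ∧
        u = vertex ar w a x (j + 1) ∧ v = vertex ar w a x j))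

/-- The standard code of `𝓓(𝔸)` in terms of the standard code of `𝔸`. -/
noncomputable def code : List Bool → List Bool :=
  NumberedDigraph.code (bound ar) (Vert ar) (Adj ar)

section LogFn

lemma logFn_dom : LogFn dom := by
  classical
  exact LogFn.count (p := fun q : List Bool × ℕ => ∀ r < q.2 + 1, q.1[r]? = some true)
    LogFn.length (LogPred.forall_lt
      (p := fun q : (List Bool × ℕ) × ℕ => q.1.1[q.2]? = some true) LogFn.snd.succ
      (LogPred.letter LogFn.snd true))

lemma logFn_tuples : LogFn (tuples ar) := logFn_dom.pow _

lemma logPred_mem : LogPred (fun p : List Bool × ℕ => mem ar p.1 p.2) := by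
  refine LogPred.forall_finite fun i => LogPred.letter ?_ true
  have hd : LogFn (fun p : List Bool × ℕ => dom p.1) := logFn_dom.app₀
  exact (hd.succ.add (LogFn.listSum _ fun i' => hd.pow (ar i'))).add
    ((LogFn.snd.div (hd.pow _)).mod (hd.pow _))

lemma logFn_triple :
    LogFn (fun p : ((List Bool × ℕ) × ℕ) × ℕ => triple ar p.1.1.1 p.1.1.2 p.1.2 p.2) := by
  have hb : LogFn (fun p : ((List Bool × ℕ) × ℕ) × ℕ =>
      dom p.1.1.1 + tuples ar p.1.1.1 + 2) := (logFn_dom.app₀.add (logFn_tuples ar).app₀).succ.succ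
  exact LogFn.snd.weaken.weaken.add (hb.mul (LogFn.snd.weaken.add (hb.mul LogFn.snd)))

lemma logPred_positions (I : Set (Fin (∑ i, ar i))) :
    LogPred (fun p : (List Bool × ℕ) × ℕ => positions ar p.1.1 p.1.2 p.2 = I) := by
  have hd : LogFn (fun p : (List Bool × ℕ) × ℕ => dom p.1.1) := logFn_dom.app₀
  have h (l : Fin (∑ i, ar i)) : LogPred (fun p : (List Bool × ℕ) × ℕ =>
      p.1.2 = p.2 / dom p.1.1 ^ l.1 % dom p.1.1) :=
    .eq LogFn.snd.weaken ((LogFn.snd.div (hd.pow _)).mod hd)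
  refine (LogPred.forall_finite (p := fun l (p : (List Bool × ℕ) × ℕ) =>
    l ∈ positions ar p.1.1 p.1.2 p.2 ↔ l ∈ I) fun l => ?_).congr fun p => Set.ext_iff
  by_cases hl : l ∈ I
  · exact (h l).congr fun p => by simp [hl, positions]
  · exact (h l).not.congr fun p => by simp [hl, positions]

lemma logPred_positions' (I : Set (Fin (∑ i, ar i))) :
    LogPred (fun p : ((List Bool × ℕ) × ℕ) × ℕ => positions ar p.1.1.1 p.1.1.2 p.1.2 = I) :=
  (logPred_positions ar I).weaken

/-- The signature is fixed, so there are finitely many sets of positions, and for each of them the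
path is a constant list. -/
lemma logPred_path (b : Bool) : LogPred (fun p : ((List Bool × ℕ) × ℕ) × ℕ =>
    (pathQ (positions ar p.1.1.1 p.1.1.2 p.1.2))[p.2]? = some b) :=
  LogPred.cases (p := fun I p => (pathQ I)[p.2]? = some b) (logPred_positions' ar)
    fun _ => LogPred.getElem? _ LogFn.snd b

lemma logFn_vertex :
    LogFn (fun p : ((List Bool × ℕ) × ℕ) × ℕ => vertex ar p.1.1.1 p.1.1.2 p.1.2 p.2) := by
  have ha : LogFn (fun p : ((List Bool × ℕ) × ℕ) × ℕ => p.1.1.2 + 1) := LogFn.snd.weaken.weaken.succ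
  have hx : LogFn (fun p : ((List Bool × ℕ) × ℕ) × ℕ => p.1.2 + 1) := LogFn.snd.weaken.succ
  refine LogFn.ite (.eq LogFn.snd .zero) ((logFn_triple ar).app₃ ha .zero .zero)
    (LogFn.ite ?_ ((logFn_triple ar).app₃ ha hx LogFn.snd)
      ((logFn_triple ar).app₃ .zero hx .zero))
  refine LogPred.cases (p := fun I p => p.2 < (pathQ I).length) (logPred_positions' ar) fun I => ?_
  exact LogPred.lt LogFn.snd (.const _)

lemma logPred_vert : LogPred (fun p : List Bool × ℕ => Vert ar p.1 p.2) := by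
  refine LogPred.exists_lt (p := fun p : (List Bool × ℕ) × ℕ => ∃ x < tuples ar p.1.1,
    ∃ j < 3 * (∑ i, ar i) + 3, mem ar p.1.1 x ∧ p.1.2 = vertex ar p.1.1 p.2 x j) logFn_dom.app₀ ?_
  refine LogPred.exists_lt (p := fun p : ((List Bool × ℕ) × ℕ) × ℕ => ∃ j < 3 * (∑ i, ar i) + 3,
    mem ar p.1.1.1 p.2 ∧ p.1.1.2 = vertex ar p.1.1.1 p.1.2 p.2 j) (logFn_tuples ar).app₀ ?_
  refine LogPred.exists_lt (p := fun p : (((List Bool × ℕ) × ℕ) × ℕ) × ℕ =>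
    mem ar p.1.1.1.1 p.1.2 ∧ p.1.1.1.2 = vertex ar p.1.1.1.1 p.1.1.2 p.1.2 p.2) (.const _) ?_
  exact ((logPred_mem ar).app₁ LogFn.snd.weaken).and (.eq LogFn.snd.weaken.weaken.weaken
    ((logFn_vertex ar).app₃ LogFn.snd.weaken.weaken LogFn.snd.weaken LogFn.snd))

lemma logPred_adj : LogPred (fun p : (List Bool × ℕ) × ℕ => Adj ar p.1.1 p.1.2 p.2) := by
  refine LogPred.exists_lt (p := fun p : ((List Bool × ℕ) × ℕ) × ℕ => ∃ x < tuples ar p.1.1.1,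
    ∃ j < 3 * (∑ i, ar i) + 3, mem ar p.1.1.1 x ∧
    (((pathQ (positions ar p.1.1.1 p.2 x))[j]? = some true ∧
        p.1.1.2 = vertex ar p.1.1.1 p.2 x j ∧ p.1.2 = vertex ar p.1.1.1 p.2 x (j + 1)) ∨
      ((pathQ (positions ar p.1.1.1 p.2 x))[j]? = some false ∧
        p.1.1.2 = vertex ar p.1.1.1 p.2 x (j + 1) ∧ p.1.2 = vertex ar p.1.1.1 p.2 x j)))
    logFn_dom.app₀ ?_
  refine LogPred.exists_lt (p := fun p : (((List Bool × ℕ) × ℕ) × ℕ) × ℕ =>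
    ∃ j < 3 * (∑ i, ar i) + 3, mem ar p.1.1.1.1 p.2 ∧
    (((pathQ (positions ar p.1.1.1.1 p.1.2 p.2))[j]? = some true ∧
        p.1.1.1.2 = vertex ar p.1.1.1.1 p.1.2 p.2 j ∧
        p.1.1.2 = vertex ar p.1.1.1.1 p.1.2 p.2 (j + 1)) ∨
      ((pathQ (positions ar p.1.1.1.1 p.1.2 p.2))[j]? = some false ∧
        p.1.1.1.2 = vertex ar p.1.1.1.1 p.1.2 p.2 (j + 1) ∧
        p.1.1.2 = vertex ar p.1.1.1.1 p.1.2 p.2 j)))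
    (logFn_tuples ar).app₀ ?_
  refine LogPred.exists_lt (p := fun p : ((((List Bool × ℕ) × ℕ) × ℕ) × ℕ) × ℕ =>
    mem ar p.1.1.1.1.1 p.1.2 ∧
    (((pathQ (positions ar p.1.1.1.1.1 p.1.1.2 p.1.2))[p.2]? = some true ∧
        p.1.1.1.1.2 = vertex ar p.1.1.1.1.1 p.1.1.2 p.1.2 p.2 ∧
        p.1.1.1.2 = vertex ar p.1.1.1.1.1 p.1.1.2 p.1.2 (p.2 + 1)) ∨
      ((pathQ (positions ar p.1.1.1.1.1 p.1.1.2 p.1.2))[p.2]? = some false ∧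
        p.1.1.1.1.2 = vertex ar p.1.1.1.1.1 p.1.1.2 p.1.2 (p.2 + 1) ∧
        p.1.1.1.2 = vertex ar p.1.1.1.1.1 p.1.1.2 p.1.2 p.2))) (.const _) ?_
  have hj : LogFn (fun p : ((((List Bool × ℕ) × ℕ) × ℕ) × ℕ) × ℕ => p.2) := LogFn.snd
  have hx : LogFn (fun p : ((((List Bool × ℕ) × ℕ) × ℕ) × ℕ) × ℕ => p.1.2) := LogFn.snd.weaken
  have ha : LogFn (fun p : ((((List Bool × ℕ) × ℕ) × ℕ) × ℕ) × ℕ => p.1.1.2) :=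
    LogFn.snd.weaken.weaken
  have hv : LogFn (fun p : ((((List Bool × ℕ) × ℕ) × ℕ) × ℕ) × ℕ => p.1.1.1.2) :=
    LogFn.snd.weaken.weaken.weaken
  have hu : LogFn (fun p : ((((List Bool × ℕ) × ℕ) × ℕ) × ℕ) × ℕ => p.1.1.1.1.2) :=
    LogFn.snd.weaken.weaken.weaken.weaken
  have h0 := (logFn_vertex ar).app₃ ha hx hj
  have h1 := (logFn_vertex ar).app₃ ha hx hj.succ
  have hp (b : Bool) := (logPred_path ar b).app₃ ha hx hj
  exact ((logPred_mem ar).app₁ hx).and (((hp true).and ((LogPred.eq hu h0).and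
    (LogPred.eq hv h1))).or ((hp false).and ((LogPred.eq hu h1).and (LogPred.eq hv h0))))

lemma logWord_code : LogWord (code ar) :=
  NumberedDigraph.logWord_code ((logFn_triple ar).app₃ (α := List Bool) .zero .zero (.const _))
    (logPred_vert ar) (logPred_adj ar)

end LogFn

end PathDigraph

/-- Locates the table of one relation among the concatenated tables. -/
lemma List.getElem?_flatMap_finRange {n : ℕ} {α : Type*} (f : Fin n → List α) (i : Fin n) {t : ℕ}
    (ht : t < (f i).length) : ((List.finRange n).flatMap f)[
      (((List.finRange n).take i).map fun i' => (f i').length).sum + t]? = (f i)[t]? := by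
  have h : List.finRange n = (List.finRange n).take i ++ i :: (List.finRange n).drop (i + 1) := by
    conv_lhs => rw [← List.take_append_drop i (List.finRange n)]
    rw [List.drop_eq_getElem_cons (by simp), List.getElem_finRange]
    rfl
  conv_lhs => enter [1]; rw [h]
  rw [List.flatMap_append, List.flatMap_cons, ← List.length_flatMap,
    List.getElem?_append_right (Nat.le_add_right _ _), Nat.add_sub_cancel_left,
    List.getElem?_append_left ht]

/-! ### Correctness on standard codes -/

namespace PathDigraph

variable {n : ℕ} {ar : Fin n → ℕ} (𝔹 : FinRelStructure ar)

open Encoding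

lemma dom_standardCode : dom (standardCode 𝔹) = 𝔹.size := by
  classical
  have h (p : ℕ) : (∀ q < p + 1, (standardCode 𝔹)[q]? = some true) ↔ p < 𝔹.size := by
    constructor
    · intro h
      by_contra hp
      have := h 𝔹.size (by omega)
      simp [standardCode, List.append_assoc] at this
    · intro hp q hq
      rw [standardCode, List.append_assoc,
        List.getElem?_append_left (by rw [List.length_replicate]; omega),
        List.getElem?_replicate, if_pos (by omega)]
  have hle : 𝔹.size ≤ (standardCode 𝔹).length := by
    simp only [standardCode, List.length_append, List.length_replicate]; omega
  unfold dom
  rw [Nat.count_eq_card_filter_range, ← Finset.card_range 𝔹.size]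
  congr 1
  ext p
  simp only [Finset.mem_filter, Finset.mem_range, h]
  omega

lemma tuples_standardCode : tuples ar (standardCode 𝔹) = 𝔹.size ^ ∑ i, ar i := by
  rw [tuples, dom_standardCode]

/-- The block of base-`m` digits of `x` that belongs to `R_i`, cut out by division and remainder, is
the index of the `i`-th block of the tuple in the table of `R_i`. The offset skips `1^m 0` and the
earlier tables. -/
lemma mem_standardCode (x : Fin (𝔹.size ^ ∑ i, ar i)) :
    mem ar (standardCode 𝔹) x ↔ finFunctionFinEquiv.symm x ∈ 𝔹.str.prodRel := by
  classical
  refine forall_congr' fun i => ?_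
  rw [dom_standardCode]
  have hlt : x.1 / 𝔹.size ^ (∑ i' : Fin i, ar (Fin.castLE i.2.le i')) % 𝔹.size ^ ar i <
    𝔹.size ^ ar i := Nat.mod_lt _ (Nat.pow_pos 𝔹.size_pos)
  have hlen (i' : Fin n) : 𝔹.size ^ ar i' = ((List.finRange (𝔹.size ^ ar i')).map fun j =>
    decide (finFunctionFinEquiv.symm j ∈ 𝔹.str.rel i')).length := by simp
  rw [standardCode, List.getElem?_append_right (by
    rw [List.length_append, List.length_replicate, List.length_singleton, add_assoc (𝔹.size + 1)]
    exact Nat.le_add_right _ _)]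
  simp only [List.length_append, List.length_replicate, List.length_singleton]
  rw [add_assoc (𝔹.size + 1), Nat.add_sub_cancel_left]
  have := List.getElem?_flatMap_finRange (fun i' => (List.finRange (𝔹.size ^ ar i')).map fun j =>
    decide (finFunctionFinEquiv.symm j ∈ 𝔹.str.rel i')) i
    (t := x.1 / 𝔹.size ^ (∑ i' : Fin i, ar (Fin.castLE i.2.le i')) % 𝔹.size ^ ar i)
    (by simpa using hlt)
  simp only [← hlen] at this
  rw [this, List.getElem?_map, List.getElem?_eq_getElem (by simpa using hlt)]
  simp only [List.getElem_finRange, Option.map_some, Option.some.injEq, decide_eq_true_eq]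
  have h : finFunctionFinEquiv.symm ⟨_, hlt⟩ =
      fun j => finFunctionFinEquiv.symm x (finSigmaFinEquiv ⟨i, j⟩) := by
    funext j
    apply Fin.ext
    -- This splitting shows that the reduction modulo `m ^ ar i` does not affect the `j`-th digit.
    have hj : 𝔹.size ^ ar i = 𝔹.size ^ (j : ℕ) * 𝔹.size ^ (ar i - j) := by
      rw [← pow_add]; congr 1; omega
    have hd : 𝔹.size ∣ 𝔹.size ^ (ar i - j) := dvd_pow_self _ (by omega)
    rw [finFunctionFinEquiv_symm_apply_val, finFunctionFinEquiv_symm_apply_val,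
      finSigmaFinEquiv_apply]
    dsimp only
    rw [pow_add, ← Nat.div_div_eq_div_mul, hj, Nat.mod_mul_right_div_self,
      Nat.mod_mod_of_dvd _ hd]
  rw [← h]
  exact Iff.rfl

lemma triple_inj {w : List Bool} {a x j a' x' j' : ℕ} (ha : a < dom w + tuples ar w + 2)
    (hx : x < dom w + tuples ar w + 2) (ha' : a' < dom w + tuples ar w + 2)
    (hx' : x' < dom w + tuples ar w + 2) :
    triple ar w a x j = triple ar w a' x' j' ↔ a = a' ∧ x = x' ∧ j = j' := by
  constructor
  · intro h
    simp only [triple] at h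
    generalize dom w + tuples ar w + 2 = B at *
    have hB : 0 < B := by omega
    have h1 := congrArg (· % B) h
    have h2 := congrArg (· / B) h
    simp only [Nat.add_mul_mod_self_left, Nat.mod_eq_of_lt ha, Nat.mod_eq_of_lt ha',
      Nat.add_mul_div_left _ _ hB, Nat.div_eq_of_lt ha, Nat.div_eq_of_lt ha', zero_add] at h1 h2
    have h3 := congrArg (· % B) h2
    have h4 := congrArg (· / B) h2
    simp only [Nat.add_mul_mod_self_left, Nat.mod_eq_of_lt hx, Nat.mod_eq_of_lt hx',
      Nat.add_mul_div_left _ _ hB, Nat.div_eq_of_lt hx, Nat.div_eq_of_lt hx', zero_add] at h3 h4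
    exact ⟨h1, h3, h4⟩
  · rintro ⟨rfl, rfl, rfl⟩
    rfl

lemma triple_lt_bound {w : List Bool} {a x j : ℕ} (ha : a < dom w + tuples ar w + 2)
    (hx : x < dom w + tuples ar w + 2) (hj : j < 3 * (∑ i, ar i) + 3) :
    triple ar w a x j < bound ar w := by
  simp only [triple, bound, zero_add]
  generalize dom w + tuples ar w + 2 = B at *
  calc a + B * (x + B * j) < B * (x + B * j + 1) := by linarith [mul_add B (x + B * j) 1]
    _ ≤ B * (B * (j + 1)) := Nat.mul_le_mul_left _ (by linarith [mul_add B j 1])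
    _ ≤ _ := Nat.mul_le_mul_left _ (Nat.mul_le_mul_left _ hj)

/-- The number of a tuple of the product relation. -/
def rank (r : 𝔹.str.prodRel) : ℕ := finFunctionFinEquiv r.1

variable {𝔹}

lemma rank_lt (r : 𝔹.str.prodRel) : rank 𝔹 r < 𝔹.size ^ ∑ i, ar i := (finFunctionFinEquiv r.1).2

lemma rank_injective : Function.Injective (rank 𝔹) := fun _ _ h =>
  Subtype.ext (finFunctionFinEquiv.injective (Fin.ext h))

lemma mem_rank (r : 𝔹.str.prodRel) : mem ar (standardCode 𝔹) (rank 𝔹 r) := by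
  rw [rank, mem_standardCode, Equiv.symm_apply_apply]
  exact r.2

lemma exists_rank_eq {x : ℕ} (hx : x < tuples ar (standardCode 𝔹)) (h : mem ar (standardCode 𝔹) x) :
    ∃ r, rank 𝔹 r = x := by
  rw [tuples_standardCode] at hx
  exact ⟨⟨_, (mem_standardCode 𝔹 ⟨x, hx⟩).1 h⟩, by simp [rank]⟩

lemma pathQ_positions (a : Fin 𝔹.size) (r : 𝔹.str.prodRel) :
    pathQ (positions ar (standardCode 𝔹) a (rank 𝔹 r)) = 𝔹.str.edgePath (a, r) := by
  rw [RelStructure.edgePath]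
  congr 1
  ext l
  have h := finFunctionFinEquiv_symm_apply_val (finFunctionFinEquiv r.1) l
  rw [Equiv.symm_apply_apply] at h
  simp only [positions, Set.mem_ofPred_eq, dom_standardCode, rank, Fin.ext_iff, h]

/-- The number of a vertex of `𝓓(𝔹)`. -/
noncomputable def number : 𝔹.str.DVertex → ℕ
  | .inl a => triple ar (standardCode 𝔹) (a + 1) 0 0
  | .inr (.inl r) => triple ar (standardCode 𝔹) 0 (rank 𝔹 r + 1) 0
  | .inr (.inr ⟨e, j⟩) => triple ar (standardCode 𝔹) (e.1 + 1) (rank 𝔹 e.2 + 1) j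

lemma number_pathVertex (a : Fin 𝔹.size) (r : 𝔹.str.prodRel) (j : ℕ) :
    number (𝔹.str.pathVertex (a, r) j) = vertex ar (standardCode 𝔹) a (rank 𝔹 r) j := by
  rw [vertex, pathQ_positions]
  split_ifs with h0 h
  · rw [h0, RelStructure.pathVertex_zero, number]
  · rw [RelStructure.pathVertex_of_mem _ ⟨Nat.pos_of_ne_zero h0, h⟩, number]
  · rw [RelStructure.pathVertex_of_le _ (not_lt.1 h), number]

/-- Elements and tuples are shifted by one, so that a component `0` means absent; this separates the
three kinds of vertices. -/
lemma number_injective : Function.Injective (number (𝔹 := 𝔹)) := by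
  have hB : dom (standardCode 𝔹) + tuples ar (standardCode 𝔹) + 2 =
      𝔹.size + 𝔹.size ^ (∑ i, ar i) + 2 := by
    rw [dom_standardCode, tuples_standardCode]
  have ha (a : Fin 𝔹.size) : a.1 + 1 < dom (standardCode 𝔹) + tuples ar (standardCode 𝔹) + 2 := by
    rw [hB]; omega
  have hr (r : 𝔹.str.prodRel) :
      rank 𝔹 r + 1 < dom (standardCode 𝔹) + tuples ar (standardCode 𝔹) + 2 := by
    have := rank_lt r
    rw [hB]; omega
  have h0 : 0 < dom (standardCode 𝔹) + tuples ar (standardCode 𝔹) + 2 := by omega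
  rintro (a | r | ⟨⟨a, r⟩, j, hj⟩) (a' | r' | ⟨⟨a', r'⟩, j', hj'⟩) h <;> simp only [number] at h
  · rw [triple_inj (ha a) h0 (ha a') h0] at h
    rw [Fin.ext (Nat.succ_injective h.1)]
  · rw [triple_inj (ha a) h0 h0 (hr r')] at h
    omega
  · rw [triple_inj (ha a) h0 (ha a') (hr r')] at h
    omega
  · rw [triple_inj h0 (hr r) (ha a') h0] at h
    omega
  · rw [triple_inj h0 (hr r) h0 (hr r')] at h
    rw [rank_injective (Nat.succ_injective h.2.1)]
  · rw [triple_inj h0 (hr r) (ha a') (hr r')] at h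
    omega
  · rw [triple_inj (ha a) (hr r) (ha a') h0] at h
    omega
  · rw [triple_inj (ha a) (hr r) h0 (hr r')] at h
    omega
  · rw [triple_inj (ha a) (hr r) (ha a') (hr r')] at h
    obtain ⟨h1, h2, h3⟩ := h
    obtain rfl := Fin.ext (Nat.succ_injective h1)
    obtain rfl := rank_injective (Nat.succ_injective h2)
    obtain rfl := h3
    rfl

lemma number_lt_bound (v : 𝔹.str.DVertex) : number v < bound ar (standardCode 𝔹) := by
  rcases v with a | r | ⟨⟨a, r⟩, j, hj⟩
  · refine triple_lt_bound ?_ (by omega) (by omega)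
    rw [dom_standardCode]; omega
  · refine triple_lt_bound (by omega) ?_ (by omega)
    have := rank_lt r
    rw [tuples_standardCode]; omega
  · refine triple_lt_bound ?_ ?_ ?_
    · change a.1 + 1 < _
      rw [dom_standardCode]; omega
    · have := rank_lt r
      change rank 𝔹 r + 1 < _
      rw [tuples_standardCode]; omega
    · have := hj.2.trans_le (length_pathQ_le _)
      change j < _
      omega

/-- The positions `j` in `Vert` and `Adj` run up to a bound valid for all paths. Positions beyond
the end of a path only repeat its terminal vertex and carry no edge. -/
lemma codes_code (𝔹 : FinRelStructure ar) : (Encoding.standard digraphSignature).Codes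
    (code ar (standardCode 𝔹)) 𝔹.str.toDigraph.toRelStructure := by
  have hne := RelStructure.prodRel_nonempty 𝔹.rel_nonempty
  have : Nonempty (Fin 𝔹.size) := ⟨⟨0, 𝔹.size_pos⟩⟩
  have : Nonempty 𝔹.str.DVertex := ⟨Sum.inl ⟨0, 𝔹.size_pos⟩⟩
  have hdom (a : Fin 𝔹.size) : a.1 < dom (standardCode 𝔹) := by
    rw [dom_standardCode]; exact a.2
  have hrank (r : 𝔹.str.prodRel) : rank 𝔹 r < tuples ar (standardCode 𝔹) := by
    rw [tuples_standardCode]; exact rank_lt r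
  refine NumberedDigraph.codes _ ?_ number number_injective (fun u => ⟨?_, ?_⟩) fun u v => ⟨?_, ?_⟩
  · obtain ⟨r, hr⟩ := hne
    exact ⟨_, _, (⟨0, 𝔹.size_pos⟩, ⟨r, hr⟩), 0, Or.inl ⟨rfl, rfl, rfl⟩⟩
  · rintro ⟨-, a, ha, x, hx, j, -, hm, rfl⟩
    obtain ⟨r, rfl⟩ := exists_rank_eq hx hm
    rw [dom_standardCode] at ha
    exact ⟨_, number_pathVertex ⟨a, ha⟩ r j⟩
  · rintro ⟨v, rfl⟩
    refine ⟨number_lt_bound v, ?_⟩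
    obtain ⟨⟨a, r⟩, j, hj, rfl⟩ := RelStructure.exists_pathVertex hne v
    have := hj.trans (length_pathQ_le _)
    exact ⟨a, hdom a, rank 𝔹 r, hrank r, j, by omega, mem_rank r, number_pathVertex a r j⟩
  · rintro ⟨⟨a, r⟩, j, h⟩
    have hj : j < 3 * (∑ i, ar i) + 3 := by
      have : j < (𝔹.str.edgePath (a, r)).length := by
        rcases h with h | h <;> exact (List.getElem?_eq_some_iff.1 h.1).1
      have := this.trans_le (length_pathQ_le _)
      omega
    refine ⟨a, hdom a, rank 𝔹 r, hrank r, j, hj, mem_rank r, ?_⟩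
    rw [pathQ_positions, ← number_pathVertex, ← number_pathVertex]
    rcases h with ⟨h, rfl, rfl⟩ | ⟨h, rfl, rfl⟩
    · exact Or.inl ⟨h, rfl, rfl⟩
    · exact Or.inr ⟨h, rfl, rfl⟩
  · rintro ⟨a, ha, x, hx, j, -, hm, h⟩
    obtain ⟨r, rfl⟩ := exists_rank_eq hx hm
    rw [dom_standardCode] at ha
    have hp := pathQ_positions ⟨a, ha⟩ r
    have hv := number_pathVertex ⟨a, ha⟩ r
    simp only at hp hv
    simp only [hp, ← hv, number_injective.eq_iff] at h
    exact ⟨(⟨a, ha⟩, r), j, h⟩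

end PathDigraph

/-! ### Isomorphisms -/

namespace RelStructure

variable {n : ℕ} {ar : Fin n → ℕ} {A B C : Type*} {𝔸 : RelStructure ar A} {𝔹 : RelStructure ar B}
  {𝕊 : RelStructure ar C}

lemma Isomorphic.refl (𝔸 : RelStructure ar A) : 𝔸.Isomorphic 𝔸 :=
  ⟨Equiv.refl A, fun _ _ => Iff.rfl⟩

lemma Isomorphic.trans (h : 𝔸.Isomorphic 𝔹) (h' : 𝔹.Isomorphic 𝕊) : 𝔸.Isomorphic 𝕊 := by
  obtain ⟨φ, hφ⟩ := h
  obtain ⟨ψ, hψ⟩ := h'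
  exact ⟨φ.trans ψ, fun i t => (hφ i t).trans (hψ i _)⟩

/-- A bijection of the domains preserves the equalities `a = r_i`, so corresponding pairs have
literally the same oriented path, and interior vertices correspond by their positions. -/
lemma Isomorphic.toDigraph (h : 𝔸.Isomorphic 𝔹) :
    𝔸.toDigraph.toRelStructure.Isomorphic 𝔹.toDigraph.toRelStructure := by
  obtain ⟨φ, hφ⟩ := h
  let ρ : 𝔸.prodRel ≃ 𝔹.prodRel := (Equiv.arrowCongr (Equiv.refl _) φ).subtypeEquiv fun r =>
    forall_congr' fun i => hφ i _
  let ε : A × 𝔸.prodRel ≃ B × 𝔹.prodRel := φ.prodCongr ρ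
  have hε (e : A × 𝔸.prodRel) : 𝔹.edgePath (ε e) = 𝔸.edgePath e := by
    unfold edgePath
    congr 1
    ext i
    exact φ.injective.eq_iff
  let σ : 𝔸.DVertex ≃ 𝔹.DVertex := φ.sumCongr (ρ.sumCongr (ε.sigmaCongr fun e =>
    Equiv.setCongr (by rw [hε])))
  have hσ (e : A × 𝔸.prodRel) (j : ℕ) : σ (𝔸.pathVertex e j) = 𝔹.pathVertex (ε e) j := by
    rcases Nat.eq_zero_or_pos j with rfl | hj
    · rfl
    rcases lt_or_ge j (𝔸.edgePath e).length with h | h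
    · rw [pathVertex_of_mem e ⟨hj, h⟩, pathVertex_of_mem (ε e) ⟨hj, by rwa [hε]⟩]
      rfl
    · rw [pathVertex_of_le e h, pathVertex_of_le (ε e) (by rwa [hε])]
      rfl
  have hadj (u v : 𝔸.DVertex) : 𝔸.toDigraph.Adj u v ↔ 𝔹.toDigraph.Adj (σ u) (σ v) := by
    simp only [RelStructure.toDigraph]
    rw [ε.symm.exists_congr_left]
    simp only [Equiv.symm_symm, hε, ← hσ, σ.injective.eq_iff]
  exact ⟨σ, fun i t => hadj (t 0) (t 1)⟩

end RelStructure

/-! ### The size and the height of `𝓓(𝔸)` -/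

namespace OrientedPath

/-- The number of forward edges minus the number of backward edges among the first `j` edges. -/
def rise (p : OrientedPath) (j : ℕ) : ℤ := ((p.take j).map fun b => if b then 1 else -1).sum

/-- The path leads from its lowest level, `0`, to its highest level, `h`. -/
def Climbs (p : OrientedPath) (h : ℕ) : Prop :=
  (∀ j, 0 ≤ rise p j ∧ rise p j ≤ h) ∧ ∀ j, p.length ≤ j → rise p j = h

lemma rise_zero (p : OrientedPath) : rise p 0 = 0 := by simp [rise]

/-- True for all `j`: before the junction the truncated difference is `0`, and after it `take`
returns all of `p`. -/
lemma rise_append (p q : OrientedPath) (j : ℕ) :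
    rise (p ++ q) j = rise p j + rise q (j - p.length) := by
  simp [rise, List.take_append]

lemma rise_succ {p : OrientedPath} {j : ℕ} {b : Bool} (h : p[j]? = some b) :
    rise p (j + 1) = rise p j + if b then 1 else -1 := by
  simp [rise, List.take_add_one, h]

lemma Climbs.append {p q : OrientedPath} {h h' : ℕ} (hp : Climbs p h) (hq : Climbs q h') :
    Climbs (p ++ q) (h + h') := by
  refine ⟨fun j => ?_, fun j hj => ?_⟩
  · rw [rise_append]
    have h1 := hp.1 j
    have h2 := hq.1 (j - p.length)
    push_cast
    exact ⟨add_nonneg h1.1 h2.1, add_le_add h1.2 h2.2⟩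
  · rw [List.length_append] at hj
    rw [rise_append, hp.2 j (by omega), hq.2 _ (by omega)]
    push_cast
    rfl

lemma climbs_nil : Climbs [] 0 := ⟨fun j => by simp [rise], fun j _ => by simp [rise]⟩

lemma climbs_singleEdge : Climbs singleEdge 1 := by
  refine ⟨fun j => ?_, fun j hj => ?_⟩
  · rcases j with _ | j <;> simp [rise, singleEdge]
  · obtain ⟨j, rfl⟩ := Nat.exists_eq_add_of_le hj
    simp [rise, singleEdge, Nat.add_comm 1]

/-- The levels are `0, 1, 0, 1`. A zigzag thus climbs like a single edge, which is why the height
does not depend on `I`. -/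
lemma climbs_zigzag : Climbs zigzag 1 := by
  refine ⟨fun j => ?_, fun j hj => ?_⟩
  · rcases j with _ | _ | _ | j <;> simp [rise, zigzag]
  · obtain ⟨j, rfl⟩ := Nat.exists_eq_add_of_le hj
    simp [rise, zigzag, Nat.add_comm 3]

lemma Climbs.flatMap {ι : Type*} {f : ι → OrientedPath} (hf : ∀ i, Climbs (f i) 1) (l : List ι) :
    Climbs (l.flatMap f) l.length := by
  induction l with
  | nil => exact climbs_nil
  | cons i l ih =>
    rw [List.flatMap_cons, List.length_cons, Nat.add_comm]
    exact (hf i).append ih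

lemma climbs_pathQ {k : ℕ} (I : Set (Fin k)) : Climbs (pathQ I) (k + 2) := by
  classical
  have h := (climbs_singleEdge.append (Climbs.flatMap (f := fun l => if l ∈ I then singleEdge
    else zigzag) (fun l => by split_ifs; exacts [climbs_singleEdge, climbs_zigzag])
      (List.finRange k))).append climbs_singleEdge
  rw [List.length_finRange] at h
  rw [show k + 2 = 1 + k + 1 by omega, pathQ]
  convert h

end OrientedPath

/-! ### Levels, connectedness, and the counts -/

namespace RelStructure

variable {n : ℕ} {ar : Fin n → ℕ} {A : Type*} {𝔸 : RelStructure ar A}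

lemma climbs_edgePath (e : A × 𝔸.prodRel) :
    OrientedPath.Climbs (𝔸.edgePath e) ((∑ i, ar i) + 2) := OrientedPath.climbs_pathQ _

variable (𝔸) in
/-- The level function of `𝓓(𝔸)`. -/
noncomputable def level : 𝔸.DVertex → ℕ
  | .inl _ => 0
  | .inr (.inl _) => (∑ i, ar i) + 2
  | .inr (.inr ⟨e, j⟩) => (OrientedPath.rise (𝔸.edgePath e) j).toNat

/-- At the ends, which are shared by several paths, the levels agree since every path rises from `0`
to `k + 2`. -/
lemma level_pathVertex (e : A × 𝔸.prodRel) (j : ℕ) :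
    (𝔸.level (𝔸.pathVertex e j) : ℤ) = OrientedPath.rise (𝔸.edgePath e) j := by
  rcases Nat.eq_zero_or_pos j with rfl | hj
  · rw [OrientedPath.rise_zero]
    rfl
  rcases lt_or_ge j (𝔸.edgePath e).length with h | h
  · rw [pathVertex_of_mem e ⟨hj, h⟩]
    exact Int.toNat_of_nonneg ((climbs_edgePath e).1 j).1
  · rw [pathVertex_of_le e h, (climbs_edgePath e).2 j h]
    rfl

lemma level_le (v : 𝔸.DVertex) : 𝔸.level v ≤ (∑ i, ar i) + 2 := by
  rcases v with a | r | ⟨e, j⟩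
  · exact Nat.zero_le _
  · exact le_rfl
  · exact Int.toNat_le.2 ((climbs_edgePath e).1 j).2

lemma isLevelFunction_level [Nonempty A] : 𝔸.toDigraph.IsLevelFunction 𝔸.level := by
  refine ⟨?_, Sum.inl (Classical.arbitrary A), rfl⟩
  rintro u v ⟨e, j, ⟨h, rfl, rfl⟩ | ⟨h, rfl, rfl⟩⟩ <;>
  · have := OrientedPath.rise_succ h
    rw [← level_pathVertex, ← level_pathVertex] at this
    simp at this
    omega

lemma reachable_pathVertex (e : A × 𝔸.prodRel) (j : ℕ) :
    𝔸.toDigraph.toSimpleGraphInclusive.Reachable (Sum.inl e.1) (𝔸.pathVertex e j) := by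
  induction j with
  | zero => exact SimpleGraph.Reachable.refl _
  | succ j ih =>
    refine ih.trans ?_
    by_cases huv : 𝔸.pathVertex e j = 𝔸.pathVertex e (j + 1)
    · rw [huv]
    rcases lt_or_ge j (𝔸.edgePath e).length with h | h
    · refine SimpleGraph.Adj.reachable ?_
      have hj := List.getElem?_eq_getElem h
      refine (SimpleGraph.fromRel_adj _ _ _).2 ⟨huv, ?_⟩
      generalize (𝔸.edgePath e)[j] = b at hj
      cases b
      · exact Or.inr ⟨e, j, Or.inr ⟨hj, rfl, rfl⟩⟩
      · exact Or.inl ⟨e, j, Or.inl ⟨hj, rfl, rfl⟩⟩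
    · rw [pathVertex_of_le e h, pathVertex_of_le e (h.trans (Nat.le_succ j))]

/-- Every vertex is joined along its path to some element of `A`, and every element of `A` to one
fixed tuple. -/
lemma connected_toDigraph [Nonempty A] (h : 𝔸.prodRel.Nonempty) :
    𝔸.toDigraph.toSimpleGraphInclusive.Connected := by
  refine SimpleGraph.connected_iff_exists_forall_reachable _ |>.2
    ⟨Sum.inr (Sum.inl ⟨h.some, h.some_mem⟩), fun v => ?_⟩
  obtain ⟨e, j, -, rfl⟩ := exists_pathVertex h v
  refine SimpleGraph.Reachable.trans (SimpleGraph.Reachable.symm ?_) (reachable_pathVertex e j)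
  rw [← pathVertex_of_le (e.1, ⟨h.some, h.some_mem⟩) le_rfl]
  exact reachable_pathVertex (𝔸 := 𝔸) (e.1, ⟨h.some, h.some_mem⟩) _

lemma hasHeight_toDigraph [Nonempty A] (h : 𝔸.prodRel.Nonempty) :
    𝔸.toDigraph.HasHeight ((∑ i, ar i) + 2) := by
  refine ⟨connected_toDigraph h, 𝔸.level, isLevelFunction_level,
    ⟨Sum.inr (Sum.inl ⟨h.some, h.some_mem⟩), rfl⟩, ?_⟩
  rintro _ ⟨v, rfl⟩
  exact level_le v

lemma eq_of_pathVertex_eq {e e' : A × 𝔸.prodRel} {j j' : ℕ}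
    (hj : j ∈ Set.Ioo 0 (𝔸.edgePath e).length) (h : 𝔸.pathVertex e j = 𝔸.pathVertex e' j') :
    e = e' ∧ j = j' := by
  rw [pathVertex_of_mem e hj] at h
  rcases Nat.eq_zero_or_pos j' with rfl | hj'
  · rw [pathVertex_zero] at h
    cases h
  rcases lt_or_ge j' (𝔸.edgePath e').length with h' | h'
  · rw [pathVertex_of_mem e' ⟨hj', h'⟩] at h
    cases h
    exact ⟨rfl, rfl⟩
  · rw [pathVertex_of_le e' h'] at h
    cases h

lemma pathVertex_injOn (e : A × 𝔸.prodRel) :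
    Set.InjOn (𝔸.pathVertex e) (Set.Iic (𝔸.edgePath e).length) := by
  intro j hj j' hj' h
  have hl := two_le_length_edgePath e
  rw [Set.mem_Iic] at hj hj'
  by_cases hm : j ∈ Set.Ioo 0 (𝔸.edgePath e).length
  · exact (eq_of_pathVertex_eq hm h).2
  by_cases hm' : j' ∈ Set.Ioo 0 (𝔸.edgePath e).length
  · exact (eq_of_pathVertex_eq hm' h.symm).2.symm
  rw [Set.mem_Ioo] at hm hm'
  have h1 : j = 0 ∨ j = (𝔸.edgePath e).length := by omega
  have h2 : j' = 0 ∨ j' = (𝔸.edgePath e).length := by omega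
  rcases h1 with rfl | rfl <;> rcases h2 with rfl | rfl
  · rfl
  · rw [pathVertex_zero, pathVertex_of_le e le_rfl] at h
    cases h
  · rw [pathVertex_zero, pathVertex_of_le e le_rfl] at h
    cases h
  · rfl

variable (𝔸) in
/-- The `j`-th edge of the path `ℙ_e`, as an ordered pair of vertices. -/
noncomputable def arc (p : Σ e : A × 𝔸.prodRel, Fin (𝔸.edgePath e).length) :
    𝔸.DVertex × 𝔸.DVertex :=
  if (𝔸.edgePath p.1)[p.2] then (𝔸.pathVertex p.1 p.2, 𝔸.pathVertex p.1 (p.2 + 1))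
  else (𝔸.pathVertex p.1 (p.2 + 1), 𝔸.pathVertex p.1 p.2)

/-- Paths have at least two edges, so each edge has an interior end, which determines the path. On
one path the vertices are distinct, and edges traversed in opposite directions would require `j = j'
+ 1` and `j + 1 = j'`. -/
lemma arc_injective : Function.Injective 𝔸.arc := by
  rintro ⟨e, j, hj⟩ ⟨e', j', hj'⟩ h
  have hl := two_le_length_edgePath e
  have h' : (𝔸.pathVertex e j = 𝔸.pathVertex e' j' ∧
        𝔸.pathVertex e (j + 1) = 𝔸.pathVertex e' (j' + 1)) ∨
      (𝔸.pathVertex e j = 𝔸.pathVertex e' (j' + 1) ∧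
        𝔸.pathVertex e (j + 1) = 𝔸.pathVertex e' j') := by
    simp only [arc] at h
    split_ifs at h <;> rw [Prod.mk.injEq] at h <;> tauto
  have he : e = e' := by
    rcases Nat.eq_zero_or_pos j with rfl | hj0
    · have hm : 0 + 1 ∈ Set.Ioo 0 (𝔸.edgePath e).length := ⟨by omega, by omega⟩
      rcases h' with h' | h' <;> exact (eq_of_pathVertex_eq hm h'.2).1
    · rcases h' with h' | h' <;> exact (eq_of_pathVertex_eq ⟨hj0, hj⟩ h'.1).1
  subst he
  have hi {i i' : ℕ} (h1 : i ≤ (𝔸.edgePath e).length) (h2 : i' ≤ (𝔸.edgePath e).length)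
    (h : 𝔸.pathVertex e i = 𝔸.pathVertex e i') : i = i' := pathVertex_injOn e h1 h2 h
  rcases h' with ⟨h1, -⟩ | ⟨h1, h2⟩
  · obtain rfl := hi hj.le hj'.le h1
    rfl
  · have := hi hj.le hj' h1
    have := hi hj hj'.le h2
    omega

lemma range_arc : Set.range 𝔸.arc = {p | 𝔸.toDigraph.Adj p.1 p.2} := by
  ext ⟨u, v⟩
  constructor
  · rintro ⟨⟨e, j⟩, h⟩
    have hj := List.getElem?_eq_getElem j.2
    simp only [arc] at h
    split_ifs at h with hb <;> rw [Prod.mk.injEq] at h <;> obtain ⟨rfl, rfl⟩ := h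
    · exact ⟨e, j, Or.inl ⟨hj.trans (congrArg some hb), rfl, rfl⟩⟩
    · exact ⟨e, j, Or.inr ⟨hj.trans (congrArg some (Bool.eq_false_of_not_eq_true hb)), rfl, rfl⟩⟩
  · rintro ⟨e, j, ⟨h, h1, h2⟩ | ⟨h, h1, h2⟩⟩ <;>
    · obtain ⟨hj, hb⟩ := List.getElem?_eq_some_iff.1 h
      refine ⟨⟨e, j, hj⟩, ?_⟩
      simp only at h1 h2
      simp [arc, hb, h1, h2]

variable [Finite A]

/-- A position contributes `1` edge if `a = r_l` and `3` otherwise. Summing over `a` first, with `r`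
fixed, the equality holds exactly once for each `l`. -/
lemma sum_length_edgePath [Fintype (A × 𝔸.prodRel)] :
    ((∑ e, (𝔸.edgePath e).length : ℕ) : ℤ) =
      (3 * (∑ i, ar i : ℕ) + 2) * Nat.card 𝔸.prodRel * Nat.card A
        - 2 * (∑ i, ar i : ℕ) * Nat.card 𝔸.prodRel := by
  classical
  have := Fintype.ofFinite A
  have := Fintype.ofFinite 𝔸.prodRel
  have hlen (e : A × 𝔸.prodRel) : ((𝔸.edgePath e).length : ℤ) =
      2 + ∑ l, (3 - 2 * if e.1 = e.2.1 l then 1 else 0) := by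
    have h (l : Fin (∑ i, ar i)) : ((if l ∈ {l | e.1 = e.2.1 l} then 1 else 3 : ℕ) : ℤ) =
        3 - 2 * if e.1 = e.2.1 l then 1 else 0 := by
      simp only [Set.mem_ofPred_eq]
      split_ifs <;> norm_num
    rw [edgePath, length_pathQ, Nat.cast_add, Nat.cast_sum, Nat.cast_two]
    exact congrArg _ (Finset.sum_congr rfl fun l _ => h l)
  rw [Nat.cast_sum, Finset.sum_congr rfl fun e _ => hlen e]
  have huniv : (Finset.univ : Finset (A × 𝔸.prodRel)) = Finset.univ ×ˢ Finset.univ := by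
    ext; simp
  rw [huniv, Finset.sum_product_right]
  have hr (r : 𝔸.prodRel) : ∑ a : A, (2 + ∑ l, (3 - 2 * if a = r.1 l then (1 : ℤ) else 0)) =
      (3 * (∑ i, ar i : ℕ) + 2) * Nat.card A - 2 * (∑ i, ar i : ℕ) := by
    rw [Finset.sum_add_distrib, Finset.sum_comm]
    simp only [Finset.sum_sub_distrib, ← Finset.mul_sum, Finset.sum_ite_eq', Finset.mem_univ,
      if_true, Finset.sum_const, Finset.card_univ, Fintype.card_fin, nsmul_eq_mul,
      Nat.card_eq_fintype_card]
    ring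
  rw [Finset.sum_congr rfl fun r _ => hr r]
  simp only [Finset.sum_const, Finset.card_univ, nsmul_eq_mul, Nat.card_eq_fintype_card]
  ring

lemma card_toDigraph_adj :
    (Nat.card {p : 𝔸.DVertex × 𝔸.DVertex // 𝔸.toDigraph.Adj p.1 p.2} : ℤ) =
      (3 * (∑ i, ar i : ℕ) + 2) * Nat.card 𝔸.prodRel * Nat.card A
        - 2 * (∑ i, ar i : ℕ) * Nat.card 𝔸.prodRel := by
  have := Fintype.ofFinite (A × 𝔸.prodRel)
  rw [← sum_length_edgePath, Nat.cast_inj]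
  have h : Nat.card {p : 𝔸.DVertex × 𝔸.DVertex // 𝔸.toDigraph.Adj p.1 p.2} =
      Nat.card (Set.range 𝔸.arc) := by
    rw [range_arc]
    rfl
  rw [h, Nat.card_congr (Equiv.ofInjective _ arc_injective).symm, Nat.card_sigma]
  simp

/-- A path has one interior vertex fewer than edges, so there are `|A| + |R|` plus the number of
edges minus `|A||R|` vertices. -/
lemma card_dVertex :
    (Nat.card 𝔸.DVertex : ℤ) =
      (3 * (∑ i, ar i : ℕ) + 1) * Nat.card 𝔸.prodRel * Nat.card A
        + (1 - 2 * (∑ i, ar i : ℕ)) * Nat.card 𝔸.prodRel + Nat.card A := by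
  have := Fintype.ofFinite (A × 𝔸.prodRel)
  have h (e : A × 𝔸.prodRel) : (Nat.card (Set.Ioo 0 (𝔸.edgePath e).length) : ℤ) =
      (𝔸.edgePath e).length - 1 := by
    have := two_le_length_edgePath e
    rw [Nat.card_coe_set_eq, Set.ncard_eq_toFinset_card', Set.toFinset_Ioo, Nat.card_Ioo]
    omega
  have hs := sum_length_edgePath (𝔸 := 𝔸)
  rw [Nat.cast_sum] at hs
  rw [Nat.card_sum, Nat.card_sum, Nat.card_sigma, Nat.cast_add, Nat.cast_add, Nat.cast_sum,
    Finset.sum_congr rfl fun e _ => h e, Finset.sum_sub_distrib, hs, Finset.sum_const,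
    Finset.card_univ, ← Nat.card_eq_fintype_card, Nat.card_prod, nsmul_eq_mul]
  push_cast
  ring

end RelStructure

/-! ### Codes of isomorphic structures -/

namespace Encoding

variable {n : ℕ} {ar : Fin n → ℕ} {Γ : Type} {E : Encoding ar Γ} {A B : Type*}
  {𝔸 : RelStructure ar A} {𝔹 : RelStructure ar B}

lemma Codes.of_isomorphic {w : List Γ} (h : E.Codes w 𝔸) (h' : 𝔸.Isomorphic 𝔹) : E.Codes w 𝔹 := by
  obtain ⟨𝕊, hS, hw⟩ := h
  exact ⟨𝕊, hS.trans h', hw⟩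

/-- Three word functions are composed: from `E` to the standard code, from there to the standard
code of the digraph, and from there to `F`. -/
lemma logspaceConstructible_toDigraph {Δ : Type} [Finite Γ] [Finite Δ]
    {F : Encoding digraphSignature Δ} (hE : E.Reasonable) (hF : F.Reasonable) :
    LogspaceConstructible (fun w (𝔸 : FinRelStructure ar) => E.Codes w 𝔸.str)
      (fun v 𝔸 => F.Codes v 𝔸.str.toDigraph.toRelStructure) := by
  obtain ⟨T, c, hT⟩ := hE.1
  obtain ⟨T', c', hT'⟩ := hF.2
  -- `W` is total and agrees with the output of the transducer wherever the space bound holds, in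
  -- particular on all codes.
  obtain ⟨W, hW, hWT⟩ := T.exists_logWord c
  obtain ⟨W', hW', hWT'⟩ := T'.exists_logWord c'
  obtain ⟨M, d, hM⟩ := (hW'.comp ((PathDigraph.logWord_code ar).comp hW)).exists_transducer
  refine ⟨M, d, fun 𝔸 w hw => ⟨_, ?_, hM w⟩⟩
  obtain ⟨v, ⟨𝔹, h𝔹, hv⟩, hTv⟩ := hT 𝔸 w hw
  obtain rfl := hWT w v hTv
  obtain ⟨𝔾, h𝔾, hG⟩ := PathDigraph.codes_code 𝔹
  rw [← show W w = standardCode 𝔹 from hv] at hG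
  -- The standard codes belong to the isomorphic copies `𝔹` and `𝔾`; the way back to `𝔸` is the
  -- isomorphism in the last line.
  obtain ⟨v', hv', hTv'⟩ := hT' 𝔾 _ ⟨𝔾, .refl _, hG⟩
  rw [hWT' _ v' hTv']
  exact hv'.of_isomorphic (h𝔾.trans h𝔹.toDigraph)

end Encoding

theorem proposition3p4 {n : ℕ} (ar : Fin n → ℕ) :
    (∀ {A : Type*} [Finite A] [Nonempty A] (𝔸 : RelStructure ar A),
      (∀ i, (𝔸.rel i).Nonempty) →
        (Nat.card 𝔸.DVertex : ℤ) =
            (3 * (∑ i, ar i : ℕ) + 1) * Nat.card 𝔸.prodRel * Nat.card A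
              + (1 - 2 * (∑ i, ar i : ℕ)) * Nat.card 𝔸.prodRel + Nat.card A ∧
        (Nat.card {p : 𝔸.DVertex × 𝔸.DVertex // 𝔸.toDigraph.Adj p.1 p.2} : ℤ) =
            (3 * (∑ i, ar i : ℕ) + 2) * Nat.card 𝔸.prodRel * Nat.card A
              - 2 * (∑ i, ar i : ℕ) * Nat.card 𝔸.prodRel ∧
        𝔸.toDigraph.HasHeight ((∑ i, ar i) + 2)) ∧
    (∀ {Γ Δ : Type} [Finite Γ] [Finite Δ] (E : Encoding ar Γ) (F : Encoding digraphSignature Δ),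
      E.Reasonable → F.Reasonable →
        LogspaceConstructible (fun w (𝔸 : FinRelStructure ar) => E.Codes w 𝔸.str)
          (fun v 𝔸 => F.Codes v 𝔸.str.toDigraph.toRelStructure)) := by
  refine ⟨fun 𝔸 h𝔸 => ⟨RelStructure.card_dVertex, RelStructure.card_toDigraph_adj,
    RelStructure.hasHeight_toDigraph (RelStructure.prodRel_nonempty h𝔸)⟩, fun E F hE hF => ?_⟩
  exact Encoding.logspaceConstructible_toDigraph hE hF
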